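/- All vector spaces are over $\mathbb{Q}$. A \emph{diagram} is a finite graph (possibly empty or disconnected) with trivalent and univalent vertices, each trivalent vertex being oriented (a cyclic order of its three incident edge-ends). The univalent vertices are called legs. All spaces of diagrams are taken modulo isomorphism and the AS and IHX relations. \emph{The space $\mathcal{B}$.} $\mathcal{B}$ is spanned by diagrams with unordered legs. $\mathcal{B}^{i}$ is spanned by the diagrams with $n$ legs, $2n=i$ (each leg has grade 2). The product $\sqcup$ is the bilinear extension of disjoint union. \emph{The non-commutative Weil complex $\widetilde{\mathcal{W}}$.} It is spanned by diagrams whose legs are linearly ordered (left to right), each leg having grade $1$ or $2$. $\widetilde{\mathcal{W}}^{i}$ is spanned by the diagrams of total leg-grade $i$ (so it is $0$ for $i<0$). The product $\#$ is disjoint union, with the legs of the second factor placed to the right of those of the first. The differential $d:\widetilde{\mathcal{W}}^{i}\to\widetilde{\mathcal{W}}^{i+1}$ is the sum over legs, with sign $(-1)^{\text{sum of the grades of the legs to the left}}$, of the following operation: a grade-1 leg becomes a grade-2 leg, and a grade-2 leg contributes $0$. The map $\iota:\widetilde{\mathcal{W}}^{i}\to\widetilde{\mathcal{W}}_{\iota}^{i-1}$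 has values in the analogous space of diagrams with exactly one additional distinguished leg, labelled $\iota$, outside the order and of grade $0$. It is the sum over legs, with the same signs, of the following operation: a grade-1 leg is taken out of the order and becomes the leg $\iota$. A grade-2 leg is cut and replaced by a trivalent vertex with cyclic order (edge to the rest of the diagram, leg $\iota$, new grade-1 leg), the new grade-1 leg taking the place of the old one. \emph{The commutative Weil complex $\mathcal{W}$.} It is the quotient of $\widetilde{\mathcal{W}}$ by the relations that two adjacent legs of grades $p,q$ may be transposed at the cost of the sign $(-1)^{pq}$. The map $\chi_{\mathcal{W}}:\mathcal{W}\to\widetilde{\mathcal{W}}$ sends a diagram with $n$ legs to $\frac1{n!}$ times the sum over the $n!$ orderings of its legs, each with the sign by which the legs are permuted to that ordering. \emph{The map $\Upsilon:\mathcal{B}\to\mathcal{W}$.} Order the legs of a diagram arbitrarily and replace each leg by its curvature, namely (a leg of grade 2) $-\frac12$ (a fork), and expand linearly. The fork is a trivalent vertex with cyclic order (edge to the rest of the diagram, left tine, right tine), whose two tines are consecutive legs of grade 1, the left one first, in the place of the replaced leg. \emph{Basic cohomology.} The basic subcomplex is $\widetilde{\mathcal{W}}_{\rm basic}=\ker\iota$,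 with the differential $d$. Write $H^{i}(\widetilde{\mathcal{W}}_{\rm basic})$ for its cohomology. \textbf{Theorem (Homological Wheeling).} (1) Let $v\in\mathcal{B}^{i}$ and $w\in\mathcal{B}^{j}$. Then there is an element $x_{v,w}\in\widetilde{\mathcal{W}}^{i+j-1}$ with $\iota(x_{v,w})=0$ and $$(\chi_{\mathcal{W}}\circ\Upsilon)(v)\ \#\ (\chi_{\mathcal{W}}\circ\Upsilon)(w)=(\chi_{\mathcal{W}}\circ\Upsilon)(v\sqcup w)+d(x_{v,w}).$$ (2) Equivalently: for $v\in\mathcal{B}^{i}$ the element $(\chi_{\mathcal{W}}\circ\Upsilon)(v)$ is a basic cocycle of grade $i$, so that $\mathbf{H}^{i}(v)=[(\chi_{\mathcal{W}}\circ\Upsilon)(v)]$ defines a linear map $\mathbf{H}^{i}:\mathcal{B}^{i}\to H^{i}(\widetilde{\mathcal{W}}_{\rm basic})$, and for $v\in\mathcal{B}^{i}$, $w\in\mathcal{B}^{j}$ $$\mathbf{H}^{i+j}(v\sqcup w)=\mathbf{H}^{i}(v)\ \#\ \mathbf{H}^{j}(w),$$ where the product on the right is induced by $\#$ on representatives: for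 all basic cocycles $a$ representing $\mathbf{H}^{i}(v)$ and $b$ representing $\mathbf{H}^{j}(w)$, the element $a\,\#\,b$ is a basic cocycle, and it represents $\mathbf{H}^{i+j}(v\sqcup w)$. -/

import Mathlib

namespace Wheeling

/-- A perfect matching of `H`: a fixed-point-free involution. -/
@[ext] structure Matching (H : Type) where
  mate : H → H
  mate_mate : ∀ h, mate (mate h) = h
  mate_ne : ∀ h, mate h ≠ h

namespace Matching
variable {H H' H'' K K' : Type}

/-- Transport of a matching along a bijection. -/
def map (e : H ≃ H') (M : Matching H) : Matching H' where
  mate h := e (M.mate (e.symm h))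
  mate_mate h := by simp [M.mate_mate]
  mate_ne h := by
    intro hh
    exact M.mate_ne (e.symm h) (by rw [← e.symm_apply_apply (M.mate (e.symm h)), hh])

/-- The disjoint union of two matchings. -/
def sum (M : Matching H) (N : Matching K) : Matching (H ⊕ K) where
  mate := Sum.map M.mate N.mate
  mate_mate h := by cases h <;> simp [M.mate_mate, N.mate_mate]
  mate_ne h := by cases h <;> simp [M.mate_ne, N.mate_ne]

open Classical in
/-- The strand ending at `x` is made to end at `y`, and vice versa. -/
noncomputable def exchange (M : Matching H) (x y : H) : Matching H :=
  M.map (Equiv.swap x y)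

theorem map_map (e : H ≃ H') (e' : H' ≃ H'') (M : Matching H) :
    (M.map e).map e' = M.map (e.trans e') := rfl

theorem map_refl (M : Matching H) : M.map (Equiv.refl H) = M := rfl

theorem map_mate (e : H ≃ H') (M : Matching H) (h : H) :
    (M.map e).mate (e h) = e (M.mate h) := by simp [map]

theorem map_exchange (e : H ≃ H') (M : Matching H) (x y : H) :
    (M.exchange x y).map e = (M.map e).exchange (e x) (e y) := by
  classical
  unfold exchange
  rw [map_map, map_map]
  congr 1
  ext k
  simp only [Equiv.trans_apply]
  exact (e.injective.swap_apply x y k).symm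

theorem sum_map (e : H ≃ H') (f : K ≃ K') (M : Matching H) (N : Matching K) :
    (M.map e).sum (N.map f) = (M.sum N).map (Equiv.sumCongr e f) := by
  ext h
  cases h <;> rfl

theorem sum_exchange (M : Matching H) (N : Matching K) (x y : H) :
    (M.exchange x y).sum N = (M.sum N).exchange (Sum.inl x) (Sum.inl y) := by
  classical
  have := sum_map (Equiv.swap x y) (Equiv.refl K) M N
  rw [map_refl] at this
  unfold exchange
  convert this using 2
  ext k
  rcases k with k | k
  · simp only [Equiv.sumCongr_apply, Sum.map_inl]
    convert (Sum.inl_injective (β := K)).swap_apply x y k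
  · simp [Equiv.swap_apply_of_ne_of_ne]

end Matching

/-- The half-edges and leg ends of a diagram with set of trivalent vertices `V` and legs named by `L`:
the cyclically ordered half-edges `(v, 0), (v, 1), (v, 2)` at each vertex `v` (counter-clockwise in
a planar picture), and one univalent end for each leg. -/
abbrev HalfEdge (V L : Type) : Type := (V × Fin 3) ⊕ L

/-- A uni-trivalent diagram with oriented trivalent vertices and univalent vertices (legs) named by
`L`: the edges match the half-edges in pairs. It need not be connected, may be empty, may have
components without legs, and may have struts (an edge which joins two legs). -/
structure Diagram (L : Type) : Type 1 where
  V : Type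
  [finite : Finite V]
  edges : Matching (HalfEdge V L)

/-- The bijection of half-edges induced by a bijection `e` of the vertex sets, which turns the
cyclically ordered triple at the vertex `v` through `r v` steps and fixes the legs. -/
def HalfEdge.congr {V V' : Type} (L : Type) (e : V ≃ V') (r : V → Fin 3) :
    HalfEdge V L ≃ HalfEdge V' L :=
  Equiv.sumCongr (Equiv.prodShear e fun v => Equiv.addRight (r v)) (Equiv.refl L)

/-- The relations between diagrams: isomorphic diagrams are equal (the orientation of a vertex is only
a cyclic order), reversing the orientation of one vertex changes the sign (AS), and, if the edge at
`v` in position `0` is the edge at `w` in position `0`, the three diagrams obtained by cyclically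
permuting the other two strands at `v` and the strand at `w` in position `1` add up to zero: with
`[a, b]` for a vertex, `[[a, b], c] + [[c, a], b] + [[b, c], a] = 0` (IHX). -/
inductive Diagram.Rel (L : Type) : (Diagram L →₀ ℚ) → Prop
  | iso (V V' : Type) [Finite V] [Finite V'] (e : V ≃ V') (r : V → Fin 3)
      (M : Matching (HalfEdge V L)) :
      Rel L (Finsupp.single ⟨V, M⟩ 1 - Finsupp.single ⟨V', M.map (HalfEdge.congr L e r)⟩ 1)
  | antisymmetry (V : Type) [Finite V] (M : Matching (HalfEdge V L)) (v : V) :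
      Rel L (Finsupp.single ⟨V, M⟩ 1 +
        Finsupp.single ⟨V, M.exchange (.inl (v, 1)) (.inl (v, 2))⟩ 1)
  | ihx (V : Type) [Finite V] (M : Matching (HalfEdge V L)) (v w : V)
      (h : M.mate (.inl (v, 0)) = .inl (w, 0)) :
      Rel L (Finsupp.single ⟨V, M⟩ 1 +
        Finsupp.single ⟨V, (M.exchange (.inl (v, 2)) (.inl (w, 1))).exchange
          (.inl (v, 1)) (.inl (v, 2))⟩ 1 +
        Finsupp.single ⟨V, (M.exchange (.inl (v, 1)) (.inl (v, 2))).exchange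
          (.inl (v, 2)) (.inl (w, 1))⟩ 1)

/-- The rational vector space of diagrams with legs named by `L`, modulo AS and IHX. -/
def JSpace (L : Type) : Type 1 :=
  (Diagram L →₀ ℚ) ⧸ Submodule.span ℚ {z | Diagram.Rel L z}

namespace JSpace
variable {V V' L : Type} [Finite V] [Finite V']

noncomputable instance (L : Type) : AddCommGroup (JSpace L) :=
  Submodule.Quotient.addCommGroup (Submodule.span ℚ {z | Diagram.Rel L z})

noncomputable instance (L : Type) : Module ℚ (JSpace L) :=
  Submodule.Quotient.module (Submodule.span ℚ {z | Diagram.Rel L z})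

/-- The quotient map. -/
noncomputable def ofComb (L : Type) : (Diagram L →₀ ℚ) →ₗ[ℚ] JSpace L :=
  (Submodule.span ℚ {z | Diagram.Rel L z}).mkQ

theorem ofComb_rel {L : Type} {z : Diagram L →₀ ℚ} (h : Diagram.Rel L z) : ofComb L z = 0 :=
  (Submodule.Quotient.mk_eq_zero _).2 (Submodule.subset_span h)

/-- The class of a diagram. -/
noncomputable def mk (M : Matching (HalfEdge V L)) : JSpace L :=
  ofComb L (Finsupp.single ⟨V, M⟩ 1)

theorem mk_congr (e : V ≃ V') (r : V → Fin 3) (M : Matching (HalfEdge V L)) :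
    mk (M.map (HalfEdge.congr L e r)) = mk M := by
  symm
  rw [← sub_eq_zero, mk, mk, ← map_sub]
  exact ofComb_rel (.iso V V' e r M)

theorem mk_antisymmetry (M : Matching (HalfEdge V L)) (v : V) :
    mk M + mk (M.exchange (.inl (v, 1)) (.inl (v, 2))) = 0 := by
  rw [mk, mk, ← map_add]
  exact ofComb_rel (.antisymmetry V M v)

theorem mk_ihx (M : Matching (HalfEdge V L)) (v w : V)
    (h : M.mate (.inl (v, 0)) = .inl (w, 0)) :
    mk M + mk ((M.exchange (.inl (v, 2)) (.inl (w, 1))).exchange (.inl (v, 1)) (.inl (v, 2))) +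
      mk ((M.exchange (.inl (v, 1)) (.inl (v, 2))).exchange (.inl (v, 2)) (.inl (w, 1))) = 0 := by
  rw [mk, mk, mk, ← map_add, ← map_add]
  exact ofComb_rel (.ihx V M v w h)

/-- Linear extension of a function on diagrams that respects the relations. -/
noncomputable def lift {L : Type} {A : Type*} [AddCommGroup A] [Module ℚ A]
    (f : ∀ (V : Type) [Finite V], Matching (HalfEdge V L) → A)
    (hiso : ∀ (V V' : Type) [Finite V] [Finite V'] (e : V ≃ V') (r : V → Fin 3)
      (M : Matching (HalfEdge V L)), f V' (M.map (HalfEdge.congr L e r)) = f V M)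
    (has : ∀ (V : Type) [Finite V] (M : Matching (HalfEdge V L)) (v : V),
      f V M + f V (M.exchange (.inl (v, 1)) (.inl (v, 2))) = 0)
    (hihx : ∀ (V : Type) [Finite V] (M : Matching (HalfEdge V L)) (v w : V),
      M.mate (.inl (v, 0)) = .inl (w, 0) →
      f V M +
        f V ((M.exchange (.inl (v, 2)) (.inl (w, 1))).exchange (.inl (v, 1)) (.inl (v, 2))) +
        f V ((M.exchange (.inl (v, 1)) (.inl (v, 2))).exchange (.inl (v, 2)) (.inl (w, 1))) = 0) :
    JSpace L →ₗ[ℚ] A :=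
  (Submodule.span ℚ {z | Diagram.Rel L z}).liftQ
    (Finsupp.linearCombination ℚ fun D : Diagram L => @f D.V D.finite D.edges) (by
      rw [Submodule.span_le]
      rintro z (⟨V, V', e, r, M⟩ | ⟨V, M, v⟩ | ⟨V, M, v, w, h⟩)
      · simp [hiso V V' e r M]
      · simpa using has V M v
      · simpa using hihx V M v w h)

@[simp] theorem lift_mk {L : Type} {A : Type*} [AddCommGroup A] [Module ℚ A]
    (f : ∀ (V : Type) [Finite V], Matching (HalfEdge V L) → A) (h1 h2 h3)
    (M : Matching (HalfEdge V L)) : lift f h1 h2 h3 (mk M) = f V M := by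
  refine (Submodule.liftQ_apply _ _ _).trans ?_
  simp

theorem hom_ext {L : Type} {A : Type*} [AddCommGroup A] [Module ℚ A] {f g : JSpace L →ₗ[ℚ] A}
    (h : ∀ (V : Type) [Finite V] (M : Matching (HalfEdge V L)), f (mk M) = g (mk M)) :
    f = g := by
  refine Submodule.linearMap_qext _ ?_
  ext ⟨V, M⟩
  exact h V M

end JSpace


/-! ### Operations on diagrams -/

section
variable {V V' L L' L'' : Type}

/-- Renaming the legs. -/
def Matching.relabel (σ : L ≃ L') (M : Matching (HalfEdge V L)) : Matching (HalfEdge V L') :=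
  M.map (Equiv.sumCongr (Equiv.refl _) σ)

/-- A piece of diagram that can be attached to the legs of any diagram with legs `L`, giving a diagram
with legs `L'`. It has trivalent vertices `U`, and a matching of additional half-edges `K`; `ends`
says at which vertex position, or at which new leg, each strand that ended in the leg `l : L`, and
each half-edge of `K`, now ends. -/
structure Context (L L' : Type) : Type 1 where
  U : Type
  [finite : Finite U]
  K : Type
  edges : Matching K
  ends : L ⊕ K ≃ (U × Fin 3) ⊕ L'

attribute [instance] Context.finite

/-- The half-edges of the diagram obtained by attaching `C`. -/
def Context.place (C : Context L L') (V : Type) :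
    HalfEdge V L ⊕ C.K ≃ HalfEdge (V ⊕ C.U) L' :=
  (Equiv.sumAssoc (V × Fin 3) L C.K).trans <|
    (Equiv.sumCongr (Equiv.refl _) C.ends).trans <|
      (Equiv.sumAssoc (V × Fin 3) (C.U × Fin 3) L').symm.trans <|
        Equiv.sumCongr (Equiv.sumProdDistrib V C.U (Fin 3)).symm (Equiv.refl _)

/-- The result of attaching `C` to a diagram. -/
def Matching.insert (C : Context L L') (M : Matching (HalfEdge V L)) :
    Matching (HalfEdge (V ⊕ C.U) L') :=
  (M.sum C.edges).map (C.place V)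

theorem Context.place_inl_inl (C : Context L L') (V : Type) (p : V × Fin 3) :
    C.place V (.inl (.inl p)) = .inl (.inl p.1, p.2) := rfl

theorem Context.place_inl_inr (C : Context L L') (V : Type) (l : L) :
    C.place V (.inl (.inr l)) = Sum.map (fun q => (.inr q.1, q.2)) id (C.ends (.inl l)) := by
  simp only [Context.place, Equiv.trans_apply, Equiv.sumAssoc_apply_inl_inr,
    Equiv.sumCongr_apply, Sum.map_inr]
  cases C.ends (.inl l) <;> rfl

theorem Context.place_inr (C : Context L L') (V : Type) (k : C.K) :
    C.place V (.inr k) = Sum.map (fun q => (.inr q.1, q.2)) id (C.ends (.inr k)) := by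
  simp only [Context.place, Equiv.trans_apply, Equiv.sumAssoc_apply_inr,
    Equiv.sumCongr_apply, Sum.map_inr]
  cases C.ends (.inr k) <;> rfl

theorem Context.place_congr (C : Context L L') (e : V ≃ V') (r : V → Fin 3) :
    (C.place V).trans (HalfEdge.congr L' (Equiv.sumCongr e (Equiv.refl C.U)) (Sum.elim r 0)) =
      (Equiv.sumCongr (HalfEdge.congr L e r) (Equiv.refl C.K)).trans (C.place V') := by
  ext x
  rcases x with (p | l) | k
  · rfl
  · simp only [Equiv.trans_apply, Context.place_inl_inr, HalfEdge.congr, Equiv.sumCongr_apply,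
      Sum.map_inl, Sum.map_inr, Equiv.refl_apply]
    cases C.ends (.inl l) <;> simp
  · simp only [Equiv.trans_apply, Context.place_inr, HalfEdge.congr, Equiv.sumCongr_apply,
      Sum.map_inr, Equiv.refl_apply]
    cases C.ends (.inr k) <;> simp

theorem HalfEdge.congr_relabel (σ : L ≃ L') (e : V ≃ V') (r : V → Fin 3) :
    (Equiv.sumCongr (Equiv.refl (V × Fin 3)) σ).trans (HalfEdge.congr L' e r) =
      (HalfEdge.congr L e r).trans (Equiv.sumCongr (Equiv.refl (V' × Fin 3)) σ) := by
  ext x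
  cases x <;> rfl

theorem Matching.insert_exchange (C : Context L L') (M : Matching (HalfEdge V L))
    (p q : V × Fin 3) :
    (M.exchange (.inl p) (.inl q)).insert C =
      (M.insert C).exchange (.inl (.inl p.1, p.2)) (.inl (.inl q.1, q.2)) := by
  unfold Matching.insert
  rw [Matching.sum_exchange, Matching.map_exchange]
  rfl

theorem Matching.relabel_exchange (σ : L ≃ L') (M : Matching (HalfEdge V L))
    (p q : V × Fin 3) :
    (M.exchange (.inl p) (.inl q)).relabel σ = (M.relabel σ).exchange (.inl p) (.inl q) := by
  unfold Matching.relabel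
  rw [Matching.map_exchange]
  rfl

/-- Renaming the legs, on combinations of diagrams. -/
noncomputable def JSpace.relabel (σ : L ≃ L') : JSpace L →ₗ[ℚ] JSpace L' :=
  JSpace.lift (fun _ _ M => JSpace.mk (M.relabel σ))
    (fun V V' _ _ e r M => by
      rw [← JSpace.mk_congr e r]
      unfold Matching.relabel
      rw [Matching.map_map, Matching.map_map, HalfEdge.congr_relabel])
    (fun V _ M v => by
      rw [Matching.relabel_exchange]
      exact JSpace.mk_antisymmetry _ v)
    (fun V _ M v w h => by
      simp only [Matching.relabel_exchange]
      refine JSpace.mk_ihx _ v w ?_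
      exact congrArg (Equiv.sumCongr (Equiv.refl (V × Fin 3)) σ) h)

/-- Attaching a context, on combinations of diagrams. -/
noncomputable def JSpace.insert (C : Context L L') : JSpace L →ₗ[ℚ] JSpace L' :=
  JSpace.lift (fun _ _ M => JSpace.mk (M.insert C))
    (fun V V' _ _ e r M => by
      rw [← JSpace.mk_congr (Equiv.sumCongr e (Equiv.refl C.U)) (Sum.elim r 0) (M.insert C)]
      unfold Matching.insert
      rw [Matching.map_map, Context.place_congr, ← Matching.map_map, ← Matching.sum_map,
        Matching.map_refl])
    (fun V _ M v => by
      rw [Matching.insert_exchange]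
      exact JSpace.mk_antisymmetry (M.insert C) (.inl v))
    (fun V _ M v w h => by
      simp only [Matching.insert_exchange]
      refine JSpace.mk_ihx (M.insert C) (.inl v) (.inl w) ?_
      have h2 : (M.sum C.edges).mate (.inl (.inl (v, 0))) = .inl (.inl (w, 0)) :=
        congrArg Sum.inl h
      have h3 := Matching.map_mate (C.place V) (M.sum C.edges) (.inl (.inl (v, 0)))
      rw [h2] at h3
      exact h3)

@[simp] theorem JSpace.relabel_mk [Finite V] (σ : L ≃ L') (M : Matching (HalfEdge V L)) :
    JSpace.relabel σ (JSpace.mk M) = JSpace.mk (M.relabel σ) := JSpace.lift_mk _ _ _ _ M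

@[simp] theorem JSpace.insert_mk [Finite V] (C : Context L L') (M : Matching (HalfEdge V L)) :
    JSpace.insert C (JSpace.mk M) = JSpace.mk (M.insert C) := JSpace.lift_mk _ _ _ _ M

theorem JSpace.relabel_relabel (σ : L ≃ L') (τ : L' ≃ L'') (x : JSpace L) :
    JSpace.relabel τ (JSpace.relabel σ x) = JSpace.relabel (σ.trans τ) x := by
  refine LinearMap.congr_fun (f := (JSpace.relabel τ).comp (JSpace.relabel σ)) ?_ x
  refine JSpace.hom_ext fun V _ M => ?_
  simp only [LinearMap.comp_apply, JSpace.relabel_mk]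
  unfold Matching.relabel
  rw [Matching.map_map]
  congr 2
  ext k; cases k <;> rfl

theorem JSpace.relabel_refl (x : JSpace L) : JSpace.relabel (Equiv.refl L) x = x := by
  refine LinearMap.congr_fun (g := LinearMap.id) ?_ x
  refine JSpace.hom_ext fun V _ M => ?_
  simp only [JSpace.relabel_mk, LinearMap.id_apply]
  unfold Matching.relabel
  rw [Equiv.sumCongr_refl, Matching.map_refl]

end


section
variable {V V' L L' : Type}

/-- The half-edges of a disjoint union. -/
def HalfEdge.union (V V' L L' : Type) :
    HalfEdge V L ⊕ HalfEdge V' L' ≃ HalfEdge (V ⊕ V') (L ⊕ L') :=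
  (Equiv.sumSumSumComm (V × Fin 3) L (V' × Fin 3) L').trans <|
    Equiv.sumCongr (Equiv.sumProdDistrib V V' (Fin 3)).symm (Equiv.refl _)

/-- The disjoint union of two diagrams. -/
def Matching.union (M : Matching (HalfEdge V L)) (M' : Matching (HalfEdge V' L')) :
    Matching (HalfEdge (V ⊕ V') (L ⊕ L')) :=
  (M.sum M').map (HalfEdge.union V V' L L')

/-- Putting the diagram `M'` beside a diagram. -/
def Context.beside (L : Type) [Finite V'] (M' : Matching (HalfEdge V' L')) :
    Context L (L ⊕ L') where
  U := V'
  K := HalfEdge V' L'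
  edges := M'
  ends := (Equiv.sumAssoc L (V' × Fin 3) L').symm.trans <|
    (Equiv.sumCongr (Equiv.sumComm L (V' × Fin 3)) (Equiv.refl L')).trans <|
      Equiv.sumAssoc (V' × Fin 3) L L'

theorem Matching.insert_beside [Finite V'] (M : Matching (HalfEdge V L))
    (M' : Matching (HalfEdge V' L')) : M.insert (.beside L M') = M.union M' := by
  unfold Matching.insert Matching.union
  have : (Context.beside L M').place V = HalfEdge.union V V' L L' := by
    ext x; rcases x with (p | l) | (p | l) <;> rfl
  rw [this]
  rfl

theorem JSpace.mk_union_comm [Finite V] [Finite V'] (M : Matching (HalfEdge V L))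
    (M' : Matching (HalfEdge V' L')) :
    JSpace.mk (M.union M') = JSpace.relabel (Equiv.sumComm L' L) (JSpace.mk (M'.union M)) := by
  rw [JSpace.relabel_mk, ← JSpace.mk_congr (Equiv.sumComm V' V) 0]
  congr 1
  unfold Matching.union Matching.relabel
  have : M.sum M' = (M'.sum M).map (Equiv.sumComm _ _) := by
    ext x; rcases x with x | x <;> rfl
  rw [this, Matching.map_map, Matching.map_map, Matching.map_map]
  congr 1
  ext x; rcases x with (p | l) | (p | l) <;> simp [HalfEdge.union, HalfEdge.congr]

/-- The disjoint union, extended bilinearly. -/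
noncomputable def JSpace.union : JSpace L →ₗ[ℚ] JSpace L' →ₗ[ℚ] JSpace (L ⊕ L') :=
  have key : ∀ (V V' : Type) [Finite V] [Finite V'] (M : Matching (HalfEdge V L))
      (M' : Matching (HalfEdge V' L')), JSpace.insert (.beside L M') (JSpace.mk M) =
        (JSpace.relabel (Equiv.sumComm L' L) ∘ₗ JSpace.insert (.beside L' M)) (JSpace.mk M') := by
    intro V V' _ _ M M'
    rw [JSpace.insert_mk, LinearMap.comp_apply, JSpace.insert_mk, Matching.insert_beside,
      Matching.insert_beside]
    exact JSpace.mk_union_comm M M'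
  (JSpace.lift (A := JSpace L →ₗ[ℚ] JSpace (L ⊕ L'))
    (fun _ _ M' => JSpace.insert (Context.beside L M'))
    (fun V V' _ _ e r M' => by
      refine JSpace.hom_ext fun W _ M => ?_
      rw [key, key, JSpace.mk_congr])
    (fun V _ M' v => by
      refine JSpace.hom_ext fun W _ M => ?_
      rw [LinearMap.add_apply, key, key, ← map_add, JSpace.mk_antisymmetry, map_zero,
        LinearMap.zero_apply])
    (fun V _ M' v w h => by
      refine JSpace.hom_ext fun W _ M => ?_
      rw [LinearMap.add_apply, LinearMap.add_apply, key, key, key, ← map_add, ← map_add,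
        JSpace.mk_ihx M' v w h, map_zero, LinearMap.zero_apply])).flip

@[simp] theorem JSpace.union_mk [Finite V] [Finite V'] (M : Matching (HalfEdge V L))
    (M' : Matching (HalfEdge V' L')) :
    JSpace.union (JSpace.mk M) (JSpace.mk M') = JSpace.mk (M.union M') := by
  unfold JSpace.union
  rw [LinearMap.flip_apply, JSpace.lift_mk, JSpace.insert_mk, Matching.insert_beside]
  rfl

/-- For a fork on each leg `s` of `S`: the strand of `s` ends in position `0` of a new vertex, the left
tine starts in position `1` and ends in the new leg `inr s`, the right tine starts in position `2`
and ends in the leg `inl s`. Legs not in `S` are unchanged. -/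
def forkEnds [DecidableEq L] (S : Finset L) :
    L ⊕ (S × Bool × Bool) ≃ (S × Fin 3) ⊕ (L ⊕ S) where
  toFun := fun
    | .inl l => if h : l ∈ S then .inl (⟨l, h⟩, 0) else .inr (.inl l)
    | .inr (s, false, false) => .inl (s, 1)
    | .inr (s, true, false) => .inl (s, 2)
    | .inr (s, false, true) => .inr (.inr s)
    | .inr (s, true, true) => .inr (.inl s)
  invFun := fun
    | .inl (s, 0) => .inl s
    | .inl (s, 1) => .inr (s, false, false)
    | .inl (s, 2) => .inr (s, true, false)
    | .inr (.inl l) => if h : l ∈ S then .inr (⟨l, h⟩, true, true) else .inl l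
    | .inr (.inr s) => .inr (s, false, true)
  left_inv := by
    rintro (l | ⟨s, b, c⟩)
    · by_cases h : l ∈ S <;> simp [h]
    · cases b <;> cases c <;> simp
  right_inv := by
    rintro (⟨s, i⟩ | l | s)
    · fin_cases i <;> simp
    · by_cases h : l ∈ S <;> simp [h]
    · simp

/-- A fork is grafted onto each leg in `S`. -/
def forkContext [DecidableEq L] (S : Finset L) : Context L (L ⊕ S) where
  U := S
  K := S × Bool × Bool
  edges :=
    { mate := fun k => (k.1, k.2.1, !k.2.2)
      mate_mate := by simp
      mate_ne := by rintro ⟨s, b, c⟩; cases c <;> simp }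
  ends := forkEnds S

theorem forkEnds_mem [DecidableEq L] (S : Finset L) (l : L) (h : l ∈ S) :
    forkEnds S (.inl l) = .inl (⟨l, h⟩, 0) := dif_pos h

theorem forkEnds_not_mem [DecidableEq L] (S : Finset L) (l : L) (h : l ∉ S) :
    forkEnds S (.inl l) = .inr (.inl l) := dif_neg h

theorem JSpace.union_relabel {K K' : Type} (σ : L ≃ K) (τ : L' ≃ K') (x : JSpace L)
    (y : JSpace L') : JSpace.union (JSpace.relabel σ x) (JSpace.relabel τ y) =
      JSpace.relabel (Equiv.sumCongr σ τ) (JSpace.union x y) := by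
  have : (JSpace.union.compl₁₂ (JSpace.relabel σ) (JSpace.relabel τ)) =
      JSpace.union.compr₂ (JSpace.relabel (Equiv.sumCongr σ τ)) := by
    refine JSpace.hom_ext fun V _ M => JSpace.hom_ext fun V' _ M' => ?_
    simp only [LinearMap.compl₁₂_apply, LinearMap.compr₂_apply, JSpace.relabel_mk,
      JSpace.union_mk]
    congr 1
    unfold Matching.union Matching.relabel
    rw [Matching.sum_map, Matching.map_map, Matching.map_map]
    congr 1
    ext k; rcases k with (p | l) | (p | l) <;> rfl
  exact LinearMap.congr_fun₂ this x y

theorem JSpace.insert_relabel {K K' : Type} (C : Context L K) (C' : Context L' K')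
    (σ : L ≃ L') (τ : K ≃ K') (u : C.U ≃ C'.U) (κ : C.K ≃ C'.K)
    (hκ : ∀ k, C'.edges.mate (κ k) = κ (C.edges.mate k))
    (h : ∀ x, C'.ends (Sum.map σ κ x) = Sum.map (Prod.map u id) τ (C.ends x)) (x : JSpace L) :
    JSpace.insert C' (JSpace.relabel σ x) = JSpace.relabel τ (JSpace.insert C x) := by
  refine LinearMap.congr_fun (f := JSpace.insert C' ∘ₗ JSpace.relabel σ)
    (g := JSpace.relabel τ ∘ₗ JSpace.insert C) ?_ x
  refine JSpace.hom_ext fun V _ M => ?_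
  simp only [LinearMap.comp_apply, JSpace.relabel_mk, JSpace.insert_mk]
  rw [← JSpace.mk_congr (Equiv.sumCongr (Equiv.refl V) u) 0 ((M.insert C).relabel τ)]
  congr 1
  unfold Matching.insert Matching.relabel
  have hκ' : C'.edges = C.edges.map κ := by
    refine Matching.ext (funext fun k => ?_)
    obtain ⟨k, rfl⟩ := κ.surjective k
    rw [hκ, Matching.map_mate]
  rw [hκ', Matching.sum_map, Matching.map_map, Matching.map_map, Matching.map_map]
  congr 1
  ext k
  rcases k with (p | l) | k
  · simp [Context.place_inl_inl, HalfEdge.congr]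
  · have h1 := h (.inl l)
    simp only [Sum.map_inl] at h1
    simp only [Equiv.trans_apply, Equiv.sumCongr_apply, Sum.map_inl, Sum.map_inr,
      Context.place_inl_inr, h1, HalfEdge.congr]
    rcases C.ends (.inl l) with y | y <;> simp
  · have h1 := h (.inr k)
    simp only [Sum.map_inr] at h1
    simp only [Equiv.trans_apply, Equiv.sumCongr_apply, Sum.map_inr,
      Context.place_inr, h1, HalfEdge.congr]
    rcases C.ends (.inr k) with y | y <;> simp

theorem JSpace.insert_fork_relabel [DecidableEq L] [DecidableEq L'] (σ : L ≃ L') (S : Finset L)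
    (S' : Finset L') (h : ∀ l, l ∈ S ↔ σ l ∈ S') (x : JSpace L) :
    JSpace.insert (forkContext S') (JSpace.relabel σ x) =
      JSpace.relabel (Equiv.sumCongr σ (σ.subtypeEquiv h)) (JSpace.insert (forkContext S) x) := by
  refine JSpace.insert_relabel (forkContext S) (forkContext S') σ _ (σ.subtypeEquiv h)
    (Equiv.prodCongr (σ.subtypeEquiv h) (Equiv.refl (Bool × Bool))) ?_ ?_ x
  · rintro ⟨s, b, c⟩
    rfl
  · rintro (l | ⟨s, b, c⟩)
    · change forkEnds S' (.inl (σ l)) = Sum.map _ _ (forkEnds S (.inl l))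
      by_cases hl : l ∈ S
      · rw [forkEnds_mem S l hl, forkEnds_mem S' _ ((h l).1 hl)]
        rfl
      · rw [forkEnds_not_mem S l hl, forkEnds_not_mem S' _ (fun h' => hl ((h l).2 h'))]
        rfl
    · cases b <;> cases c <;> rfl

end


/-- Legs of Weil diagrams have grade `1` (plain) or grade `2` (marked by a fat dot). -/
inductive LegGrade
  | one
  | two
  deriving DecidableEq

/-- The grade of a leg. -/
def LegGrade.deg : LegGrade → ℕ
  | .one => 1
  | .two => 2

/-- A sequence of leg grades. -/
abbrev Word : Type := Σ n : ℕ, Fin n → LegGrade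

/-- The total grade of a sequence of legs. -/
def Word.degree (w : Word) : ℕ := ∑ k, (w.2 k).deg

/-- The non-commutative Weil complex: combinations of diagrams, modulo AS and IHX, whose legs are
linearly ordered (from left to right, numbered `0, …, n - 1`) and are each of grade `1` or `2`.
AS and IHX do not touch the legs, so this is the direct sum over all sequences of leg grades. -/
abbrev NCWeil : Type 1 := DirectSum Word fun w => JSpace (Fin w.1)

/-- As `NCWeil`, for diagrams which have in addition exactly one special leg `ι`, named `none`, which
is not part of the linear order. -/
abbrev NCWeilIota : Type 1 := DirectSum Word fun w => JSpace (Option (Fin w.1))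

/-- Arrange the legs `X`, of grades `g`, in the linear order given by `σ`. -/
noncomputable def NCWeil.place {X : Type} {N : ℕ} (σ : X ≃ Fin N) (g : X → LegGrade) :
    JSpace X →ₗ[ℚ] NCWeil :=
  DirectSum.lof ℚ Word (fun w => JSpace (Fin w.1)) ⟨N, g ∘ σ.symm⟩ ∘ₗ JSpace.relabel σ

/-- Arrange the legs `X`, of grades `g`, other than `ι`, in the linear order given by `σ`. -/
noncomputable def NCWeilIota.place {X : Type} {N : ℕ} (σ : X ≃ Fin N) (g : X → LegGrade) :
    JSpace (Option X) →ₗ[ℚ] NCWeilIota :=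
  DirectSum.lof ℚ Word (fun w => JSpace (Option (Fin w.1))) ⟨N, g ∘ σ.symm⟩ ∘ₗ
    JSpace.relabel (Equiv.optionCongr σ)

/-- The numbering of the elements of `X` in increasing order of an injective key. -/
noncomputable def rankBy {X A : Type} [Fintype X] [LinearOrder A] (key : X → A)
    (hkey : Function.Injective key) : X ≃ Fin (Fintype.card X) :=
  letI : LinearOrder X := LinearOrder.lift' key hkey
  (Fintype.orderIsoFinOfCardEq X rfl).symm.toEquiv

theorem rankBy_lt {X A : Type} [Fintype X] [LinearOrder A] (key : X → A)
    (hkey : Function.Injective key) (x y : X) :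
    rankBy key hkey x < rankBy key hkey y ↔ key x < key y :=
  letI : LinearOrder X := LinearOrder.lift' key hkey
  (Fintype.orderIsoFinOfCardEq X rfl).symm.lt_iff_lt

/-- The sign picked up by an odd operator that moves past the legs to the left of `k`. -/
def passSign {n : ℕ} (g : Fin n → LegGrade) (k : Fin n) : ℚ :=
  ∏ j ∈ Finset.univ.filter (· < k), (-1 : ℚ) ^ (g j).deg

/-- The differential: the odd derivation along the ordered legs that turns a leg of grade `1` into a leg
of grade `2`, and is zero on a leg of grade `2`. -/
noncomputable def NCWeil.d : NCWeil →ₗ[ℚ] NCWeil :=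
  DirectSum.toModule ℚ Word NCWeil fun w =>
    ∑ k : Fin w.1, passSign w.2 k •
      match w.2 k with
      | .one => DirectSum.lof ℚ Word (fun w => JSpace (Fin w.1))
          ⟨w.1, Function.update w.2 k .two⟩
      | .two => 0

/-- After grafting a fork on `k`, its left tine is the leg `ι`, and its right tine takes the place of
`k`. -/
def attachEquiv {L : Type} [DecidableEq L] (k : L) : L ⊕ ({k} : Finset L) ≃ Option L where
  toFun := Sum.elim some fun _ => none
  invFun := fun
    | some l => .inl l
    | none => .inr ⟨k, Finset.mem_singleton_self k⟩
  left_inv := by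
    rintro (l | ⟨s, hs⟩)
    · rfl
    · have := Finset.mem_singleton.1 hs
      subst this; rfl
  right_inv := by rintro (_ | l) <;> rfl

/-- The leg `ι` is joined to the leg `k` by a trivalent vertex with cyclic order
`(the old strand of k, ι, the new leg k)`. -/
noncomputable def JSpace.attach {L : Type} [DecidableEq L] (k : L) :
    JSpace L →ₗ[ℚ] JSpace (Option L) :=
  JSpace.relabel (attachEquiv k) ∘ₗ JSpace.insert (forkContext {k})

/-- The map `ι`: the odd derivation along the ordered legs that turns a leg of grade `1` into the
special leg `ι`, and a leg of grade `2` into a leg of grade `1` with the special leg joined to it. -/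
noncomputable def NCWeil.iota : NCWeil →ₗ[ℚ] NCWeilIota :=
  DirectSum.toModule ℚ Word NCWeilIota fun w =>
    ∑ k : Fin w.1, passSign w.2 k •
      match w.2 k with
      | .one => NCWeilIota.place (rankBy (Subtype.val : {j // j ≠ k} → Fin w.1)
            Subtype.val_injective) (fun j => w.2 j) ∘ₗ
          JSpace.relabel (Equiv.optionSubtypeNe k).symm
      | .two => DirectSum.lof ℚ Word (fun w => JSpace (Option (Fin w.1)))
          ⟨w.1, Function.update w.2 k .one⟩ ∘ₗ JSpace.attach k

/-- The product `#`: the disjoint union, the legs of the second diagram to the right of those of the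
first. -/
noncomputable def NCWeil.juxtapose : NCWeil →ₗ[ℚ] NCWeil →ₗ[ℚ] NCWeil :=
  DirectSum.toModule ℚ Word (NCWeil →ₗ[ℚ] NCWeil) fun w =>
    (DirectSum.toModule ℚ Word (JSpace (Fin w.1) →ₗ[ℚ] NCWeil) fun w' =>
      (JSpace.union.compr₂ (NCWeil.place finSumFinEquiv (Sum.elim w.2 w'.2))).flip).flip

/-- The subspace of elements of grade `i`. It is zero for `i < 0`. -/
noncomputable def NCWeil.grade (i : ℤ) : Submodule ℚ NCWeil :=
  Submodule.span ℚ {z | ∃ (w : Word) (x : JSpace (Fin w.1)), (w.degree : ℤ) = i ∧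
    z = DirectSum.lof ℚ Word (fun w => JSpace (Fin w.1)) w x}

/-- The sign by which reordering graded legs from the order `σ` to the order `τ` acts: a factor
`(-1) ^ (deg x * deg y)` for each pair `x, y` whose order is reversed. -/
def koszul {X A B : Type} [Fintype X] [LinearOrder A] [LinearOrder B] (σ : X → A) (τ : X → B)
    (g : X → LegGrade) : ℚ :=
  ∏ x, ∏ y, if σ x < σ y ∧ τ y < τ x then (-1) ^ ((g x).deg * (g y).deg) else 1

/-- The leg permutation relations: two adjacent legs may be transposed, with the sign
`(-1) ^ (product of their grades)`. The transposition exchanges the positions of two legs, which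
keep their grades. -/
noncomputable def permRelations : Submodule ℚ NCWeil :=
  Submodule.span ℚ {z | ∃ (w : Word) (k : ℕ) (hk : k + 1 < w.1) (x : JSpace (Fin w.1)),
    z = DirectSum.lof ℚ Word (fun w => JSpace (Fin w.1)) w x -
      (-1 : ℚ) ^ ((w.2 ⟨k, by omega⟩).deg * (w.2 ⟨k + 1, hk⟩).deg) •
        NCWeil.place (Equiv.swap ⟨k, by omega⟩ ⟨k + 1, hk⟩) w.2 x}


/-- The commutative Weil complex. -/
abbrev Weil : Type 1 := NCWeil ⧸ permRelations

/-- The average, with signs, over all orders of the legs. -/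
noncomputable def NCWeil.average : NCWeil →ₗ[ℚ] NCWeil :=
  DirectSum.toModule ℚ Word NCWeil fun w =>
    (w.1.factorial : ℚ)⁻¹ • ∑ π : Equiv.Perm (Fin w.1),
      koszul (id : Fin w.1 → Fin w.1) π w.2 • NCWeil.place π w.2


section koszul
variable {X Y A B C : Type} [Fintype X] [Fintype Y] [LinearOrder A] [LinearOrder B]
  [LinearOrder C]

theorem koszul_congr {A' B' : Type} [LinearOrder A'] [LinearOrder B'] {σ : X → A} {τ : X → B}
    {σ' : X → A'} {τ' : X → B'} (hσ : ∀ x y, σ x < σ y ↔ σ' x < σ' y)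
    (hτ : ∀ x y, τ x < τ y ↔ τ' x < τ' y) (g : X → LegGrade) :
    koszul σ τ g = koszul σ' τ' g := by
  unfold koszul
  simp only [hσ, hτ]

theorem koszul_comp (e : X ≃ Y) (σ : Y → A) (τ : Y → B) (g : Y → LegGrade) :
    koszul (σ ∘ e) (τ ∘ e) (g ∘ e) = koszul σ τ g := by
  unfold koszul
  rw [← e.prod_comp]
  refine Finset.prod_congr rfl fun x _ => ?_
  rw [← e.prod_comp]
  rfl

theorem koszul_self (σ : X → A) (g : X → LegGrade) : koszul σ σ g = 1 := by
  unfold koszul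
  refine Finset.prod_eq_one fun x _ => Finset.prod_eq_one fun y _ => if_neg ?_
  rintro ⟨h1, h2⟩
  exact lt_asymm h1 h2

theorem koszul_trans (ρ : X → A) (σ : X → B) (τ : X → C) (hρ : Function.Injective ρ)
    (hσ : Function.Injective σ) (hτ : Function.Injective τ) (g : X → LegGrade) :
    koszul ρ σ g * koszul σ τ g = koszul ρ τ g := by
  let s : X → X → ℚ := fun x y => (-1) ^ ((g x).deg * (g y).deg)
  have hs : ∀ x y, s x y * s x y = 1 := fun x y => by
    simp only [s]; rw [← mul_pow]; norm_num
  have hsymm : ∀ x y, s x y = s y x := fun x y => by simp only [s]; rw [mul_comm]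
  -- the pairs `x, y` with `y` before `x` in the second order only
  let a : X → X → ℚ := fun x y => if ρ x < ρ y ∧ σ y < σ x ∧ τ x < τ y then s x y else 1
  let b : X → X → ℚ := fun x y => if ρ y < ρ x ∧ σ x < σ y ∧ τ y < τ x then s x y else 1
  have hab : ∏ x, ∏ y, b x y = ∏ x, ∏ y, a x y := by
    rw [Finset.prod_comm]
    refine Finset.prod_congr rfl fun x _ => Finset.prod_congr rfl fun y _ => ?_
    simp only [a, b]
    rw [hsymm y x]
  have haa : (∏ x, ∏ y, a x y) * ∏ x, ∏ y, a x y = 1 := by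
    rw [← Finset.prod_mul_distrib]
    refine Finset.prod_eq_one fun x _ => ?_
    rw [← Finset.prod_mul_distrib]
    refine Finset.prod_eq_one fun y _ => ?_
    simp only [a]
    split_ifs
    · exact hs x y
    · norm_num
  have key : koszul ρ σ g * koszul σ τ g =
      koszul ρ τ g * ((∏ x, ∏ y, a x y) * ∏ x, ∏ y, b x y) := by
    unfold koszul
    simp only [← Finset.prod_mul_distrib]
    refine Finset.prod_congr rfl fun x _ => Finset.prod_congr rfl fun y _ => ?_
    change (if ρ x < ρ y ∧ σ y < σ x then s x y else 1) *
      (if σ x < σ y ∧ τ y < τ x then s x y else 1) =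
      (if ρ x < ρ y ∧ τ y < τ x then s x y else 1) * (a x y * b x y)
    simp only [a, b]
    rcases eq_or_ne x y with rfl | hxy
    · simp
    · rcases lt_or_gt_of_ne (hρ.ne hxy) with h1 | h1 <;>
      rcases lt_or_gt_of_ne (hσ.ne hxy) with h2 | h2 <;>
      rcases lt_or_gt_of_ne (hτ.ne hxy) with h3 | h3 <;>
      simp [h1, h2, h3, h1.not_gt, h2.not_gt, h3.not_gt]
  rw [key, hab, haa, mul_one]

theorem koszul_mul_self (σ : X → A) (τ : X → B) (hσ : Function.Injective σ)
    (hτ : Function.Injective τ) (g : X → LegGrade) : koszul σ τ g * koszul τ σ g = 1 := by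
  rw [koszul_trans σ τ σ hσ hτ hσ, koszul_self]

theorem koszul_swap {n k : ℕ} (hk : k + 1 < n) (g : Fin n → LegGrade) :
    koszul (id : Fin n → Fin n) (Equiv.swap (⟨k, by omega⟩ : Fin n) ⟨k + 1, hk⟩) g =
      (-1) ^ ((g ⟨k, by omega⟩).deg * (g ⟨k + 1, hk⟩).deg) := by
  unfold koszul
  rw [Finset.prod_eq_single (⟨k, by omega⟩ : Fin n), Finset.prod_eq_single (⟨k + 1, hk⟩ : Fin n)]
  · rw [if_pos]
    simp
  · intro y _ hy
    refine if_neg ?_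
    rintro ⟨h1, h2⟩
    rw [Equiv.swap_apply_left] at h2
    by_cases hy' : y = ⟨k, by omega⟩
    · rw [hy'] at h1; exact lt_irrefl _ h1
    · rw [Equiv.swap_apply_of_ne_of_ne hy' hy] at h2
      simp only [id, Fin.lt_def] at h1 h2
      omega
  · simp
  · intro x _ hx
    refine Finset.prod_eq_one fun y _ => if_neg ?_
    rintro ⟨h1, h2⟩
    obtain ⟨x, hx'⟩ := x
    obtain ⟨y, hy'⟩ := y
    rw [Equiv.swap_apply_def, Equiv.swap_apply_def] at h2
    simp only [id, Fin.mk.injEq, Fin.lt_def, ne_eq] at h1 h2 hx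
    split_ifs at h2 <;> simp only at h2 <;> omega
  · simp

end koszul

theorem NCWeil.place_relabel {X Y : Type} {N : ℕ} (σ : X ≃ Y) (τ : Y ≃ Fin N) (g : Y → LegGrade)
    (x : JSpace X) :
    NCWeil.place τ g (JSpace.relabel σ x) = NCWeil.place (σ.trans τ) (g ∘ σ) x := by
  unfold NCWeil.place
  rw [LinearMap.comp_apply, LinearMap.comp_apply, JSpace.relabel_relabel]
  congr 3
  ext k
  simp

theorem NCWeil.place_refl {N : ℕ} (g : Fin N → LegGrade) (x : JSpace (Fin N)) :
    NCWeil.place (Equiv.refl _) g x =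
      DirectSum.lof ℚ Word (fun w => JSpace (Fin w.1)) ⟨N, g⟩ x := by
  unfold NCWeil.place
  rw [LinearMap.comp_apply, JSpace.relabel_refl]
  rfl


namespace Weil

theorem mk_swap (w : Word) (k : ℕ) (hk : k + 1 < w.1) (x : JSpace (Fin w.1)) :
    permRelations.mkQ (DirectSum.lof ℚ Word (fun w => JSpace (Fin w.1)) w x) =
      (-1 : ℚ) ^ ((w.2 ⟨k, by omega⟩).deg * (w.2 ⟨k + 1, hk⟩).deg) •
        permRelations.mkQ (NCWeil.place (Equiv.swap ⟨k, by omega⟩ ⟨k + 1, hk⟩) w.2 x) := by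
  rw [← map_smul, ← sub_eq_zero, ← map_sub]
  exact (Submodule.Quotient.mk_eq_zero _).2 (Submodule.subset_span ⟨w, k, hk, x, rfl⟩)

theorem mk_perm {n : ℕ} (π : Equiv.Perm (Fin n)) : ∀ (g : Fin n → LegGrade) (x : JSpace (Fin n)),
    permRelations.mkQ (DirectSum.lof ℚ Word (fun w => JSpace (Fin w.1)) ⟨n, g⟩ x) =
      koszul (id : Fin n → Fin n) π g • permRelations.mkQ (NCWeil.place π g x) := by
  have hone : ∀ (g : Fin n → LegGrade) (x : JSpace (Fin n)),
      permRelations.mkQ (DirectSum.lof ℚ Word (fun w => JSpace (Fin w.1)) ⟨n, g⟩ x) =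
      koszul (id : Fin n → Fin n) (1 : Equiv.Perm (Fin n)) g •
        permRelations.mkQ (NCWeil.place (1 : Equiv.Perm (Fin n)) g x) := by
    intro g x
    have h1 : koszul (id : Fin n → Fin n) (1 : Equiv.Perm (Fin n)) g = 1 := koszul_self id g
    rw [h1, one_smul]
    exact congrArg _ (NCWeil.place_refl g x).symm
  rcases n with _ | n
  · rw [Subsingleton.elim π 1]; exact hone
  have hπ : π ∈ Submonoid.closure
      (Set.range fun i : Fin n => Equiv.swap i.castSucc i.succ) := by
    rw [Equiv.Perm.mclosure_swap_castSucc_succ]; trivial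
  induction hπ using Submonoid.closure_induction with
  | mem π h =>
    obtain ⟨i, rfl⟩ := h
    intro g x
    have hi : (i : ℕ) + 1 < n + 1 := by omega
    have := mk_swap ⟨n + 1, g⟩ i hi x
    rw [← koszul_swap hi g] at this
    exact this
  | one => exact hone
  | mul π ρ _ _ hπ hρ =>
    intro g x
    rw [hρ g x]
    have h1 : NCWeil.place ρ g x = DirectSum.lof ℚ Word (fun w => JSpace (Fin w.1))
      ⟨n + 1, g ∘ ρ.symm⟩ (JSpace.relabel ρ x) := rfl
    have h2 : (g ∘ ρ.symm) ∘ ρ = g := by ext; simp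
    rw [h1, hπ, NCWeil.place_relabel, h2, smul_smul]
    congr 1
    have h3 := koszul_comp ρ id π (g ∘ ρ.symm)
    rw [h2] at h3
    rw [← h3]
    exact koszul_trans id ρ (π * ρ) Function.injective_id ρ.injective (π * ρ).injective g

theorem mk_place {X : Type} [Fintype X] {N : ℕ} (σ τ : X ≃ Fin N) (g : X → LegGrade)
    (x : JSpace X) : permRelations.mkQ (NCWeil.place σ g x) =
      koszul σ τ g • permRelations.mkQ (NCWeil.place τ g x) := by
  have h1 : NCWeil.place σ g x = DirectSum.lof ℚ Word (fun w => JSpace (Fin w.1))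
    ⟨N, g ∘ σ.symm⟩ (JSpace.relabel σ x) := rfl
  have h2 : (g ∘ σ.symm) ∘ σ = g := by ext; simp
  rw [h1, mk_perm (σ.symm.trans τ), NCWeil.place_relabel, h2, ← koszul_comp σ, h2]
  have h3 : σ.trans (σ.symm.trans τ) = τ := by ext; simp
  have h4 : (σ.symm.trans τ : Fin N → Fin N) ∘ σ = τ := by ext; simp
  rw [h3, h4]
  rfl

end Weil

theorem NCWeil.average_lof (w : Word) (x : JSpace (Fin w.1)) :
    NCWeil.average (DirectSum.lof ℚ Word (fun w => JSpace (Fin w.1)) w x) =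
      (w.1.factorial : ℚ)⁻¹ • ∑ π : Equiv.Perm (Fin w.1),
        koszul (id : Fin w.1 → Fin w.1) π w.2 • NCWeil.place π w.2 x := by
  unfold NCWeil.average
  rw [DirectSum.toModule_lof]
  simp

theorem NCWeil.average_place {n : ℕ} (ρ : Equiv.Perm (Fin n)) (g : Fin n → LegGrade)
    (x : JSpace (Fin n)) : NCWeil.average (NCWeil.place ρ g x) =
      koszul ρ (id : Fin n → Fin n) g •
        NCWeil.average (DirectSum.lof ℚ Word (fun w => JSpace (Fin w.1)) ⟨n, g⟩ x) := by
  have h1 : NCWeil.place ρ g x = DirectSum.lof ℚ Word (fun w => JSpace (Fin w.1))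
    ⟨n, g ∘ ρ.symm⟩ (JSpace.relabel ρ x) := rfl
  have h2 : (g ∘ ρ.symm) ∘ ρ = g := by ext; simp
  have hsum : ∑ π : Equiv.Perm (Fin n), koszul (id : Fin n → Fin n) π (g ∘ ρ.symm) •
      NCWeil.place π (g ∘ ρ.symm) (JSpace.relabel ρ x) =
      koszul ρ (id : Fin n → Fin n) g • ∑ π : Equiv.Perm (Fin n),
        koszul (id : Fin n → Fin n) π g • NCWeil.place π g x := by
    rw [Finset.smul_sum, ← Equiv.sum_comp (Equiv.mulRight ρ) fun π : Equiv.Perm (Fin n) =>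
      koszul ρ (id : Fin n → Fin n) g • koszul (id : Fin n → Fin n) π g • NCWeil.place π g x]
    refine Finset.sum_congr rfl fun π _ => ?_
    have h3 := koszul_comp ρ (id : Fin n → Fin n) π (g ∘ ρ.symm)
    rw [h2] at h3
    rw [NCWeil.place_relabel, h2, smul_smul, ← h3]
    refine congrArg (· • _) ?_
    exact (koszul_trans ρ id (π * ρ) ρ.injective Function.injective_id (π * ρ).injective g).symm
  rw [h1, NCWeil.average_lof, NCWeil.average_lof]
  exact (congrArg _ hsum).trans (smul_comm _ _ _)

/-- The symmetrization map `χ_W` from the commutative to the non-commutative Weil complex. -/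
noncomputable def Weil.chi : Weil →ₗ[ℚ] NCWeil :=
  permRelations.liftQ NCWeil.average (by
    unfold permRelations
    rw [Submodule.span_le]
    rintro _ ⟨w, k, hk, x, rfl⟩
    rw [SetLike.mem_coe, LinearMap.mem_ker, map_sub, map_smul, NCWeil.average_place, smul_smul,
      ← koszul_swap hk, koszul_mul_self _ _ Function.injective_id (Equiv.injective _), one_smul,
      sub_self])

/-- Combinations of diagrams with numbered legs, modulo AS and IHX. -/
abbrev NumberedJacobi : Type 1 := DirectSum ℕ fun n => JSpace (Fin n)

/-- The numbering of the legs is irrelevant. -/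
noncomputable def renumbering : Submodule ℚ NumberedJacobi :=
  Submodule.span ℚ {z | ∃ (n : ℕ) (π : Equiv.Perm (Fin n)) (x : JSpace (Fin n)),
    z = DirectSum.lof ℚ ℕ (fun n => JSpace (Fin n)) n x -
      DirectSum.lof ℚ ℕ (fun n => JSpace (Fin n)) n (JSpace.relabel π x)}

/-- The space `B` of symmetric Jacobi diagrams: combinations of uni-trivalent diagrams with unordered
legs, modulo AS and IHX. -/
abbrev SymJacobi : Type 1 := NumberedJacobi ⧸ renumbering

namespace SymJacobi

/-- A diagram with numbered legs, with the numbering forgotten. -/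
noncomputable def ofLegs (n : ℕ) : JSpace (Fin n) →ₗ[ℚ] SymJacobi :=
  renumbering.mkQ ∘ₗ DirectSum.lof ℚ ℕ (fun n => JSpace (Fin n)) n

theorem ofLegs_relabel {n : ℕ} (π : Equiv.Perm (Fin n)) (x : JSpace (Fin n)) :
    ofLegs n (JSpace.relabel π x) = ofLegs n x := by
  symm
  rw [← sub_eq_zero]
  unfold ofLegs
  rw [LinearMap.comp_apply, LinearMap.comp_apply, ← map_sub]
  exact (Submodule.Quotient.mk_eq_zero _).2 (Submodule.subset_span ⟨n, π, x, rfl⟩)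

/-- A linear map out of `SymJacobi` is a family of linear maps invariant under renumbering. -/
noncomputable def lift {A : Type*} [AddCommGroup A] [Module ℚ A]
    (f : ∀ n, JSpace (Fin n) →ₗ[ℚ] A)
    (hf : ∀ n (π : Equiv.Perm (Fin n)) x, f n (JSpace.relabel π x) = f n x) :
    SymJacobi →ₗ[ℚ] A :=
  renumbering.liftQ (DirectSum.toModule ℚ ℕ A f) (by
    unfold renumbering
    rw [Submodule.span_le]
    rintro _ ⟨n, π, x, rfl⟩
    rw [SetLike.mem_coe, LinearMap.mem_ker, map_sub, DirectSum.toModule_lof,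
      DirectSum.toModule_lof, hf, sub_self])

@[simp] theorem lift_ofLegs {A : Type*} [AddCommGroup A] [Module ℚ A]
    (f : ∀ n, JSpace (Fin n) →ₗ[ℚ] A) (hf) (n : ℕ) (x : JSpace (Fin n)) :
    lift f hf (ofLegs n x) = f n x := by
  unfold lift ofLegs
  rw [LinearMap.comp_apply, Submodule.mkQ_apply, Submodule.liftQ_apply, DirectSum.toModule_lof]

theorem hom_ext {A : Type*} [AddCommGroup A] [Module ℚ A] {f g : SymJacobi →ₗ[ℚ] A}
    (h : ∀ n x, f (ofLegs n x) = g (ofLegs n x)) : f = g := by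
  refine Submodule.linearMap_qext _ ?_
  refine DirectSum.linearMap_ext _ fun n => ?_
  ext x
  exact h n x

/-- The product `⊔` on `B`: disjoint union. -/
noncomputable def disjointUnion : SymJacobi →ₗ[ℚ] SymJacobi →ₗ[ℚ] SymJacobi :=
  lift (fun m => (lift (fun n => (JSpace.union.compr₂
      (ofLegs (m + n) ∘ₗ JSpace.relabel finSumFinEquiv)).flip) (by
      intro n π y
      ext x
      simp only [LinearMap.flip_apply, LinearMap.compr₂_apply, LinearMap.comp_apply]
      conv_lhs => rw [← JSpace.relabel_refl x, JSpace.union_relabel, JSpace.relabel_relabel]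
      refine Eq.trans ?_ (ofLegs_relabel (finSumFinEquiv.symm.trans
        ((Equiv.sumCongr (Equiv.refl _) π).trans finSumFinEquiv)) _)
      rw [JSpace.relabel_relabel]
      congr 3
      ext k; simp)).flip) (by
    intro m π x
    refine hom_ext fun n y => ?_
    simp only [LinearMap.flip_apply, lift_ofLegs, LinearMap.compr₂_apply, LinearMap.comp_apply]
    conv_lhs => rw [← JSpace.relabel_refl y, JSpace.union_relabel, JSpace.relabel_relabel]
    refine Eq.trans ?_ (ofLegs_relabel (finSumFinEquiv.symm.trans
      ((Equiv.sumCongr π (Equiv.refl _)).trans finSumFinEquiv)) _)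
    rw [JSpace.relabel_relabel]
    congr 3
    ext k; simp)

/-- The subspace of elements of grade `i`, where every leg has grade `2`. -/
noncomputable def grade (i : ℤ) : Submodule ℚ SymJacobi :=
  Submodule.span ℚ {z | ∃ (n : ℕ) (x : JSpace (Fin n)), 2 * (n : ℤ) = i ∧ z = ofLegs n x}

end SymJacobi

/-- The order of the legs after forks are grafted on the legs in `S`: the two tines of a fork are
consecutive, left tine first, in the place of the leg they replace. -/
def forkKey {L : Type} (S : Finset L) : L ⊕ S → L ×ₗ Fin 2
  | .inl l => toLex (l, 1)
  | .inr s => toLex (s, 0)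

theorem forkKey_injective {L : Type} (S : Finset L) : Function.Injective (forkKey S) := by
  rintro (l | s) (l' | s') h
  · have := congrArg (fun p => (ofLex p).1) h
    exact congrArg Sum.inl this
  · have := congrArg (fun p => (ofLex p).2) h
    simp [forkKey] at this
  · have := congrArg (fun p => (ofLex p).2) h
    simp [forkKey] at this
  · have := congrArg (fun p => (ofLex p).1) h
    exact congrArg Sum.inr (Subtype.ext this)

/-- The tines of the forks have grade `1`, the other legs have grade `2`. -/
def forkGrade {L : Type} [DecidableEq L] (S : Finset L) : L ⊕ S → LegGrade
  | .inl l => if l ∈ S then .one else .two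
  | .inr _ => .one

/-- The legs are ordered by their numbers, and each leg is replaced by its curvature: the leg of
grade `2`, minus one half of the fork with two legs of grade `1`. The product is expanded over the
set `S` of legs replaced by a fork. -/
noncomputable def splitHairs (n : ℕ) : JSpace (Fin n) →ₗ[ℚ] NCWeil :=
  ∑ S : Finset (Fin n), (-1 / 2 : ℚ) ^ S.card •
    NCWeil.place (rankBy (forkKey S) (forkKey_injective S)) (forkGrade S) ∘ₗ
      JSpace.insert (forkContext S)


section
variable {n : ℕ}

theorem forkGrade_sum (S : Finset (Fin n)) (h : Fin n → ℕ) :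
    ∑ x : Fin n ⊕ S, (forkGrade S x).deg * h (ofLex (forkKey S x)).1 = 2 * ∑ l, h l := by
  rw [Fintype.sum_sum_type]
  have h1 : ∑ s : S, (forkGrade S (.inr s)).deg * h (ofLex (forkKey S (.inr s))).1 =
      ∑ l, if l ∈ S then h l else 0 := by
    rw [Finset.sum_ite_mem, Finset.univ_inter]
    simp only [forkGrade, forkKey, LegGrade.deg, one_mul, ofLex_toLex]
    exact Finset.sum_coe_sort S h
  rw [h1, ← Finset.sum_add_distrib, Finset.mul_sum]
  refine Finset.sum_congr rfl fun l _ => ?_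
  by_cases hl : l ∈ S <;> simp [forkGrade, forkKey, LegGrade.deg, hl] <;> ring

theorem koszul_fork (S : Finset (Fin n)) (π : Equiv.Perm (Fin n)) (τ : Fin n ⊕ S → Fin n ×ₗ Fin 2)
    (hτ : ∀ x, τ x = toLex (π (ofLex (forkKey S x)).1, (ofLex (forkKey S x)).2)) :
    koszul (forkKey S) τ (forkGrade S) = 1 := by
  have h1 : ∀ x y, (forkKey S x < forkKey S y ∧ τ y < τ x) ↔
      ((ofLex (forkKey S x)).1 < (ofLex (forkKey S y)).1 ∧
        π (ofLex (forkKey S y)).1 < π (ofLex (forkKey S x)).1) := by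
    intro x y
    rw [hτ, hτ, Prod.Lex.lt_iff, Prod.Lex.lt_iff]
    simp only [ofLex_toLex]
    constructor
    · rintro ⟨h | ⟨h, h'⟩, k | ⟨k, k'⟩⟩
      · exact ⟨h, k⟩
      · rw [π.injective k] at h; exact absurd h (lt_irrefl _)
      · rw [h] at k; exact absurd k (lt_irrefl _)
      · exact absurd h' (lt_asymm k')
    · rintro ⟨h, k⟩; exact ⟨.inl h, .inl k⟩
  have h2 : koszul (forkKey S) τ (forkGrade S) = (-1 : ℚ) ^ (∑ x, ∑ y,
      if (ofLex (forkKey S x)).1 < (ofLex (forkKey S y)).1 ∧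
        π (ofLex (forkKey S y)).1 < π (ofLex (forkKey S x)).1
      then (forkGrade S x).deg * (forkGrade S y).deg else 0) := by
    unfold koszul
    rw [← Finset.prod_pow_eq_pow_sum]
    refine Finset.prod_congr rfl fun x _ => ?_
    rw [← Finset.prod_pow_eq_pow_sum]
    refine Finset.prod_congr rfl fun y _ => ?_
    simp only [h1]
    split_ifs <;> simp
  rw [h2]
  refine Even.neg_one_pow ?_
  refine Finset.even_sum _ fun x _ => ?_
  have h3 := forkGrade_sum S fun l => if (ofLex (forkKey S x)).1 < l ∧
    π l < π (ofLex (forkKey S x)).1 then (forkGrade S x).deg else 0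
  refine ⟨_, Eq.trans ?_ (h3.trans (two_mul _))⟩
  refine Finset.sum_congr rfl fun y _ => ?_
  split_ifs <;> simp [mul_comm]

theorem splitHairs_relabel (π : Equiv.Perm (Fin n)) (x : JSpace (Fin n)) :
    permRelations.mkQ (splitHairs n (JSpace.relabel π x)) =
      permRelations.mkQ (splitHairs n x) := by
  unfold splitHairs
  simp only [LinearMap.sum_apply, LinearMap.smul_apply, LinearMap.comp_apply, map_sum, map_smul]
  symm
  refine Fintype.sum_equiv (Equiv.finsetCongr π) _ _ fun S => ?_
  have hS : ∀ l, l ∈ S ↔ π l ∈ Equiv.finsetCongr π S := by simp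
  have hcard : (Equiv.finsetCongr π S).card = S.card := by simp
  rw [hcard]
  congr 1
  rw [JSpace.insert_fork_relabel π S _ hS, NCWeil.place_relabel]
  set S' := Equiv.finsetCongr π S
  set e := Equiv.sumCongr π (π.subtypeEquiv hS)
  have hg : forkGrade S' ∘ e = forkGrade S := by
    ext x
    rcases x with l | s
    · simp only [Function.comp, e, Equiv.sumCongr_apply, Sum.map_inl, forkGrade, ← hS]
    · rfl
  rw [hg]
  have key : ∀ (N N' : ℕ) (hN : N = N') (σ : Fin n ⊕ S ≃ Fin N) (τ : Fin n ⊕ S ≃ Fin N')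
      (y : JSpace (Fin n ⊕ S)), koszul σ τ (forkGrade S) = 1 →
      permRelations.mkQ (NCWeil.place σ (forkGrade S) y) =
        permRelations.mkQ (NCWeil.place τ (forkGrade S) y) := by
    intro N N' hN σ τ y h
    subst hN
    rw [Weil.mk_place σ τ, h, one_smul]
  refine key _ _ (Fintype.card_congr e) _ _ _ ?_
  rw [← koszul_fork S π (forkKey S' ∘ e) ?_]
  · refine koszul_congr (fun x y => rankBy_lt _ _ x y) (fun x y => ?_) _
    exact rankBy_lt _ _ (e x) (e y)
  · rintro (l | s) <;> rfl

end

/-- The hair-splitting map `Υ` from `B` to the commutative Weil complex. -/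
noncomputable def SymJacobi.upsilon : SymJacobi →ₗ[ℚ] Weil :=
  SymJacobi.lift (fun n => permRelations.mkQ ∘ₗ splitHairs n) fun _ π x =>
    splitHairs_relabel π x


theorem SymJacobi.disjointUnion_ofLegs (m n : ℕ) (x : JSpace (Fin m)) (y : JSpace (Fin n)) :
    SymJacobi.disjointUnion (SymJacobi.ofLegs m x) (SymJacobi.ofLegs n y) =
      SymJacobi.ofLegs (m + n) (JSpace.relabel finSumFinEquiv (JSpace.union x y)) := by
  unfold SymJacobi.disjointUnion
  rw [SymJacobi.lift_ofLegs, LinearMap.flip_apply, SymJacobi.lift_ofLegs]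
  rfl

theorem SymJacobi.disjointUnion_mem {i j : ℤ} {v w : SymJacobi} (hv : v ∈ SymJacobi.grade i)
    (hw : w ∈ SymJacobi.grade j) : SymJacobi.disjointUnion v w ∈ SymJacobi.grade (i + j) := by
  unfold SymJacobi.grade at hv hw
  induction hv, hw using Submodule.span_induction₂ with
  | mem_mem v w hv hw =>
    obtain ⟨m, x, rfl, rfl⟩ := hv
    obtain ⟨n, y, rfl, rfl⟩ := hw
    rw [SymJacobi.disjointUnion_ofLegs]
    exact Submodule.subset_span ⟨m + n, _, by push_cast; ring, rfl⟩
  | zero_left y _ => rw [map_zero, LinearMap.zero_apply]; exact zero_mem _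
  | zero_right x _ => rw [map_zero]; exact zero_mem _
  | add_left x y z _ _ _ h1 h2 => rw [map_add, LinearMap.add_apply]; exact add_mem h1 h2
  | add_right x y z _ _ _ h1 h2 => rw [map_add]; exact add_mem h1 h2
  | smul_left r x y _ _ h => rw [map_smul, LinearMap.smul_apply]; exact Submodule.smul_mem _ r h
  | smul_right r x y _ _ h => rw [map_smul]; exact Submodule.smul_mem _ r h

namespace NCWeil

/-- The basic elements of grade `i`: those killed by `ι`. -/
noncomputable def basic (i : ℤ) : Submodule ℚ NCWeil := grade i ⊓ LinearMap.ker iota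

/-- The cocycles of the basic subcomplex. -/
noncomputable def basicCocycles (i : ℤ) : Submodule ℚ NCWeil := basic i ⊓ LinearMap.ker d

/-- The images under `d` of basic elements of grade `i - 1`. -/
noncomputable def basicCoboundaries (i : ℤ) : Submodule ℚ NCWeil := (basic (i - 1)).map d

/-- The cohomology of the basic subcomplex in grade `i`. The coboundaries are cocycles, so
`submoduleOf` loses nothing. -/
abbrev BasicCohomology (i : ℤ) : Type 1 :=
  basicCocycles i ⧸ (basicCoboundaries i).submoduleOf (basicCocycles i)

/-- The class of a basic cocycle. -/
noncomputable def basicClass (i : ℤ) : basicCocycles i →ₗ[ℚ] BasicCohomology i :=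
  ((basicCoboundaries i).submoduleOf (basicCocycles i)).mkQ

/-- `γ` is the product `α # β` of basic cohomology classes induced by `#`: for all representatives `a`
of `α` and `b` of `β`, `a # b` is a basic cocycle, and its class is `γ`. -/
def IsBasicProduct {i j : ℤ} (α : BasicCohomology i) (β : BasicCohomology j)
    (γ : BasicCohomology (i + j)) : Prop :=
  ∀ (a : basicCocycles i) (b : basicCocycles j), basicClass i a = α → basicClass j b = β →
    ∃ h : juxtapose (a : NCWeil) (b : NCWeil) ∈ basicCocycles (i + j),
      basicClass (i + j) ⟨juxtapose (a : NCWeil) (b : NCWeil), h⟩ = γ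

end NCWeil

end Wheeling

/-!
Let `z` be the product of the symmetrized curvature expansions `χ Υ v` and `χ Υ w`. In the
commutative Weil complex `Υ` is multiplicative (`mk_juxtapose_chi_upsilon`), so the symmetrization
of `z` is `χ Υ (v ⊔ w)`, and the theorem compares `z` with its symmetrization.

For this there is an explicit homotopy `s` (`NCWeil.homotopy`). It turns a leg of grade `2`, in
position `k`, into a leg of grade `1`, and then takes the difference between symmetrizing the first
`k` and the first `k + 1` legs. These differences telescope, so `d s + s d` is the identity minus
the symmetrization (`NCWeil.d_homotopy_add_homotopy_d`). Moreover `s` anticommutes with `ι`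
(`NCWeil.iota_homotopy`): if `ι` acts on the leg that `s` has just changed, the two partial
symmetrizations become equal. Hence, once `z` is known to be a basic cocycle, `x = s z` is basic
and `z = χ Υ (v ⊔ w) + d x` (`exists_juxtapose_chi_upsilon`).

The map `ι` and the differential `d` are odd derivations of the product, so it remains to see that
`χ Υ v` is a basic cocycle. Both maps commute with symmetrization.

* For `ι`, expand the product of curvatures over the set `S` of legs that carry a fork. At each
  leg, the two tines of the fork contribute equally, by antisymmetry, and the coefficient `-1/2`
  makes them cancel the contribution of the leg of grade `2` (`iota_splitHairs`).
* For `d`, only the image in the commutative Weil complex matters. There `d` of a fork on `l`, with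
  its coefficient, is an odd leg attached to the leg `l` of grade `2`, and the odd leg may be moved
  to the front. The attachments of a new leg to all legs of a diagram add up to zero by IHX
  (`JSpace.sum_attach`), and an attachment to a tine vanishes: it contains a tree with three legs
  of grade `1`, whose three cyclic rotations are equal and add up to zero by IHX
  (`Weil.mk_ordered_attach_attach`). So the attachments to the legs of grade `2` add up to zero
  (`mk_d_splitHairs`).

The statement on cohomology follows, as `#` descends to the cohomology of basic elements by the
derivation property of `d` and `ι`.
-/

namespace Wheeling

/-! ### Grafting onto diagrams -/

theorem Matching.map_eq_of_mate {H H' : Type} {M : Matching H} {N : Matching H'} {e : H ≃ H'}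
    (h : ∀ x, N.mate (e x) = e (M.mate x)) : M.map e = N := by
  refine Matching.ext (funext fun y => ?_)
  obtain ⟨x, rfl⟩ := e.surjective y
  rw [Matching.map_mate, h]

theorem Matching.exchange_eq_map {H : Type} [DecidableEq H] (M : Matching H) (x y : H) :
    M.exchange x y = M.map (Equiv.swap x y) := by
  unfold Matching.exchange
  congr!

section
variable {V L L' L'' : Type}

/-- Attaching first `C` and then `C'`, as a single context. -/
abbrev Context.comp (C : Context L L') (C' : Context L' L'') : Context L L'' where
  U := C.U ⊕ C'.U
  K := C.K ⊕ C'.K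
  edges := C.edges.sum C'.edges
  ends := (Equiv.sumAssoc L C.K C'.K).symm.trans <|
    (Equiv.sumCongr C.ends (Equiv.refl C'.K)).trans <|
    (Equiv.sumAssoc (C.U × Fin 3) L' C'.K).trans <|
    (Equiv.sumCongr (Equiv.refl (C.U × Fin 3)) C'.ends).trans <|
    (Equiv.sumAssoc (C.U × Fin 3) (C'.U × Fin 3) L'').symm.trans <|
    Equiv.sumCongr (Equiv.sumProdDistrib C.U C'.U (Fin 3)).symm (Equiv.refl L'')

theorem Context.comp_ends_inl (C : Context L L') (C' : Context L' L'') (l : L) :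
    (C.comp C').ends (.inl l) = Sum.elim (fun q => .inl (.inl q.1, q.2))
      (fun l' => Sum.map (fun q => (.inr q.1, q.2)) id (C'.ends (.inl l'))) (C.ends (.inl l)) := by
  simp only [Context.comp, Equiv.trans_apply, Equiv.sumAssoc_symm_apply_inl,
    Equiv.sumCongr_apply, Sum.map_inl]
  rcases C.ends (.inl l) with q | l'
  · rfl
  · simp only [Equiv.sumAssoc_apply_inl_inr, Sum.map_inr, Sum.elim_inr]
    rcases C'.ends (.inl l') with q | l'' <;> rfl

theorem Context.comp_ends_inr_inl (C : Context L L') (C' : Context L' L'') (k : C.K) :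
    (C.comp C').ends (.inr (.inl k)) = Sum.elim (fun q => .inl (.inl q.1, q.2))
      (fun l' => Sum.map (fun q => (.inr q.1, q.2)) id (C'.ends (.inl l'))) (C.ends (.inr k)) := by
  simp only [Context.comp, Equiv.trans_apply, Equiv.sumAssoc_symm_apply_inr_inl,
    Equiv.sumCongr_apply, Sum.map_inl]
  rcases C.ends (.inr k) with q | l'
  · rfl
  · simp only [Equiv.sumAssoc_apply_inl_inr, Sum.map_inr, Sum.elim_inr]
    rcases C'.ends (.inl l') with q | l'' <;> rfl

theorem Context.comp_ends_inr_inr (C : Context L L') (C' : Context L' L'') (k : C'.K) :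
    (C.comp C').ends (.inr (.inr k)) =
      Sum.map (fun q => (.inr q.1, q.2)) id (C'.ends (.inr k)) := by
  simp only [Context.comp, Equiv.trans_apply, Equiv.sumAssoc_symm_apply_inr_inr,
    Equiv.sumCongr_apply, Sum.map_inr, Equiv.sumAssoc_apply_inr, Equiv.refl_apply]
  rcases C'.ends (.inr k) with q | l'' <;> rfl

/-- Attaching two contexts in succession is attaching their composite. -/
theorem JSpace.insert_insert (C : Context L L') (C' : Context L' L'') (x : JSpace L) :
    JSpace.insert C' (JSpace.insert C x) = JSpace.insert (C.comp C') x := by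
  refine LinearMap.congr_fun (f := JSpace.insert C' ∘ₗ JSpace.insert C) ?_ x
  refine JSpace.hom_ext fun V _ M => ?_
  simp only [LinearMap.comp_apply, JSpace.insert_mk]
  have : Finite (C.comp C').U := inferInstanceAs (Finite (C.U ⊕ C'.U))
  refine (JSpace.mk_congr (Equiv.sumAssoc V C.U C'.U) 0 _).symm.trans (congrArg _ ?_)
  unfold Matching.insert
  have h : M.sum (C.comp C').edges =
      ((M.sum C.edges).sum C'.edges).map (Equiv.sumAssoc _ _ _) := by
    ext x; rcases x with x | x | x <;> rfl
  have h' : ((M.sum C.edges).map (C.place V)).sum C'.edges =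
      ((M.sum C.edges).sum C'.edges).map (Equiv.sumCongr (C.place V) (Equiv.refl _)) := by
    rw [← Matching.sum_map, Matching.map_refl]
  rw [h, h', Matching.map_map, Matching.map_map, Matching.map_map]
  congr 1
  ext x
  rcases x with ((p | l) | k) | k
  · simp only [Context.place_inl_inl, HalfEdge.congr, Equiv.trans_apply, Equiv.sumCongr_apply,
      Sum.map_inl]
    refine Eq.trans ?_ (Context.place_inl_inl (C.comp C') V p).symm
    simp
  · simp only [Equiv.trans_apply, Equiv.sumCongr_apply, Sum.map_inl, Context.place_inl_inr,
      Equiv.sumAssoc_apply_inl_inl]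
    rw [Context.place_inl_inr, Context.comp_ends_inl]
    rcases C.ends (.inl l) with q | l'
    · simp [Context.place_inl_inl, HalfEdge.congr]
    · simp only [Sum.map_inr, id, Context.place_inl_inr, Sum.elim_inr]
      rcases C'.ends (.inl l') with q | l'' <;> simp [HalfEdge.congr]
  · simp only [Equiv.trans_apply, Equiv.sumCongr_apply, Sum.map_inl, Context.place_inr,
      Equiv.sumAssoc_apply_inl_inr]
    rw [Context.place_inr, Context.comp_ends_inr_inl]
    rcases C.ends (.inr k) with q | l'
    · simp [Context.place_inl_inl, HalfEdge.congr]
    · simp only [Sum.map_inr, id, Context.place_inl_inr, Sum.elim_inr]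
      rcases C'.ends (.inl l') with q | l'' <;> simp [HalfEdge.congr]
  · simp only [Equiv.trans_apply, Equiv.sumCongr_apply, Sum.map_inr, Context.place_inr,
      Equiv.sumAssoc_apply_inr, Equiv.refl_apply]
    rw [Context.place_inr, Context.comp_ends_inr_inr]
    rcases C'.ends (.inr k) with q | l'' <;> simp [HalfEdge.congr]

end

section
variable {V L : Type} [DecidableEq L]

/-- The fork on the single leg `k`, whose left tine is named `none` and whose right tine inherits
the name of `k`. -/
abbrev Context.graft (k : L) : Context L (Option L) where
  U := Unit
  K := Bool × Bool
  edges :=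
    { mate := fun b => (b.1, !b.2)
      mate_mate := by simp
      mate_ne := by rintro ⟨b, c⟩; cases c <;> simp }
  ends :=
    { toFun := fun
        | .inl l => if l = k then .inl ((), 0) else .inr (some l)
        | .inr (false, false) => .inl ((), 1)
        | .inr (true, false) => .inl ((), 2)
        | .inr (false, true) => .inr none
        | .inr (true, true) => .inr (some k)
      invFun := fun
        | .inl (_, 0) => .inl k
        | .inl (_, 1) => .inr (false, false)
        | .inl (_, 2) => .inr (true, false)
        | .inr none => .inr (false, true)
        | .inr (some l) => if l = k then .inr (true, true) else .inl l
      left_inv := by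
        rintro (l | ⟨b, c⟩)
        · by_cases h : l = k <;> simp [h]
        · cases b <;> cases c <;> simp
      right_inv := by
        rintro (⟨s, i⟩ | _ | l)
        · fin_cases i <;> simp
        · simp
        · by_cases h : l = k <;> simp [h] }

theorem Context.graft_ends_inl (k l : L) :
    (Context.graft k).ends (.inl l) = if l = k then .inl ((), 0) else .inr (some l) := rfl

/-- `JSpace.attach` in terms of a context with a single vertex, which composes more easily than the
fork on a one-element set. -/
theorem JSpace.attach_eq_insert (k : L) (x : JSpace L) :
    JSpace.attach k x = JSpace.insert (Context.graft k) x := by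
  unfold JSpace.attach
  rw [LinearMap.comp_apply]
  let u : ({k} : Finset L) ≃ Unit := Equiv.equivPUnit _
  refine (JSpace.insert_relabel (forkContext {k}) (Context.graft k) (Equiv.refl L) _
    u ((Equiv.prodCongr u (Equiv.refl _)).trans (Equiv.punitProd _)) ?_ ?_ x).symm.trans ?_
  · rintro ⟨s, b, c⟩
    rfl
  · rintro (l | ⟨⟨s, hs⟩, b, c⟩)
    · change (Context.graft k).ends (.inl l) = Sum.map _ _ (forkEnds {k} (.inl l))
      by_cases hl : l = k
      · rw [forkEnds_mem _ l (by simp [hl]), Context.graft_ends_inl, if_pos hl]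
        rfl
      · rw [forkEnds_not_mem _ l (by simp [hl]), Context.graft_ends_inl, if_neg hl]
        rfl
    · obtain rfl := Finset.mem_singleton.1 hs
      cases b <;> cases c <;> rfl
  · rw [JSpace.relabel_refl]

/-- Attaching `ι` is natural in the leg names. -/
theorem JSpace.attach_relabel {L' : Type} [DecidableEq L'] (σ : L ≃ L') (k : L) (x : JSpace L) :
    JSpace.attach (σ k) (JSpace.relabel σ x) =
      JSpace.relabel (Equiv.optionCongr σ) (JSpace.attach k x) := by
  rw [JSpace.attach_eq_insert, JSpace.attach_eq_insert]
  refine JSpace.insert_relabel (Context.graft k) (Context.graft (σ k)) σ _ (Equiv.refl Unit)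
    (Equiv.refl (Bool × Bool)) (fun _ => rfl) ?_ x
  rintro (l | ⟨b, c⟩)
  · simp only [Sum.map_inl]
    by_cases hl : l = k <;> simp [hl]
  · cases b <;> cases c <;> rfl

/-- The antisymmetry of the fork. -/
theorem JSpace.relabel_swap_attach (k : L) (x : JSpace L) :
    JSpace.relabel (Equiv.swap none (some k)) (JSpace.attach k x) = -JSpace.attach k x := by
  classical
  rw [JSpace.attach_eq_insert]
  refine LinearMap.congr_fun (f := JSpace.relabel (Equiv.swap none (some k)) ∘ₗ
    JSpace.insert (Context.graft k)) (g := -JSpace.insert (Context.graft k)) ?_ x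
  refine JSpace.hom_ext fun V _ M => ?_
  have : Finite (Context.graft k).U := inferInstanceAs (Finite Unit)
  simp only [LinearMap.comp_apply, LinearMap.neg_apply, JSpace.insert_mk, JSpace.relabel_mk]
  rw [eq_neg_iff_add_eq_zero, add_comm]
  refine Eq.trans (congrArg (_ + JSpace.mk ·) ?_)
    (JSpace.mk_antisymmetry (M.insert (Context.graft k)) (.inr ()))
  rw [Matching.exchange_eq_map]
  unfold Matching.insert Matching.relabel
  -- exchanging the ends of the tines amounts to exchanging the tines, which preserves the matching
  let κ : Bool × Bool ≃ Bool × Bool := Equiv.prodCongr Equiv.boolNot (Equiv.refl _)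
  have hκ : M.sum (Context.graft k).edges =
      (M.sum (Context.graft k).edges).map (Equiv.sumCongr (Equiv.refl _) κ) := by
    symm
    refine Matching.map_eq_of_mate ?_
    rintro (x | x) <;> rfl
  conv_lhs => rw [hκ]
  rw [Matching.map_map, Matching.map_map, Matching.map_map]
  congr 1
  ext x
  have key : ∀ a b : (HalfEdge V L) ⊕ (Context.graft k).K, ∀ a' b',
      (Context.graft k).place V a = a' → (Context.graft k).place V b = b' →
      Sum.map id (Equiv.swap none (some k)) a' =
        Equiv.swap (Sum.inl (Sum.inr (), 1)) (Sum.inl (Sum.inr (), 2)) b' →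
      Sum.map id (Equiv.swap none (some k)) ((Context.graft k).place V a) =
        Equiv.swap (Sum.inl (Sum.inr (), 1)) (Sum.inl (Sum.inr (), 2))
          ((Context.graft k).place V b) := by
    rintro a b _ _ rfl rfl h
    exact h
  rcases x with (p | l) | k'
  · refine key _ _ _ _ (Context.place_inl_inl _ V p) (Context.place_inl_inl _ V p) ?_
    rw [Equiv.swap_apply_of_ne_of_ne] <;> simp
  · refine key _ _ _ _ (Context.place_inl_inr _ V l) (Context.place_inl_inr _ V l) ?_
    rw [Context.graft_ends_inl]
    by_cases hl : l = k
    · simp [hl, Equiv.swap_apply_of_ne_of_ne]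
    · simp [hl, Equiv.swap_apply_of_ne_of_ne]
  · refine key (.inr (κ k')) (.inr k') _ _ (Context.place_inr (Context.graft k) V (κ k'))
      (Context.place_inr (Context.graft k) V k') ?_
    obtain ⟨b, c⟩ := k'
    cases b <;> cases c <;> simp [κ, Equiv.swap_apply_of_ne_of_ne]

/-- Attachments to different legs commute. -/
theorem JSpace.attach_attach_comm {j k : L} (h : j ≠ k) (x : JSpace L) :
    JSpace.attach (some j) (JSpace.attach k x) =
      JSpace.relabel (Equiv.swap none (some none))
        (JSpace.attach (some k) (JSpace.attach j x)) := by
  simp only [JSpace.attach_eq_insert, JSpace.insert_insert]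
  refine Eq.trans ?_ (JSpace.insert_relabel ((Context.graft j).comp (Context.graft (some k)))
    ((Context.graft k).comp (Context.graft (some j))) (Equiv.refl L) _ (Equiv.sumComm Unit Unit)
    (Equiv.sumComm (Bool × Bool) (Bool × Bool)) ?_ ?_ x)
  · rw [JSpace.relabel_refl]
  · rintro (x | x) <;> rfl
  · rintro (l | ⟨b, c⟩ | ⟨b, c⟩)
    · simp only [Sum.map_inl, Equiv.refl_apply]
      by_cases hj : l = j
      · subst hj; simp [h]
      · by_cases hk : l = k
        · subst hk; simp [hj]
        · simp [hj, hk, Equiv.swap_apply_of_ne_of_ne]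
    · simp only [Sum.map_inr, Equiv.sumComm_apply, Sum.swap_inl]
      cases b <;> cases c <;> simp [h, Equiv.swap_apply_of_ne_of_ne]
    · simp only [Sum.map_inr, Equiv.sumComm_apply, Sum.swap_inr]
      cases b <;> cases c <;> simp [h.symm, Equiv.swap_apply_of_ne_of_ne]

end
/-! ### Attaching a leg to all legs of a diagram -/

section
variable {V L : Type}

/-- AS for the half-edges in positions `0` and `2`, by turning the vertex. -/
theorem JSpace.mk_exchange_zero_two [Finite V] (M : Matching (HalfEdge V L)) (v : V) :
    JSpace.mk (M.exchange (.inl (v, 0)) (.inl (v, 2))) = -JSpace.mk M := by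
  classical
  have h := JSpace.mk_antisymmetry
    (M.map (HalfEdge.congr L (Equiv.refl V) fun _ => 2)) v
  rw [JSpace.mk_congr] at h
  have h0 : HalfEdge.congr L (Equiv.refl V) (fun _ => 2) (.inl (v, 0)) = .inl (v, 2) := by
    simp [HalfEdge.congr]
  have h2 : HalfEdge.congr L (Equiv.refl V) (fun _ => 2) (.inl (v, 2)) = .inl (v, 1) := by
    simp [HalfEdge.congr]
  rw [eq_neg_iff_add_eq_zero, add_comm, ← h, ← JSpace.mk_congr (Equiv.refl V) (fun _ => 2)
    (M.exchange _ _), Matching.map_exchange, h0, h2, Matching.exchange_eq_map,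
    Matching.exchange_eq_map, Equiv.swap_comm]

/-- The IHX relation for an edge that ends at `w` in position `2`. -/
theorem JSpace.mk_ihx_two [Finite V] (M : Matching (HalfEdge V L)) {v w : V} (hvw : v ≠ w)
    (h : M.mate (.inl (v, 0)) = .inl (w, 2)) :
    JSpace.mk M +
      JSpace.mk ((M.exchange (.inl (v, 2)) (.inl (w, 0))).exchange (.inl (v, 1)) (.inl (v, 2))) +
      JSpace.mk ((M.exchange (.inl (v, 1)) (.inl (v, 2))).exchange
        (.inl (v, 2)) (.inl (w, 0))) = 0 := by
  classical
  let r : V → Fin 3 := Pi.single w 1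
  have hv : ∀ i, HalfEdge.congr L (Equiv.refl V) r (.inl (v, i)) = .inl (v, i) := by
    intro i
    simp [HalfEdge.congr, r, Pi.single_eq_of_ne hvw]
  have hw : ∀ i, HalfEdge.congr L (Equiv.refl V) r (.inl (w, i)) = .inl (w, i + 1) := by
    intro i
    simp [HalfEdge.congr, r]
  have key := JSpace.mk_ihx (M.map (HalfEdge.congr L (Equiv.refl V) r)) v w (by
    rw [← hv, Matching.map_mate, h, hw]
    rfl)
  rw [← JSpace.mk_congr (Equiv.refl V) r M, ← JSpace.mk_congr (Equiv.refl V) r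
    ((M.exchange _ _).exchange _ _), ← JSpace.mk_congr (Equiv.refl V) r
    ((M.exchange (.inl (v, 1)) (.inl (v, 2))).exchange _ _)]
  simp only [Matching.map_exchange, hv, hw]
  exact key

/-- A new leg `none` on a new vertex whose other two half-edges are joined to each other. -/
abbrev Context.lollipop (L : Type) : Context L (Option L) where
  U := Unit
  K := Bool × Bool
  edges :=
    { mate := fun b => (b.1, !b.2)
      mate_mate := by simp
      mate_ne := by rintro ⟨b, c⟩; cases c <;> simp }
  ends :=
    { toFun := fun
        | .inl l => .inr (some l)
        | .inr (false, false) => .inl ((), 1)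
        | .inr (true, false) => .inl ((), 2)
        | .inr (false, true) => .inr none
        | .inr (true, true) => .inl ((), 0)
      invFun := fun
        | .inl (_, 0) => .inr (true, true)
        | .inl (_, 1) => .inr (false, false)
        | .inl (_, 2) => .inr (true, false)
        | .inr none => .inr (false, true)
        | .inr (some l) => .inl l
      left_inv := by
        rintro (l | ⟨b, c⟩)
        · rfl
        · cases b <;> cases c <;> rfl
      right_inv := by
        rintro (⟨s, i⟩ | _ | l)
        · fin_cases i <;> rfl
        · rfl
        · rfl }

/-- The half-edges of a diagram, within the diagram with a lollipop added. -/
def HalfEdge.lift : HalfEdge V L → HalfEdge (V ⊕ Unit) (Option L)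
  | .inl p => .inl (.inl p.1, p.2)
  | .inr l => .inr (some l)

/-- The disjoint union of a diagram and a lollipop. -/
def Matching.addLollipop (M : Matching (HalfEdge V L)) :
    Matching (HalfEdge (V ⊕ Unit) (Option L)) := M.insert (Context.lollipop L)

theorem Matching.addLollipop_mate_lift (M : Matching (HalfEdge V L)) (h : HalfEdge V L) :
    M.addLollipop.mate h.lift = (M.mate h).lift := by
  have hl : ∀ h : HalfEdge V L, (Context.lollipop L).place V (.inl h) = h.lift := by
    rintro (p | l) <;> rfl
  rw [← hl, ← hl]
  exact Matching.map_mate ((Context.lollipop L).place V) (M.sum (Context.lollipop L).edges) (.inl h)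

theorem Matching.addLollipop_mate_zero (M : Matching (HalfEdge V L)) :
    M.addLollipop.mate (.inl (.inr (), 0)) = .inl (.inr (), 2) :=
  Matching.map_mate ((Context.lollipop L).place V) (M.sum (Context.lollipop L).edges)
    (.inr (true, true))

/-- A leg attached to the half-edge `h` of a diagram: the loop of the lollipop is opened and
inserted into the edge that ends at `h`. -/
noncomputable def Matching.attachAt (M : Matching (HalfEdge V L)) (h : HalfEdge V L) :
    Matching (HalfEdge (V ⊕ Unit) (Option L)) :=
  M.addLollipop.exchange h.lift (.inl (.inr (), 0))

theorem HalfEdge.lift_injective : Function.Injective (HalfEdge.lift : HalfEdge V L → _) := by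
  rintro (⟨v, i⟩ | l) (⟨v', i'⟩ | l') h <;> simp [HalfEdge.lift] at h ⊢ <;> exact h

theorem HalfEdge.lift_ne (h : HalfEdge V L) (i : Fin 3) : h.lift ≠ .inl (.inr (), i) := by
  rcases h with p | l <;> simp [HalfEdge.lift]

/-- Attaching a leg at the two ends of an edge gives opposite results, by AS. -/
theorem JSpace.mk_attachAt_mate [Finite V] (M : Matching (HalfEdge V L)) (h : HalfEdge V L) :
    JSpace.mk (M.attachAt (M.mate h)) = -JSpace.mk (M.attachAt h) := by
  classical
  rw [← JSpace.mk_exchange_zero_two _ (.inr ())]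
  congr 1
  unfold Matching.attachAt
  rw [Matching.exchange_eq_map, Matching.exchange_eq_map, Matching.exchange_eq_map,
    Matching.map_map]
  set B := M.addLollipop
  set u0 : HalfEdge (V ⊕ Unit) (Option L) := .inl (.inr (), 0)
  set u2 : HalfEdge (V ⊕ Unit) (Option L) := .inl (.inr (), 2)
  set a := h.lift
  set b := (M.mate h).lift
  have hab : a ≠ b := fun e => M.mate_ne h (HalfEdge.lift_injective e).symm
  have ha0 : a ≠ u0 := HalfEdge.lift_ne _ _
  have ha2 : a ≠ u2 := HalfEdge.lift_ne _ _
  have hb0 : b ≠ u0 := HalfEdge.lift_ne _ _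
  have hb2 : b ≠ u2 := HalfEdge.lift_ne _ _
  have h02 : u0 ≠ u2 := by simp [u0, u2]
  have m1 : B.mate a = b := M.addLollipop_mate_lift h
  have m2 : B.mate u0 = u2 := M.addLollipop_mate_zero
  have m3 : B.mate b = a := by rw [← m1, B.mate_mate]
  have m4 : B.mate u2 = u0 := by rw [← m2, B.mate_mate]
  -- the two permutations differ by one that exchanges the edges `a b` and `u0 u2`
  have hg : B.map ((Equiv.swap a u0).trans ((Equiv.swap u0 u2).trans (Equiv.swap b u0))) = B := by
    refine Matching.map_eq_of_mate fun x => ?_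
    simp only [Equiv.trans_apply]
    by_cases x1 : x = a
    · subst x1
      rw [Equiv.swap_apply_left, Equiv.swap_apply_left, Equiv.swap_apply_of_ne_of_ne hb2.symm
        h02.symm, m1, m4, Equiv.swap_apply_of_ne_of_ne hab.symm hb0,
        Equiv.swap_apply_of_ne_of_ne hb0 hb2, Equiv.swap_apply_left]
    by_cases x2 : x = u0
    · subst x2
      rw [Equiv.swap_apply_right, Equiv.swap_apply_of_ne_of_ne ha0 ha2,
        Equiv.swap_apply_of_ne_of_ne hab ha0, m2, m1, Equiv.swap_apply_of_ne_of_ne ha2.symm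
        h02.symm, Equiv.swap_apply_right, Equiv.swap_apply_right]
    by_cases x3 : x = b
    · subst x3
      rw [Equiv.swap_apply_of_ne_of_ne hab.symm hb0, Equiv.swap_apply_of_ne_of_ne hb0 hb2,
        Equiv.swap_apply_left, m3, m2, Equiv.swap_apply_left, Equiv.swap_apply_left,
        Equiv.swap_apply_of_ne_of_ne hb2.symm h02.symm]
    by_cases x4 : x = u2
    · subst x4
      rw [Equiv.swap_apply_of_ne_of_ne ha2.symm h02.symm, Equiv.swap_apply_right,
        Equiv.swap_apply_right, m3, m4, Equiv.swap_apply_right, Equiv.swap_apply_of_ne_of_ne ha0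
        ha2, Equiv.swap_apply_of_ne_of_ne hab ha0]
    have y : ∀ c d : HalfEdge (V ⊕ Unit) (Option L), B.mate c = d → x ≠ d → B.mate x ≠ c := by
      rintro c d hcd hx rfl
      rw [B.mate_mate] at hcd
      exact hx hcd
    rw [Equiv.swap_apply_of_ne_of_ne x1 x2, Equiv.swap_apply_of_ne_of_ne x2 x4,
      Equiv.swap_apply_of_ne_of_ne x3 x2, Equiv.swap_apply_of_ne_of_ne (y _ _ m1 x3) (y _ _ m2 x4),
      Equiv.swap_apply_of_ne_of_ne (y _ _ m2 x4) (y _ _ m4 x2),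
      Equiv.swap_apply_of_ne_of_ne (y _ _ m3 x1) (y _ _ m2 x4)]
  conv_lhs => rw [← hg, Matching.map_map]
  congr 1
  ext x
  simp

/-- A leg attached in turn to the three half-edges at a vertex: the sum vanishes by IHX. -/
theorem JSpace.sum_mk_attachAt_vertex [Finite V] (M : Matching (HalfEdge V L)) (v : V) :
    ∑ i : Fin 3, JSpace.mk (M.attachAt (.inl (v, i))) = 0 := by
  classical
  -- IHX for the edge between `v` and the vertex of the new leg
  have h := JSpace.mk_ihx_two (M.attachAt (.inl (v, 0))) (v := .inl v) (w := .inr ()) (by simp) (by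
    unfold Matching.attachAt
    rw [Matching.exchange_eq_map]
    change Equiv.swap _ _ (M.addLollipop.mate (Equiv.swap _ _ (HalfEdge.lift (.inl (v, 0))))) = _
    rw [Equiv.swap_apply_left, Matching.addLollipop_mate_zero]
    exact Equiv.swap_apply_of_ne_of_ne (HalfEdge.lift_ne _ _).symm (by simp))
  rw [Fin.sum_univ_three, ← h, add_assoc, add_assoc]
  congr 1
  rw [add_comm]
  have h1 : HalfEdge.lift (L := L) (.inl (v, 0)) = .inl (.inl v, 0) := rfl
  have h2 : HalfEdge.lift (L := L) (.inl (v, 1)) = .inl (.inl v, 1) := rfl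
  have h3 : HalfEdge.lift (L := L) (.inl (v, 2)) = .inl (.inl v, 2) := rfl
  congr 1
  -- the other two terms of IHX agree with attachments after `v` is turned by one or two steps
  · rw [← JSpace.mk_congr (Equiv.refl _) (Pi.single (.inl v) 1)]
    congr 1
    unfold Matching.attachAt
    simp only [Matching.exchange_eq_map, Matching.map_map, h1, h3]
    congr 1
    ext x
    rcases x with ⟨v' | u, i⟩ | l
    · by_cases hv : v' = v
      · subst hv
        fin_cases i <;> simp [HalfEdge.congr, Equiv.swap_apply_def]
      · simp [HalfEdge.congr, Equiv.swap_apply_def, hv]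
    · fin_cases i <;> simp [HalfEdge.congr, Equiv.swap_apply_def]
    · simp [HalfEdge.congr, Equiv.swap_apply_def]
  · rw [← JSpace.mk_congr (Equiv.refl _) (Pi.single (.inl v) 2)]
    congr 1
    unfold Matching.attachAt
    simp only [Matching.exchange_eq_map, Matching.map_map, h1, h2]
    congr 1
    ext x
    rcases x with ⟨v' | u, i⟩ | l
    · by_cases hv : v' = v
      · subst hv
        fin_cases i <;> simp [HalfEdge.congr, Equiv.swap_apply_def]
      · simp [HalfEdge.congr, Equiv.swap_apply_def, hv]
    · fin_cases i <;> simp [HalfEdge.congr, Equiv.swap_apply_def]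
    · simp [HalfEdge.congr, Equiv.swap_apply_def]

/-- The fork that attaches `ι` to the leg `l` is the opened lollipop inserted into the edge that
ends at `l`. -/
theorem JSpace.attach_mk [Finite V] [DecidableEq L] (M : Matching (HalfEdge V L)) (l : L) :
    JSpace.attach l (JSpace.mk M) = JSpace.mk (M.attachAt (.inr l)) := by
  classical
  have : Finite (Context.graft l).U := inferInstanceAs (Finite Unit)
  rw [JSpace.attach_eq_insert, JSpace.insert_mk]
  congr 1
  unfold Matching.attachAt Matching.addLollipop Matching.insert
  rw [Matching.exchange_eq_map, Matching.map_map]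
  change Matching.map _ _ = Matching.map _ (M.sum (Context.graft l).edges)
  congr 1
  ext x
  have key : ∀ a b : (HalfEdge V L) ⊕ (Bool × Bool), ∀ a' b',
      (Context.graft l).place V a = a' → (Context.lollipop L).place V b = b' →
      a' = Equiv.swap (HalfEdge.lift (.inr l)) (Sum.inl (Sum.inr (), 0)) b' →
      (Context.graft l).place V a = Equiv.swap (HalfEdge.lift (.inr l)) (Sum.inl (Sum.inr (), 0))
          ((Context.lollipop L).place V b) := by
    rintro a b _ _ rfl rfl h
    exact h
  rcases x with (p | k) | ⟨b, c⟩
  · refine key _ _ _ _ (Context.place_inl_inl (Context.graft l) V p)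
      (Context.place_inl_inl (Context.lollipop L) V p) ?_
    rw [Equiv.swap_apply_of_ne_of_ne] <;> simp [HalfEdge.lift]
  · refine key _ _ _ _ (Context.place_inl_inr (Context.graft l) V k)
      (Context.place_inl_inr (Context.lollipop L) V k) ?_
    rw [Context.graft_ends_inl]
    by_cases hl : k = l
    · simp [hl, HalfEdge.lift]
    · simp [hl, HalfEdge.lift, Equiv.swap_apply_of_ne_of_ne]
  · refine key (.inr (b, c)) (.inr (b, c)) _ _ (Context.place_inr (Context.graft l) V (b, c))
      (Context.place_inr (Context.lollipop L) V (b, c)) ?_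
    cases b <;> cases c <;> simp [HalfEdge.lift, Equiv.swap_apply_of_ne_of_ne]

/-- Invariance: attaching a leg to all legs of a diagram in turn gives zero. The attachments to all
half-edges cancel in pairs along the edges, and those to the half-edges at a vertex add up to zero,
so that those to the legs do as well. -/
theorem JSpace.sum_attach [Fintype L] [DecidableEq L] (x : JSpace L) :
    ∑ l, JSpace.attach l x = 0 := by
  classical
  have : ∑ l : L, JSpace.attach l = 0 := by
    refine JSpace.hom_ext fun V _ M => ?_
    have := Fintype.ofFinite V
    simp only [LinearMap.sum_apply, LinearMap.zero_apply, JSpace.attach_mk]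
    have h : ∑ h : HalfEdge V L, JSpace.mk (M.attachAt h) = 0 := by
      refine Finset.sum_involution (fun h _ => M.mate h) (fun h _ => ?_) (fun h _ _ => M.mate_ne h)
        (fun _ _ => Finset.mem_univ _) (fun h _ => M.mate_mate h)
      rw [JSpace.mk_attachAt_mate, add_neg_cancel]
    rw [Fintype.sum_sum_type, Fintype.sum_prod_type, Finset.sum_eq_zero, zero_add] at h
    · exact h
    · exact fun v _ => JSpace.sum_mk_attachAt_vertex M v
  rw [← LinearMap.sum_apply, this, LinearMap.zero_apply]

/-- Two legs attached in succession satisfy a Jacobi identity. It is `JSpace.sum_attach` for a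
diagram with a leg attached to `k`: the attachments to legs other than `k` commute with the first
one, so `JSpace.sum_attach` also evaluates their sum. -/
theorem JSpace.attach_attach_jacobi [Fintype L] [DecidableEq L] (k : L) (x : JSpace L) :
    JSpace.attach (some k) (JSpace.attach k x) =
      JSpace.relabel (Equiv.swap none (some none)) (JSpace.attach (some k) (JSpace.attach k x)) -
        JSpace.attach none (JSpace.attach k x) := by
  have h1 := JSpace.sum_attach (JSpace.attach k x)
  rw [Fintype.sum_option, ← Finset.add_sum_erase _ _ (Finset.mem_univ k)] at h1
  have h2 : ∑ j ∈ Finset.univ.erase k, JSpace.attach (some j) (JSpace.attach k x) =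
      -JSpace.relabel (Equiv.swap none (some none))
        (JSpace.attach (some k) (JSpace.attach k x)) := by
    rw [Finset.sum_congr rfl fun j hj => JSpace.attach_attach_comm (Finset.ne_of_mem_erase hj) x,
      ← map_sum, ← map_sum, ← map_neg, ← map_neg]
    congr 2
    rw [eq_neg_iff_add_eq_zero, Finset.sum_erase_add _ _ (Finset.mem_univ k), JSpace.sum_attach]
  rw [h2] at h1
  rw [eq_sub_iff_add_eq, ← sub_eq_zero, ← h1]
  abel

end
/-! ### Forks and disjoint unions -/

section
variable {V V' L L' K K' : Type}

/-- Attaching contexts to both parts of a disjoint union. -/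
abbrev Context.sum (C : Context L K) (C' : Context L' K') : Context (L ⊕ L') (K ⊕ K') where
  U := C.U ⊕ C'.U
  K := C.K ⊕ C'.K
  edges := C.edges.sum C'.edges
  ends := (Equiv.sumSumSumComm L L' C.K C'.K).trans <|
    (Equiv.sumCongr C.ends C'.ends).trans (HalfEdge.union C.U C'.U K K')

theorem JSpace.union_insert_insert (C : Context L K) (C' : Context L' K') (x : JSpace L)
    (y : JSpace L') : JSpace.union (JSpace.insert C x) (JSpace.insert C' y) =
      JSpace.insert (C.sum C') (JSpace.union x y) := by
  have : JSpace.union.compl₁₂ (JSpace.insert C) (JSpace.insert C') =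
      JSpace.union.compr₂ (JSpace.insert (C.sum C')) := by
    refine JSpace.hom_ext fun V _ M => JSpace.hom_ext fun V' _ M' => ?_
    simp only [LinearMap.compl₁₂_apply, LinearMap.compr₂_apply, JSpace.insert_mk, JSpace.union_mk]
    have : Finite (C.sum C').U := inferInstanceAs (Finite (C.U ⊕ C'.U))
    refine (JSpace.mk_congr (Equiv.sumSumSumComm V C.U V' C'.U) 0 _).symm.trans (congrArg _ ?_)
    unfold Matching.insert Matching.union
    rw [Matching.sum_map, Matching.map_map, Matching.map_map]
    have h1 : ((M.sum M').map (HalfEdge.union V V' L L')).sum (C.sum C').edges =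
        ((M.sum C.edges).sum (M'.sum C'.edges)).map
          ((Equiv.sumSumSumComm _ _ _ _).trans
            (Equiv.sumCongr (HalfEdge.union V V' L L') (Equiv.refl _))) := by
      symm
      refine Matching.map_eq_of_mate ?_
      rintro ((x | x) | (x | x)) <;> simp [Matching.sum, Matching.map]
    rw [h1, Matching.map_map]
    congr 1
    ext x
    rcases x with ((p | l) | k) | ((p | l) | k)
    · simp only [Equiv.trans_apply, Equiv.sumCongr_apply, Sum.map_inl, Context.place_inl_inl]
      refine Eq.trans ?_ (Context.place_inl_inl (C.sum C') _ _).symm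
      simp [HalfEdge.union, HalfEdge.congr]
    · simp only [Equiv.trans_apply, Equiv.sumCongr_apply, Sum.map_inl, Context.place_inl_inr]
      refine Eq.trans ?_ (Context.place_inl_inr (C.sum C') _ (.inl l)).symm
      simp only [Equiv.trans_apply, Equiv.sumSumSumComm_apply, Equiv.sumCongr_apply]
      simp only [HalfEdge.union, HalfEdge.congr]
      rcases h : C.ends (.inl l) with q | q <;> simp [h]
    · simp only [Equiv.trans_apply, Equiv.sumCongr_apply, Sum.map_inl, Context.place_inr]
      refine Eq.trans ?_ (Context.place_inr (C.sum C') _ (.inl k)).symm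
      simp only [Equiv.trans_apply, Equiv.sumSumSumComm_apply, Equiv.sumCongr_apply]
      simp only [HalfEdge.union, HalfEdge.congr]
      rcases h : C.ends (.inr k) with q | q <;> simp [h]
    · simp only [Equiv.trans_apply, Equiv.sumCongr_apply, Sum.map_inr, Context.place_inl_inl]
      refine Eq.trans ?_ (Context.place_inl_inl (C.sum C') _ _).symm
      simp [HalfEdge.union, HalfEdge.congr]
    · simp only [Equiv.trans_apply, Equiv.sumCongr_apply, Sum.map_inr, Context.place_inl_inr]
      refine Eq.trans ?_ (Context.place_inl_inr (C.sum C') _ (.inr l)).symm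
      simp only [Equiv.trans_apply, Equiv.sumSumSumComm_apply, Equiv.sumCongr_apply]
      simp only [HalfEdge.union, HalfEdge.congr]
      rcases h : C'.ends (.inl l) with q | q <;> simp [h]
    · simp only [Equiv.trans_apply, Equiv.sumCongr_apply, Sum.map_inr, Context.place_inr]
      refine Eq.trans ?_ (Context.place_inr (C.sum C') _ (.inr k)).symm
      simp only [Equiv.trans_apply, Equiv.sumSumSumComm_apply, Equiv.sumCongr_apply]
      simp only [HalfEdge.union, HalfEdge.congr]
      rcases h : C'.ends (.inr k) with q | q <;> simp [h]
  exact LinearMap.congr_fun₂ this x y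

/-- The context without vertices and edges. -/
abbrev Context.trivial (L : Type) : Context L L where
  U := Empty
  K := Empty
  edges := ⟨Empty.elim, Empty.rec, Empty.rec⟩
  ends := (Equiv.sumEmpty L Empty).trans (Equiv.emptySum (Empty × Fin 3) L).symm

theorem JSpace.insert_trivial (x : JSpace L) : JSpace.insert (Context.trivial L) x = x := by
  refine LinearMap.congr_fun (g := LinearMap.id) ?_ x
  refine JSpace.hom_ext fun V _ M => ?_
  simp only [JSpace.insert_mk, LinearMap.id_apply]
  have : Finite (Context.trivial L).U := inferInstanceAs (Finite Empty)
  refine (JSpace.mk_congr (Equiv.sumEmpty V Empty) 0 _).symm.trans (congrArg _ ?_)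
  unfold Matching.insert
  rw [Matching.map_map]
  refine Matching.map_eq_of_mate ?_
  have h : ∀ x, ((Context.trivial L).place V).trans (HalfEdge.congr L (Equiv.sumEmpty V Empty) 0)
      (.inl x) = x := by
    rintro (p | l)
    · refine (congrArg (HalfEdge.congr L (Equiv.sumEmpty V Empty) 0)
        (Context.place_inl_inl (Context.trivial L) V p)).trans ?_
      simp [HalfEdge.congr]
    · rfl
  rintro (x | x)
  · rw [h]
    exact (h _).symm
  · exact x.elim

/-- Attaching a leg to the left part of a disjoint union. -/
theorem JSpace.attach_inl_union [DecidableEq L] [DecidableEq L'] (k : L) (x : JSpace L)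
    (y : JSpace L') (e : Option L ⊕ L' ≃ Option (L ⊕ L')) (h0 : e (.inl none) = none)
    (h1 : ∀ l, e (.inl (some l)) = some (.inl l)) (h2 : ∀ l, e (.inr l) = some (.inr l)) :
    JSpace.attach (.inl k) (JSpace.union x y) =
      JSpace.relabel e (JSpace.union (JSpace.attach k x) y) := by
  conv_rhs => rw [← JSpace.insert_trivial y]
  rw [JSpace.attach_eq_insert, JSpace.attach_eq_insert, JSpace.union_insert_insert]
  have key := JSpace.insert_relabel ((Context.graft k).sum (Context.trivial L'))
    (Context.graft (.inl k)) (Equiv.refl _) e (Equiv.sumEmpty Unit Empty)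
    (Equiv.sumEmpty (Bool × Bool) Empty) (by
    rintro (x | x)
    · rfl
    · exact x.elim) (by
    rintro ((l | l) | ((⟨b, c⟩) | x))
    · by_cases hl : l = k
      · simp [hl, HalfEdge.union]
      · simp [hl, HalfEdge.union, h1]
    · simp [HalfEdge.union, h2]
    · cases b <;> cases c <;> simp [HalfEdge.union, h0, h1]
    · exact x.elim) (JSpace.union x y)
  rw [JSpace.relabel_refl] at key
  exact key

/-- Attaching a leg to the right part of a disjoint union. -/
theorem JSpace.attach_inr_union [DecidableEq L] [DecidableEq L'] (k : L') (x : JSpace L)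
    (y : JSpace L') (e : L ⊕ Option L' ≃ Option (L ⊕ L')) (h0 : e (.inr none) = none)
    (h1 : ∀ l, e (.inl l) = some (.inl l)) (h2 : ∀ l, e (.inr (some l)) = some (.inr l)) :
    JSpace.attach (.inr k) (JSpace.union x y) =
      JSpace.relabel e (JSpace.union x (JSpace.attach k y)) := by
  conv_rhs => rw [← JSpace.insert_trivial x]
  rw [JSpace.attach_eq_insert, JSpace.attach_eq_insert, JSpace.union_insert_insert]
  have key := JSpace.insert_relabel ((Context.trivial L).sum (Context.graft k))
    (Context.graft (.inr k)) (Equiv.refl _) e (Equiv.emptySum Empty Unit)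
    (Equiv.emptySum Empty (Bool × Bool)) (by
    rintro (x | x)
    · exact x.elim
    · rfl) (by
    rintro ((l | l) | (x | (⟨b, c⟩)))
    · simp [HalfEdge.union, h1]
    · by_cases hl : l = k
      · simp [hl, HalfEdge.union]
      · simp [hl, HalfEdge.union, h2]
    · exact x.elim
    · cases b <;> cases c <;> simp [HalfEdge.union, h0, h2]) (JSpace.union x y)
  rw [JSpace.relabel_refl] at key
  exact key

section
variable [DecidableEq L] [DecidableEq L']

/-- The set of legs of a disjoint union that carry forks, split by the two parts. -/
def disjSumEquiv (S : Finset L) (S' : Finset L') : S ⊕ S' ≃ S.disjSum S' where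
  toFun := Sum.elim (fun s => ⟨.inl s, Finset.inl_mem_disjSum.2 s.2⟩)
    fun s => ⟨.inr s, Finset.inr_mem_disjSum.2 s.2⟩
  invFun := fun
    | ⟨.inl s, h⟩ => .inl ⟨s, Finset.inl_mem_disjSum.1 h⟩
    | ⟨.inr s, h⟩ => .inr ⟨s, Finset.inr_mem_disjSum.1 h⟩
  left_inv := by rintro (s | s) <;> rfl
  right_inv := by rintro ⟨s | s, h⟩ <;> rfl

/-- The legs of a disjoint union of diagrams with forks on `S` and `S'`. -/
def forkUnionEquiv (S : Finset L) (S' : Finset L') :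
    (L ⊕ S) ⊕ (L' ⊕ S') ≃ (L ⊕ L') ⊕ S.disjSum S' :=
  (Equiv.sumSumSumComm L S L' S').trans (Equiv.sumCongr (Equiv.refl _) (disjSumEquiv S S'))

/-- Forks may be grafted before or after taking a disjoint union. -/
theorem JSpace.insert_fork_union (S : Finset L) (S' : Finset L') (x : JSpace L) (y : JSpace L') :
    JSpace.insert (forkContext (S.disjSum S')) (JSpace.union x y) =
      JSpace.relabel (forkUnionEquiv S S') (JSpace.union (JSpace.insert (forkContext S) x)
        (JSpace.insert (forkContext S') y)) := by
  rw [JSpace.union_insert_insert]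
  conv_lhs => rw [← JSpace.relabel_refl (JSpace.union x y)]
  refine JSpace.insert_relabel ((forkContext S).sum (forkContext S'))
    (forkContext (S.disjSum S')) (Equiv.refl _) _ (disjSumEquiv S S')
    ((Equiv.sumProdDistrib S S' (Bool × Bool)).symm.trans
      (Equiv.prodCongr (disjSumEquiv S S') (Equiv.refl _))) ?_ ?_ _
  · rintro (⟨s, b, c⟩ | ⟨s, b, c⟩) <;> rfl
  · rintro ((l | l) | (⟨s, b, c⟩ | ⟨s, b, c⟩))
    · change forkEnds (S.disjSum S') (.inl (.inl l)) = Sum.map _ _ (HalfEdge.union _ _ _ _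
        (.inl (forkEnds S (.inl l))))
      by_cases h : l ∈ S
      · rw [forkEnds_mem S l h]
        exact forkEnds_mem (S.disjSum S') (.inl l) (Finset.inl_mem_disjSum.2 h)
      · rw [forkEnds_not_mem S l h]
        exact forkEnds_not_mem (S.disjSum S') (.inl l) (by simpa using h)
    · change forkEnds (S.disjSum S') (.inl (.inr l)) = Sum.map _ _ (HalfEdge.union _ _ _ _
        (.inr (forkEnds S' (.inl l))))
      by_cases h : l ∈ S'
      · rw [forkEnds_mem S' l h]
        exact forkEnds_mem (S.disjSum S') (.inr l) (Finset.inr_mem_disjSum.2 h)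
      · rw [forkEnds_not_mem S' l h]
        exact forkEnds_not_mem (S.disjSum S') (.inr l) (by simpa using h)
    · cases b <;> cases c <;> rfl
    · cases b <;> cases c <;> rfl

/-- An element of `S` is either `l` or another element. -/
def eraseEquiv {S : Finset L} {l : L} (h : l ∈ S) : S ≃ Option (S.erase l) where
  toFun s := if hs : s.1 = l then none else some ⟨s, Finset.mem_erase.2 ⟨hs, s.2⟩⟩
  invFun := Option.elim' ⟨l, h⟩ fun s => ⟨s, Finset.mem_of_mem_erase s.2⟩
  left_inv := by
    rintro ⟨s, hs⟩
    by_cases h : s = l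
    · subst h; simp
    · simp [h]
  right_inv := by
    rintro (_ | ⟨s, hs⟩)
    · simp
    · simp [Finset.ne_of_mem_erase hs]

/-- The legs after forks are grafted on the legs in `S`, with the left tine at `l ∈ S` singled
out. -/
def tineEquiv {S : Finset L} {l : L} (h : l ∈ S) : L ⊕ S ≃ Option (L ⊕ S.erase l) where
  toFun := Sum.elim (fun a => some (.inl a)) fun s => (eraseEquiv h s).map .inr
  invFun := Option.elim' (.inr ⟨l, h⟩) <|
    Sum.elim .inl fun s => .inr ⟨s, Finset.mem_of_mem_erase s.2⟩
  left_inv := by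
    rintro (a | s)
    · rfl
    · have h1 := (eraseEquiv h).symm_apply_apply s
      rcases h2 : eraseEquiv h s with _ | t
      · rw [h2] at h1; rw [← h1]; simp [eraseEquiv]
      · rw [h2] at h1; rw [← h1]; simp [eraseEquiv, Finset.ne_of_mem_erase t.2]
  right_inv := by
    rintro (_ | a | s)
    · simp [eraseEquiv]
    · rfl
    · simp [eraseEquiv, Finset.ne_of_mem_erase s.2]

@[simp] theorem tineEquiv_inl {S : Finset L} {l : L} (h : l ∈ S) (a : L) :
    tineEquiv h (.inl a) = some (.inl a) := rfl

@[simp] theorem tineEquiv_inr_self {S : Finset L} {l : L} (h : l ∈ S) :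
    tineEquiv h (.inr ⟨l, h⟩) = none := by simp [tineEquiv, eraseEquiv]

@[simp] theorem tineEquiv_symm_none {S : Finset L} {l : L} (h : l ∈ S) :
    (tineEquiv h).symm none = .inr ⟨l, h⟩ := rfl

@[simp] theorem tineEquiv_symm_inl {S : Finset L} {l : L} (h : l ∈ S) (a : L) :
    (tineEquiv h).symm (some (.inl a)) = .inl a := rfl

@[simp] theorem tineEquiv_symm_inr {S : Finset L} {l : L} (h : l ∈ S) (s : S.erase l) :
    (tineEquiv h).symm (some (.inr s)) = .inr ⟨s, Finset.mem_of_mem_erase s.2⟩ := rfl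

/-- A fork on `l` is the attachment of a leg to `l`. -/
theorem JSpace.relabel_insert_fork {S : Finset L} {l : L} (h : l ∈ S) (x : JSpace L) :
    JSpace.relabel (tineEquiv h) (JSpace.insert (forkContext S) x) =
      JSpace.attach (.inl l) (JSpace.insert (forkContext (S.erase l)) x) := by
  rw [JSpace.attach_eq_insert, JSpace.insert_insert]
  conv_rhs => rw [← JSpace.relabel_refl x]
  symm
  let u : S ≃ S.erase l ⊕ Unit := (eraseEquiv h).trans (Equiv.optionEquivSumPUnit _)
  have hu : ∀ s (hs : s ∈ S) (hsl : s ≠ l), u ⟨s, hs⟩ = .inl ⟨s, Finset.mem_erase.2 ⟨hsl, hs⟩⟩ := by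
    intro s hs hsl
    simp [u, eraseEquiv, hsl]
  have hul : ∀ h', u ⟨l, h'⟩ = .inr () := by
    intro h'
    simp [u, eraseEquiv]
  refine JSpace.insert_relabel (forkContext S)
    ((forkContext (S.erase l)).comp (Context.graft (.inl l))) (Equiv.refl _) _ u
    ((Equiv.prodCongr u (Equiv.refl (Bool × Bool))).trans
      ((Equiv.sumProdDistrib _ _ _).trans (Equiv.sumCongr (Equiv.refl _) (Equiv.punitProd _))))
    ?_ ?_ _
  · rintro ⟨s, b, c⟩
    change ((forkContext (S.erase l)).comp (Context.graft (.inl l))).edges.mate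
      (Sum.map id (Equiv.punitProd _) (Equiv.sumProdDistrib _ _ _ (u s, (b, c)))) =
      Sum.map id (Equiv.punitProd _) (Equiv.sumProdDistrib _ _ _ (u s, (b, !c)))
    rcases u s with t | t <;> rfl
  · rintro (a | ⟨⟨s, hs⟩, b, c⟩)
    · change ((forkContext (S.erase l)).comp (Context.graft (.inl l))).ends (.inl a) =
        Sum.map (Prod.map u id) (tineEquiv h) (forkEnds S (.inl a))
      rw [Context.comp_ends_inl]
      change Sum.elim _ _ (forkEnds (S.erase l) (.inl a)) = _
      by_cases ha : a ∈ S
      · rw [forkEnds_mem S a ha]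
        by_cases hal : a = l
        · subst hal
          rw [forkEnds_not_mem _ _ (by simp)]
          change Sum.map (fun q => (Sum.inr q.1, q.2)) id
            ((Context.graft (.inl a : L ⊕ S.erase a)).ends (.inl (.inl a))) = _
          rw [Context.graft_ends_inl]
          simp [hul]
          rfl
        · rw [forkEnds_mem _ a (Finset.mem_erase.2 ⟨hal, ha⟩)]
          simp only [Sum.map_inl, Prod.map_apply, hu _ ha hal]
          rfl
      · rw [forkEnds_not_mem S a ha, forkEnds_not_mem _ a fun h' => ha (Finset.mem_of_mem_erase h')]
        have hal : a ≠ l := fun h' => ha (h' ▸ h)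
        change Sum.map (fun q => (Sum.inr q.1, q.2)) id
          ((Context.graft (.inl l : L ⊕ S.erase l)).ends (.inl (.inl a))) = _
        rw [Context.graft_ends_inl]
        simp [hal]
        rfl
    · change ((forkContext (S.erase l)).comp (Context.graft (.inl l))).ends
        (.inr (Sum.map id (Equiv.punitProd _) (Equiv.sumProdDistrib _ _ _ (u ⟨s, hs⟩, (b, c))))) =
        Sum.map (Prod.map u id) (tineEquiv h) (forkEnds S (.inr (⟨s, hs⟩, b, c)))
      by_cases hsl : s = l
      · subst hsl
        rw [hul]
        refine (Context.comp_ends_inr_inr (forkContext (S.erase s)) (Context.graft (.inl s))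
          (b, c)).trans ?_
        cases b <;> cases c <;> (simp [forkEnds, hul]; rfl)
      · rw [hu s hs hsl]
        refine (Context.comp_ends_inr_inl (forkContext (S.erase l)) (Context.graft (.inl l))
          (_, (b, c))).trans ?_
        have e1 : tineEquiv h (.inr ⟨s, hs⟩) =
            some (.inr ⟨s, Finset.mem_erase.2 ⟨hsl, hs⟩⟩) := by
          simp [tineEquiv, eraseEquiv, hsl]
        cases b <;> cases c
        · change _ = Sum.inl (u ⟨s, hs⟩, 1)
          rw [hu s hs hsl]
          rfl
        · change Sum.map (fun q => (Sum.inr q.1, q.2)) id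
              ((Context.graft (.inl l : L ⊕ S.erase l)).ends
            (.inl (.inr ⟨s, _⟩))) = Sum.inr (tineEquiv h (.inr ⟨s, hs⟩))
          rw [e1, Context.graft_ends_inl, if_neg (by simp)]
          rfl
        · change _ = Sum.inl (u ⟨s, hs⟩, 2)
          rw [hu s hs hsl]
          rfl
        · change Sum.map (fun q => (Sum.inr q.1, q.2)) id
              ((Context.graft (.inl l : L ⊕ S.erase l)).ends
            (.inl (.inl s))) = Sum.inr (some (.inl s))
          rw [Context.graft_ends_inl, if_neg fun h' => hsl (Sum.inl_injective h')]
          rfl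

end
end
/-! ### Diagrams with legs ordered by a key -/

theorem LegGrade.eq_one_or_two (a : LegGrade) : a = .one ∨ a = .two := by cases a <;> simp

theorem LegGrade.eq_two_of_ne_one {a : LegGrade} (h : a ≠ .one) : a = .two :=
  a.eq_one_or_two.resolve_left h

/-- The sign picked up by an odd operator that moves past the legs before `k`, in the order given by
`key`. -/
def passSignBy {X A : Type} [Fintype X] [LinearOrder A] (key : X → A) (g : X → LegGrade) (k : X) :
    ℚ := ∏ x, if key x < key k then (-1 : ℚ) ^ (g x).deg else 1

/-- Two numberings that induce the same order are equal, as there is only one order automorphism of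
`Fin N`. -/
theorem rankBy_order_unique {X : Type} {N N' : ℕ} (σ : X ≃ Fin N) (σ' : X ≃ Fin N')
    (h : ∀ x y, σ x < σ y ↔ σ' x < σ' y) (x : X) : (σ x : ℕ) = σ' x := by
  have hN : N = N' := by simpa using Fintype.card_congr (σ.symm.trans σ')
  subst hN
  let f : Fin N ≃o Fin N := (σ.symm.trans σ').toOrderIso
    (fun a b hab => le_of_not_gt fun hlt => by
      have := (h (σ.symm b) (σ.symm a)).2 hlt
      simp only [Equiv.apply_symm_apply] at this
      exact absurd hab (not_le_of_gt this))
    (fun a b hab => le_of_not_gt fun hlt => by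
      have := (h (σ'.symm b) (σ'.symm a)).1 hlt
      simp only [Equiv.apply_symm_apply] at this
      exact absurd hab (not_le_of_gt this))
  have h1 : f (σ x) = σ' x := congrArg σ' (σ.symm_apply_apply x)
  rw [← h1, Subsingleton.elim f (OrderIso.refl _)]
  rfl

theorem NCWeil.place_congr {X : Type} {N N' : ℕ} (σ : X ≃ Fin N) (σ' : X ≃ Fin N')
    (h : ∀ x y, σ x < σ y ↔ σ' x < σ' y) (g : X → LegGrade) :
    NCWeil.place σ g = NCWeil.place σ' g := by
  have hN : N = N' := by simpa using Fintype.card_congr (σ.symm.trans σ')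
  subst hN
  rw [show σ = σ' from Equiv.ext fun x => Fin.ext (rankBy_order_unique σ σ' h x)]

theorem NCWeilIota.place_congr {X : Type} {N N' : ℕ} (σ : X ≃ Fin N) (σ' : X ≃ Fin N')
    (h : ∀ x y, σ x < σ y ↔ σ' x < σ' y) (g : X → LegGrade) :
    NCWeilIota.place σ g = NCWeilIota.place σ' g := by
  have hN : N = N' := by simpa using Fintype.card_congr (σ.symm.trans σ')
  subst hN
  rw [show σ = σ' from Equiv.ext fun x => Fin.ext (rankBy_order_unique σ σ' h x)]

theorem NCWeilIota.place_relabel {X Y : Type} {N : ℕ} (σ : X ≃ Y) (τ : Y ≃ Fin N) (g : Y → LegGrade)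
    (x : JSpace (Option X)) :
    NCWeilIota.place τ g (JSpace.relabel (Equiv.optionCongr σ) x) =
      NCWeilIota.place (σ.trans τ) (g ∘ σ) x := by
  unfold NCWeilIota.place
  rw [LinearMap.comp_apply, LinearMap.comp_apply, JSpace.relabel_relabel]
  congr 3
  · ext k
    simp
  · ext k
    simp

theorem update_comp_symm {X Y : Type} [DecidableEq X] [DecidableEq Y] (σ : X ≃ Y)
    (g : X → LegGrade) (k : X) (a : LegGrade) :
    Function.update (g ∘ σ.symm) (σ k) a = Function.update g k a ∘ σ.symm := by
  ext y
  obtain ⟨x, rfl⟩ := σ.surjective y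
  by_cases h : x = k
  · subst h; simp
  · simp [h, Function.update_of_ne]

section
variable {X Y A B : Type} [Fintype X] [Fintype Y] [LinearOrder A] [LinearOrder B]

theorem passSign_eq {n : ℕ} (g : Fin n → LegGrade) (k : Fin n) :
    passSign g k = passSignBy (id : Fin n → Fin n) g k := by
  unfold passSign passSignBy
  rw [Finset.prod_filter]
  rfl

theorem passSignBy_congr {key : X → A} {key' : X → B} (h : ∀ x y, key x < key y ↔ key' x < key' y)
    (g : X → LegGrade) (k : X) : passSignBy key g k = passSignBy key' g k := by
  unfold passSignBy
  simp only [h]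

theorem passSignBy_comp (e : X ≃ Y) (key : Y → A) (g : Y → LegGrade) (k : X) :
    passSignBy (key ∘ e) (g ∘ e) k = passSignBy key g (e k) := by
  unfold passSignBy
  rw [← e.prod_comp]
  rfl

theorem passSignBy_mul_self (key : X → A) (g : X → LegGrade) (k : X) :
    passSignBy key g k * passSignBy key g k = 1 := by
  unfold passSignBy
  rw [← Finset.prod_mul_distrib]
  refine Finset.prod_eq_one fun x _ => ?_
  split_ifs
  · rw [← mul_pow]; norm_num
  · norm_num

/-- Arrange the legs `X`, of grades `g`, in increasing order of an injective key. -/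
noncomputable def NCWeil.ordered (key : X → A) (hkey : Function.Injective key)
    (g : X → LegGrade) : JSpace X →ₗ[ℚ] NCWeil := NCWeil.place (rankBy key hkey) g

/-- Arrange the legs `X`, of grades `g`, other than `ι`, in increasing order of an injective key. -/
noncomputable def NCWeilIota.ordered (key : X → A) (hkey : Function.Injective key)
    (g : X → LegGrade) : JSpace (Option X) →ₗ[ℚ] NCWeilIota :=
  NCWeilIota.place (rankBy key hkey) g

theorem NCWeil.ordered_congr {key : X → A} {key' : X → B} (hkey : Function.Injective key)
    (hkey' : Function.Injective key') (h : ∀ x y, key x < key y ↔ key' x < key' y)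
    (g : X → LegGrade) : NCWeil.ordered key hkey g = NCWeil.ordered key' hkey' g :=
  NCWeil.place_congr _ _ (fun x y => by rw [rankBy_lt, rankBy_lt, h]) g

theorem NCWeilIota.ordered_congr {key : X → A} {key' : X → B} (hkey : Function.Injective key)
    (hkey' : Function.Injective key') (h : ∀ x y, key x < key y ↔ key' x < key' y)
    (g : X → LegGrade) : NCWeilIota.ordered key hkey g = NCWeilIota.ordered key' hkey' g :=
  NCWeilIota.place_congr _ _ (fun x y => by rw [rankBy_lt, rankBy_lt, h]) g

theorem NCWeil.place_eq_ordered {N : ℕ} (σ : X ≃ Fin N) (g : X → LegGrade) :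
    NCWeil.place σ g = NCWeil.ordered σ σ.injective g :=
  NCWeil.place_congr _ _ (fun x y => by rw [rankBy_lt]) g

theorem NCWeilIota.place_eq_ordered {N : ℕ} (σ : X ≃ Fin N) (g : X → LegGrade) :
    NCWeilIota.place σ g = NCWeilIota.ordered σ σ.injective g :=
  NCWeilIota.place_congr _ _ (fun x y => by rw [rankBy_lt]) g

theorem NCWeil.ordered_relabel (e : X ≃ Y) (key : Y → A) (hkey : Function.Injective key)
    (g : Y → LegGrade) (x : JSpace X) : NCWeil.ordered key hkey g (JSpace.relabel e x) =
      NCWeil.ordered (key ∘ e) (hkey.comp e.injective) (g ∘ e) x := by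
  unfold NCWeil.ordered
  rw [NCWeil.place_relabel]
  exact LinearMap.congr_fun (NCWeil.place_congr _ _ (fun x y => by
    simp only [Equiv.trans_apply, rankBy_lt]; rfl) _) x

theorem NCWeilIota.ordered_relabel (e : X ≃ Y) (key : Y → A) (hkey : Function.Injective key)
    (g : Y → LegGrade) (x : JSpace (Option X)) :
    NCWeilIota.ordered key hkey g (JSpace.relabel (Equiv.optionCongr e) x) =
      NCWeilIota.ordered (key ∘ e) (hkey.comp e.injective) (g ∘ e) x := by
  unfold NCWeilIota.ordered
  rw [NCWeilIota.place_relabel]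
  exact LinearMap.congr_fun (NCWeilIota.place_congr _ _ (fun x y => by
    simp only [Equiv.trans_apply, rankBy_lt]; rfl) _) x

theorem NCWeil.lof_eq_ordered {n : ℕ} (g : Fin n → LegGrade) (x : JSpace (Fin n)) :
    DirectSum.lof ℚ Word (fun w => JSpace (Fin w.1)) ⟨n, g⟩ x =
      NCWeil.ordered (id : Fin n → Fin n) Function.injective_id g x := by
  rw [← NCWeil.place_refl, NCWeil.place_eq_ordered]
  rfl

theorem NCWeilIota.lof_eq_ordered {n : ℕ} (g : Fin n → LegGrade) (x : JSpace (Option (Fin n))) :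
    DirectSum.lof ℚ Word (fun w => JSpace (Option (Fin w.1))) ⟨n, g⟩ x =
      NCWeilIota.ordered (id : Fin n → Fin n) Function.injective_id g x := by
  have : NCWeilIota.place (Equiv.refl (Fin n)) g x =
      DirectSum.lof ℚ Word (fun w => JSpace (Option (Fin w.1))) ⟨n, g⟩ x := by
    unfold NCWeilIota.place
    rw [LinearMap.comp_apply, Equiv.optionCongr_refl, JSpace.relabel_refl]
    rfl
  rw [← this, NCWeilIota.place_eq_ordered]
  rfl

theorem NCWeil.hom_ext {M : Type*} [AddCommGroup M] [Module ℚ M] {f f' : NCWeil →ₗ[ℚ] M}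
    (h : ∀ n (g : Fin n → LegGrade) (x : JSpace (Fin n)),
      f (NCWeil.ordered id Function.injective_id g x) =
        f' (NCWeil.ordered id Function.injective_id g x)) : f = f' := by
  refine DirectSum.linearMap_ext _ fun ⟨n, g⟩ => LinearMap.ext fun x => ?_
  have := h n g x
  rw [← NCWeil.lof_eq_ordered] at this
  exact this

theorem NCWeil.d_ordered [DecidableEq X] (key : X → A) (hkey : Function.Injective key)
    (g : X → LegGrade) (x : JSpace X) : NCWeil.d (NCWeil.ordered key hkey g x) =
      ∑ k, if g k = .one then
        passSignBy key g k • NCWeil.ordered key hkey (Function.update g k .two) x else 0 := by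
  unfold NCWeil.ordered
  set σ := rankBy key hkey
  have h1 : NCWeil.place σ g x = DirectSum.lof ℚ Word (fun w => JSpace (Fin w.1))
    ⟨_, g ∘ σ.symm⟩ (JSpace.relabel σ x) := rfl
  rw [h1]
  unfold NCWeil.d
  rw [DirectSum.toModule_lof, LinearMap.sum_apply, ← σ.sum_comp]
  refine Finset.sum_congr rfl fun k _ => ?_
  have h2 : passSign (g ∘ σ.symm) (σ k) = passSignBy key g k := by
    rw [passSign_eq, ← passSignBy_comp σ]
    have : (g ∘ σ.symm) ∘ σ = g := by ext; simp
    rw [this]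
    exact passSignBy_congr (fun x y => rankBy_lt key hkey x y) g k
  rw [LinearMap.smul_apply]
  simp only [h2]
  have h3 : (g ∘ σ.symm) (σ k) = g k := by simp
  rw [h3]
  rcases h : g k with _ | _
  · rw [if_pos rfl, update_comp_symm]
    rfl
  · simp

/-- Diagrams in which the leg `k` has become `ι`: the remaining legs may be named by any type `Y`
instead of the subtype of legs other than `k`. -/
theorem NCWeilIota.ordered_removed [DecidableEq X] (key : X → A) (g : X → LegGrade) (k : X)
    (e : X ≃ Option Y) (he : e k = none) (x : JSpace X)
    (hk : Function.Injective fun j : {j // j ≠ k} => key j)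
    (hk' : Function.Injective fun y => key (e.symm (some y))) :
    NCWeilIota.ordered (fun j : {j // j ≠ k} => key j) hk (fun j => g j)
        (JSpace.relabel (Equiv.optionSubtypeNe k).symm x) =
      NCWeilIota.ordered (fun y => key (e.symm (some y))) hk' (fun y => g (e.symm (some y)))
        (JSpace.relabel e x) := by
  let f : {j // j ≠ k} ≃ Y :=
    { toFun := fun j => (e j).get (by
        rw [← Option.ne_none_iff_isSome, ← he]; exact e.injective.ne j.2)
      invFun := fun y => ⟨e.symm (some y), fun h => by
        rw [Equiv.symm_apply_eq, he] at h; exact Option.some_ne_none y h⟩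
      left_inv := fun j => by simp
      right_inv := fun y => by simp }
  have h1 : JSpace.relabel e x = JSpace.relabel (Equiv.optionCongr f)
      (JSpace.relabel (Equiv.optionSubtypeNe k).symm x) := by
    rw [JSpace.relabel_relabel]
    congr 2
    ext j : 1
    by_cases hj : j = k
    · subst hj; simp [he]
    · simp [Equiv.optionSubtypeNe_symm_of_ne hj, f]
  rw [h1, NCWeilIota.ordered_relabel]
  have h2 : ∀ j : {j // j ≠ k}, e.symm (some (f j)) = j := fun j => by simp [f]
  have h3 : (fun y => g (e.symm (some y))) ∘ f = fun j : {j // j ≠ k} => g j := by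
    ext j; simp [h2]
  rw [h3]
  refine LinearMap.congr_fun (NCWeilIota.ordered_congr _ _ (fun j j' => ?_) _) _
  simp [h2]

theorem NCWeil.iota_ordered [DecidableEq X] (key : X → A) (hkey : Function.Injective key)
    (g : X → LegGrade) (x : JSpace X) : NCWeil.iota (NCWeil.ordered key hkey g x) =
      ∑ k, passSignBy key g k • if g k = .one then
        NCWeilIota.ordered (fun j : {j // j ≠ k} => key j)
          (hkey.comp Subtype.val_injective) (fun j => g j)
          (JSpace.relabel (Equiv.optionSubtypeNe k).symm x)
        else NCWeilIota.ordered key hkey (Function.update g k .one) (JSpace.attach k x) := by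
  have h1 : NCWeil.ordered key hkey g x = DirectSum.lof ℚ Word (fun w => JSpace (Fin w.1))
    ⟨_, g ∘ (rankBy key hkey).symm⟩ (JSpace.relabel (rankBy key hkey) x) := rfl
  rw [h1]
  set σ := rankBy key hkey
  have hσ : ∀ x y, σ x < σ y ↔ key x < key y := rankBy_lt key hkey
  unfold NCWeil.iota
  rw [DirectSum.toModule_lof, LinearMap.sum_apply, ← σ.sum_comp]
  refine Finset.sum_congr rfl fun k _ => ?_
  have h2 : passSign (g ∘ σ.symm) (σ k) = passSignBy key g k := by
    rw [passSign_eq, ← passSignBy_comp σ]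
    have : (g ∘ σ.symm) ∘ σ = g := by ext; simp
    rw [this]
    exact passSignBy_congr hσ g k
  rw [LinearMap.smul_apply]
  simp only [h2]
  have h3 : (g ∘ σ.symm) (σ k) = g k := by simp
  rw [h3]
  rcases h : g k with _ | _
  · rw [if_pos rfl]
    congr 1
    rw [LinearMap.comp_apply]
    let f : {j // j ≠ k} ≃ {j // j ≠ σ k} := σ.subtypeEquiv fun j => by simp
    have h4 : JSpace.relabel (Equiv.optionSubtypeNe (σ k)).symm (JSpace.relabel σ x) =
        JSpace.relabel (Equiv.optionCongr f) (JSpace.relabel (Equiv.optionSubtypeNe k).symm x) := by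
      rw [JSpace.relabel_relabel, JSpace.relabel_relabel]
      congr 2
      ext j : 1
      by_cases hj : j = k
      · subst hj; simp
      · simp [Equiv.optionSubtypeNe_symm_of_ne hj,
          Equiv.optionSubtypeNe_symm_of_ne (σ.injective.ne hj), f]
    have h5 := NCWeilIota.ordered_relabel f (Subtype.val : {j // j ≠ σ k} → Fin _)
      Subtype.val_injective (fun j => (g ∘ σ.symm) j)
      (JSpace.relabel (Equiv.optionSubtypeNe k).symm x)
    rw [← h4] at h5
    refine h5.trans ?_
    have h6 : (fun j : {j // j ≠ σ k} => (g ∘ σ.symm) j) ∘ f = fun j : {j // j ≠ k} => g j := by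
      ext j; simp [f]
    rw [h6]
    refine LinearMap.congr_fun (NCWeilIota.ordered_congr _ _ (fun j j' => ?_) _) _
    exact hσ j j'
  · rw [if_neg (by simp)]
    congr 1
    rw [LinearMap.comp_apply, JSpace.attach_relabel, update_comp_symm]
    rfl

end
/-! ### Signs of reorderings -/

/-- The order that puts `a` first and `b` second, and orders the other legs as `key` does. -/
def pairFirst {X A : Type} [DecidableEq X] (a b : X) (key : X → A) (x : X) : ℕ ×ₗ A :=
  toLex (if x = a then 0 else if x = b then 1 else 2, key x)

theorem pairFirst_injective {X A : Type} [DecidableEq X] (a b : X) {key : X → A}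
    (hkey : Function.Injective key) : Function.Injective (pairFirst a b key) := fun _ _ h =>
  hkey (congrArg (fun p => (ofLex p).2) h)

section
variable {X Y A B C : Type} [Fintype X] [Fintype Y] [LinearOrder A] [LinearOrder B] [LinearOrder C]

theorem LegGrade.neg_one_pow_two_mul (a : LegGrade) :
    (-1 : ℚ) ^ (LegGrade.two.deg * a.deg) = 1 := by
  rw [show LegGrade.two.deg = 2 from rfl, pow_mul]; norm_num

theorem koszul_option (r : Option Y → A) (σ : Option Y → B) (hr : Function.Injective r)
    (hσ : Function.Injective σ) (g : Option Y → LegGrade) :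
    koszul r σ g = (if g none = .one then passSignBy r g none * passSignBy σ g none else 1) *
      koszul (r ∘ some) (σ ∘ some) (g ∘ some) := by
  unfold koszul passSignBy
  simp only [Fintype.prod_option, lt_irrefl, false_and, if_false, one_mul]
  rw [Finset.prod_mul_distrib, ← mul_assoc, ← Finset.prod_mul_distrib]
  congr 1
  rcases h : g none with _ | _
  · rw [if_pos rfl, ← Finset.prod_mul_distrib]
    refine Finset.prod_congr rfl fun y _ => ?_
    rcases lt_or_gt_of_ne (hr.ne (Option.some_ne_none y)) with h1 | h1 <;>
    rcases lt_or_gt_of_ne (hσ.ne (Option.some_ne_none y)) with h2 | h2 <;>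
    simp only [h1, h2, h1.not_gt, h2.not_gt, and_self, and_true, and_false, if_true, if_false,
      mul_one, one_mul, LegGrade.deg]
    rw [← mul_pow]; norm_num
  · rw [if_neg (by simp)]
    refine Finset.prod_eq_one fun y _ => ?_
    rw [LegGrade.neg_one_pow_two_mul, mul_comm _ LegGrade.two.deg, LegGrade.neg_one_pow_two_mul]
    simp

/-- Removing the leg `k` from a reordering changes the sign by the signs of moving `k` to the front
in both orders, when `k` has odd grade. -/
theorem koszul_remove (r : X → A) (σ : X → B) (hr : Function.Injective r)
    (hσ : Function.Injective σ) (g : X → LegGrade) (k : X) (e : X ≃ Option Y) (he : e k = none) :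
    koszul r σ g = (if g k = .one then passSignBy r g k * passSignBy σ g k else 1) *
      koszul (fun y => r (e.symm (some y))) (fun y => σ (e.symm (some y)))
        (fun y => g (e.symm (some y))) := by
  have hk : e.symm none = k := by rw [Equiv.symm_apply_eq, he]
  rw [← koszul_comp e.symm, koszul_option _ _ (hr.comp e.symm.injective)
    (hσ.comp e.symm.injective), passSignBy_comp, passSignBy_comp]
  simp only [Function.comp_apply, hk]
  rfl

/-- How the sign of a reordering changes with the parity of the leg `k`; this makes odd derivations
commute with reordering. -/
theorem koszul_update [DecidableEq X] (r : X → A) (σ : X → B) (hr : Function.Injective r)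
    (hσ : Function.Injective σ) (g : X → LegGrade) (k : X) (a : LegGrade) (ha : a ≠ g k) :
    koszul r σ g * passSignBy σ g k =
      passSignBy r g k * koszul r σ (Function.update g k a) := by
  classical
  let e : X ≃ Option {j // j ≠ k} := (Equiv.optionSubtypeNe k).symm
  have he : e k = none := by simp [e]
  have hs : ∀ y, e.symm (some y) ≠ k := fun y => by simp [e, y.2]
  have hps : ∀ {D : Type} [LinearOrder D] (s : X → D),
      passSignBy s (Function.update g k a) k = passSignBy s g k := by
    intro D _ s
    unfold passSignBy
    refine Finset.prod_congr rfl fun x _ => ?_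
    by_cases hx : x = k
    · subst hx; simp
    · rw [Function.update_of_ne hx]
  rw [koszul_remove r σ hr hσ g k e he, koszul_remove r σ hr hσ (Function.update g k a) k e he,
    hps, hps]
  simp only [Function.update_self, Function.update_of_ne (hs _)]
  rcases h : g k with _ | _
  · have : a = .two := LegGrade.eq_two_of_ne_one (h ▸ ha)
    rw [if_pos rfl, this, if_neg (by simp)]
    linear_combination passSignBy r g k * koszul (fun y => r (e.symm (some y)))
      (fun y => σ (e.symm (some y))) (fun y => g (e.symm (some y))) * passSignBy_mul_self σ g k
  · have : a = .one := by
      rcases a.eq_one_or_two with h' | h'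
      · exact h'
      · exact absurd (h'.trans h.symm) ha
    rw [if_neg (by simp), this, if_pos rfl]
    linear_combination -passSignBy σ g k * koszul (fun y => r (e.symm (some y)))
      (fun y => σ (e.symm (some y))) (fun y => g (e.symm (some y))) * passSignBy_mul_self r g k

/-- In the commutative Weil complex, the order of the legs matters only up to the Koszul sign. -/
theorem Weil.mk_ordered (key : X → A) (key' : X → B) (hkey : Function.Injective key)
    (hkey' : Function.Injective key') (g : X → LegGrade) (x : JSpace X) :
    permRelations.mkQ (NCWeil.ordered key hkey g x) =
      koszul key key' g • permRelations.mkQ (NCWeil.ordered key' hkey' g x) := by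
  unfold NCWeil.ordered
  rw [Weil.mk_place (rankBy key hkey) (rankBy key' hkey')]
  congr 1
  exact koszul_congr (rankBy_lt _ _) (rankBy_lt _ _) g

/-- The two orders that start with `a, b` and with `b, a`, and otherwise agree, differ by a sign
when `a` and `b` have grade `1`. -/
theorem koszul_pairFirst [DecidableEq X] {a b : X} (hab : a ≠ b) (key : X → A)
    (g : X → LegGrade) (ha : g a = .one) (hb : g b = .one) :
    koszul (pairFirst a b key) (fun x => toLex ((ofLex (pairFirst a b key
      (Equiv.swap a b x))).1, key x) : X → ℕ ×ₗ A) g = -1 := by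
  have hba := hab.symm
  unfold koszul
  have h : ∀ x y, (pairFirst a b key x < pairFirst a b key y ∧
      (toLex ((ofLex (pairFirst a b key (Equiv.swap a b y))).1, key y) : ℕ ×ₗ A) <
        toLex ((ofLex (pairFirst a b key (Equiv.swap a b x))).1, key x)) ↔ x = a ∧ y = b := by
    intro x y
    simp only [pairFirst, Prod.Lex.lt_iff, ofLex_toLex, Equiv.swap_apply_def]
    constructor
    · rintro ⟨h1, h2⟩
      by_cases xa : x = a <;> by_cases xb : x = b <;> by_cases ya : y = a <;>
        by_cases yb : y = b <;> simp_all [lt_asymm]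
    · rintro ⟨rfl, rfl⟩
      simp [hab.symm]
  simp only [h]
  rw [Finset.prod_eq_single a, Finset.prod_eq_single b]
  · simp [ha, hb, LegGrade.deg]
  · intro y _ hy
    simp [hy]
  · simp
  · intro x _ hx
    exact Finset.prod_eq_one fun y _ => by simp [hx]
  · simp

/-- Exchanging two legs of grade `1` changes the sign in the commutative Weil complex. -/
theorem Weil.mk_ordered_swap [DecidableEq X] {a b : X} (hab : a ≠ b) (key : X → A)
    (hkey : Function.Injective key) (g : X → LegGrade) (ha : g a = .one) (hb : g b = .one)
    (x : JSpace X) :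
    permRelations.mkQ (NCWeil.ordered key hkey g (JSpace.relabel (Equiv.swap a b) x)) =
      -permRelations.mkQ (NCWeil.ordered key hkey g x) := by
  have hg : g ∘ Equiv.swap a b = g := by
    ext y
    simp only [Function.comp_apply, Equiv.swap_apply_def]
    split_ifs with h1 h2
    · rw [h1, ha, hb]
    · rw [h2, ha, hb]
    · rfl
  -- both sides are compared with an order in which `a` and `b` are adjacent
  set κ := pairFirst a b key with hκ
  have hκi : Function.Injective κ := pairFirst_injective a b hkey
  have hsi := (Equiv.swap a b).injective
  let μ : X → ℕ ×ₗ A := fun x => toLex ((ofLex (κ (Equiv.swap a b x))).1, key x)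
  have hμi : Function.Injective μ := fun _ _ h => hkey (congrArg (fun p => (ofLex p).2) h)
  rw [NCWeil.ordered_relabel, hg, Weil.mk_ordered (key ∘ Equiv.swap a b) (κ ∘ Equiv.swap a b)
    _ (hκi.comp hsi) g x, Weil.mk_ordered key κ _ hκi g x]
  have h1 : koszul (key ∘ Equiv.swap a b) (κ ∘ Equiv.swap a b) g = koszul key κ g := by
    conv_lhs => rw [← hg]
    exact koszul_comp _ _ _ _
  have h2 : NCWeil.ordered (κ ∘ Equiv.swap a b) (hκi.comp hsi) g = NCWeil.ordered μ hμi g := by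
    refine NCWeil.ordered_congr _ _ (fun y z => ?_) g
    simp only [κ, μ, Function.comp_apply, pairFirst, Prod.Lex.lt_iff, ofLex_toLex,
      Equiv.swap_apply_def]
    have hba := hab.symm
    by_cases ya : y = a <;> by_cases yb : y = b <;> by_cases za : z = a <;>
        by_cases zb : z = b <;> simp_all
  rw [h1, h2, Weil.mk_ordered κ μ hκi hμi, koszul_pairFirst hab key g ha hb]
  simp

end
/-! ### Partial symmetrization -/

section
variable {n : ℕ}

theorem Fin.succAbove_val_eq (p : Fin (n + 1)) (i : Fin n) :
    (p.succAbove i : ℕ) = if (i : ℕ) < p then (i : ℕ) else i + 1 := by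
  unfold Fin.succAbove
  simp only [Fin.lt_def, Fin.val_castSucc]
  split_ifs <;> simp

/-- The permutations of the positions that move only the first `m` of them. -/
def initialPerms (n m : ℕ) : Finset (Equiv.Perm (Fin n)) :=
  Finset.univ.filter fun π => ∀ i : Fin n, m ≤ i → π i = i

theorem mem_initialPerms {m : ℕ} {π : Equiv.Perm (Fin n)} :
    π ∈ initialPerms n m ↔ ∀ i : Fin n, m ≤ i → π i = i := by simp [initialPerms]

theorem initialPerms_zero : initialPerms n 0 = {1} := by
  ext π
  simp only [mem_initialPerms, Nat.zero_le, forall_true_left, Finset.mem_singleton]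
  exact ⟨fun h => Equiv.ext h, fun h => by simp [h]⟩

theorem initialPerms_self : initialPerms n n = Finset.univ := by
  ext π
  simp only [mem_initialPerms, Finset.mem_univ, iff_true]
  intro i hi
  omega

/-- The permutation that sends `j` to `p`, and acts by `σ` on the other positions. -/
def insertPerm (j p : Fin (n + 1)) (σ : Equiv.Perm (Fin n)) : Equiv.Perm (Fin (n + 1)) :=
  (finSuccEquiv' j).trans ((Equiv.optionCongr σ).trans (finSuccEquiv' p).symm)

@[simp] theorem insertPerm_self (j p : Fin (n + 1)) (σ : Equiv.Perm (Fin n)) :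
    insertPerm j p σ j = p := by simp [insertPerm]

@[simp] theorem insertPerm_succAbove (j p : Fin (n + 1)) (σ : Equiv.Perm (Fin n)) (i : Fin n) :
    insertPerm j p σ (j.succAbove i) = p.succAbove (σ i) := by simp [insertPerm]

theorem insertPerm_bijective (j : Fin (n + 1)) :
    Function.Bijective fun q : Fin (n + 1) × Equiv.Perm (Fin n) => insertPerm j q.1 q.2 := by
  rw [Fintype.bijective_iff_injective_and_card]
  constructor
  · rintro ⟨p, σ⟩ ⟨p', σ'⟩ h
    have h1 : p = p' := by simpa using DFunLike.congr_fun h j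
    subst h1
    have h2 : σ = σ' := by
      ext i : 1
      simpa using DFunLike.congr_fun h (j.succAbove i)
    rw [h2]
  · simp [Fintype.card_perm, Nat.factorial_succ]

/-- The number of the first `m` positions that remain when the position `j` is deleted. -/
def deletedSize (j m : ℕ) : ℕ := if j < m then m - 1 else m

theorem insertPerm_mem_initialPerms (j p : Fin (n + 1)) (σ : Equiv.Perm (Fin n)) (m : ℕ) :
    insertPerm j p σ ∈ initialPerms (n + 1) m ↔
      (if (j : ℕ) < m then (p : ℕ) < m else p = j) ∧ σ ∈ initialPerms n (deletedSize j m) := by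
  rw [mem_initialPerms, mem_initialPerms, deletedSize]
  by_cases hj : (j : ℕ) < m
  · simp only [if_pos hj]
    constructor
    · intro h
      have hp : (p : ℕ) < m := by
        by_contra hp
        have h1 := h p (not_lt.1 hp)
        have h2 := insertPerm_self j p σ
        have h3 := (insertPerm j p σ).injective (h1.trans h2.symm)
        rw [h3] at hp
        exact hp hj
      refine ⟨hp, fun i hi => ?_⟩
      have h1 : j.succAbove i = i.succ := Fin.ext (by
        rw [Fin.succAbove_val_eq, if_neg (by omega)]; rfl)
      have h2 : p.succAbove i = i.succ := Fin.ext (by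
        rw [Fin.succAbove_val_eq, if_neg (by omega)]; rfl)
      have h3 := h (j.succAbove i) (by rw [h1, Fin.val_succ]; omega)
      rw [insertPerm_succAbove, h1, ← h2] at h3
      exact Fin.succAbove_right_injective h3
    · rintro ⟨hp, hσ⟩ k hk
      obtain ⟨i, rfl⟩ := Fin.exists_succAbove_eq (x := k) (y := j) (by
        rintro rfl; exact absurd hj (by omega))
      rw [Fin.succAbove_val_eq] at hk
      have hi : m - 1 ≤ (i : ℕ) := by split_ifs at hk <;> omega
      rw [insertPerm_succAbove, hσ i hi]
      refine Fin.ext ?_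
      rw [Fin.succAbove_val_eq, Fin.succAbove_val_eq, if_neg (by omega), if_neg (by omega)]
  · simp only [if_neg hj]
    constructor
    · intro h
      have hp : p = j := by
        have := h j (by omega)
        rwa [insertPerm_self] at this
      subst hp
      refine ⟨rfl, fun i hi => ?_⟩
      have h3 := h (p.succAbove i) (by rw [Fin.succAbove_val_eq]; split_ifs <;> omega)
      rw [insertPerm_succAbove] at h3
      exact Fin.succAbove_right_injective h3
    · rintro ⟨rfl, hσ⟩ k hk
      by_cases hkp : k = p
      · rw [hkp, insertPerm_self]
      · obtain ⟨i, rfl⟩ := Fin.exists_succAbove_eq hkp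
        rw [Fin.succAbove_val_eq] at hk
        rw [insertPerm_succAbove, hσ i (by split_ifs at hk <;> omega)]

/-- If `F` does not depend on the image of `j`, then its average over the permutations of the first
`m` positions is an average over the permutations that remain when the position `j` is deleted. -/
theorem average_insertPerm {M : Type*} [AddCommGroup M] [Module ℚ M] (j : Fin (n + 1)) (m : ℕ)
    (F : Equiv.Perm (Fin (n + 1)) → M) (F' : Equiv.Perm (Fin n) → M)
    (hF : ∀ p σ, F (insertPerm j p σ) = F' σ) :
    ((initialPerms (n + 1) m).card : ℚ)⁻¹ • ∑ π ∈ initialPerms (n + 1) m, F π =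
      ((initialPerms n (deletedSize j m)).card : ℚ)⁻¹ •
        ∑ σ ∈ initialPerms n (deletedSize j m), F' σ := by
  classical
  -- the possible images of `j`
  set P : Finset (Fin (n + 1)) :=
    Finset.univ.filter fun p => if (j : ℕ) < m then (p : ℕ) < m else p = j with hP
  let I := Equiv.ofBijective _ (insertPerm_bijective j)
  have hmem : ∀ q, q ∈ P ×ˢ initialPerms n (deletedSize j m) ↔ I q ∈ initialPerms (n + 1) m := by
    rintro ⟨p, σ⟩
    rw [Finset.mem_product]
    refine Iff.trans ?_ (insertPerm_mem_initialPerms j p σ m).symm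
    simp [hP]
  have h1 : ∑ π ∈ initialPerms (n + 1) m, F π =
      (P.card : ℚ) • ∑ σ ∈ initialPerms n (deletedSize j m), F' σ := by
    rw [← Finset.sum_equiv I hmem (f := fun q => F' q.2) fun q _ => (hF q.1 q.2).symm,
      Finset.sum_product]
    simp only [Finset.sum_const, Nat.cast_smul_eq_nsmul]
  have h2 : (initialPerms (n + 1) m).card = P.card * (initialPerms n (deletedSize j m)).card := by
    rw [← Finset.card_product]
    exact (Finset.card_equiv I hmem).symm
  have hP0 : (P.card : ℚ) ≠ 0 := by
    rw [Nat.cast_ne_zero, Finset.card_ne_zero]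
    exact ⟨j, by simp [hP]⟩
  rw [h1, h2, smul_smul]
  congr 1
  push_cast
  field_simp

/-- The average, with signs, over all orders of the first `m` legs. -/
noncomputable def NCWeil.symInitial (m : ℕ) (g : Fin n → LegGrade) : JSpace (Fin n) →ₗ[ℚ] NCWeil :=
  ((initialPerms n m).card : ℚ)⁻¹ • ∑ π ∈ initialPerms n m,
    koszul (id : Fin n → Fin n) π g • NCWeil.ordered π π.injective g

/-- As `NCWeil.symInitial`, for diagrams with a leg `ι`. -/
noncomputable def NCWeilIota.symInitial (m : ℕ) (g : Fin n → LegGrade) :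
    JSpace (Option (Fin n)) →ₗ[ℚ] NCWeilIota :=
  ((initialPerms n m).card : ℚ)⁻¹ • ∑ π ∈ initialPerms n m,
    koszul (id : Fin n → Fin n) π g • NCWeilIota.ordered π π.injective g

theorem NCWeil.symInitial_zero (g : Fin n → LegGrade) :
    NCWeil.symInitial 0 g = NCWeil.ordered id Function.injective_id g := by
  unfold NCWeil.symInitial
  rw [initialPerms_zero]
  simp [koszul_self]

theorem NCWeil.symInitial_self (g : Fin n → LegGrade) (x : JSpace (Fin n)) :
    NCWeil.symInitial n g x = NCWeil.average (NCWeil.ordered id Function.injective_id g x) := by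
  rw [← NCWeil.lof_eq_ordered, NCWeil.average_lof]
  unfold NCWeil.symInitial
  rw [initialPerms_self, Finset.card_univ, Fintype.card_perm, Fintype.card_fin]
  simp only [LinearMap.smul_apply, LinearMap.sum_apply, NCWeil.place_eq_ordered]

/-- The differential commutes with partial symmetrization. -/
theorem NCWeil.d_symInitial (m : ℕ) (g : Fin n → LegGrade) (x : JSpace (Fin n)) :
    NCWeil.d (NCWeil.symInitial m g x) = ∑ j, if g j = .one then
      passSignBy id g j • NCWeil.symInitial m (Function.update g j .two) x else 0 := by
  unfold NCWeil.symInitial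
  simp only [LinearMap.smul_apply, LinearMap.sum_apply, map_smul, map_sum, NCWeil.d_ordered,
    Finset.smul_sum]
  rw [Finset.sum_comm]
  refine Finset.sum_congr rfl fun j _ => ?_
  split_ifs with h
  · refine Finset.sum_congr rfl fun π _ => ?_
    have := koszul_update id π Function.injective_id π.injective g j .two (by simp [h])
    simp only [smul_smul]
    congr 1
    linear_combination ((initialPerms n m).card : ℚ)⁻¹ * this
  · simp

/-- The map `ι` commutes with partial symmetrization, except that a symmetrization of `m` legs
becomes one of `m - 1` legs when one of these is turned into `ι`. -/
theorem NCWeil.iota_symInitial (m : ℕ) (g : Fin (n + 1) → LegGrade) (x : JSpace (Fin (n + 1))) :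
    NCWeil.iota (NCWeil.symInitial m g x) = ∑ j, passSignBy id g j • if g j = .one then
      NCWeilIota.symInitial (deletedSize j m) (g ∘ j.succAbove)
        (JSpace.relabel (finSuccEquiv' j) x)
      else NCWeilIota.symInitial m (Function.update g j .one) (JSpace.attach j x) := by
  unfold NCWeil.symInitial
  simp only [LinearMap.smul_apply, LinearMap.sum_apply, map_smul, map_sum, NCWeil.iota_ordered,
    Finset.smul_sum (r := koszul _ _ _)]
  rw [Finset.sum_comm, Finset.smul_sum]
  refine Finset.sum_congr rfl fun j _ => ?_
  split_ifs with h
  · have hk' : ∀ π : Equiv.Perm (Fin (n + 1)),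
        Function.Injective fun y => π ((finSuccEquiv' j).symm (some y)) := fun π =>
      (π.injective.comp (finSuccEquiv' j).symm.injective).comp (Option.some_injective _)
    rw [average_insertPerm j m _ fun σ => passSignBy id g j •
      koszul (id : Fin n → Fin n) σ (g ∘ j.succAbove) • NCWeilIota.ordered σ σ.injective
        (g ∘ j.succAbove) (JSpace.relabel (finSuccEquiv' j) x)]
    · unfold NCWeilIota.symInitial
      simp only [LinearMap.smul_apply, LinearMap.sum_apply, Finset.smul_sum]
      exact Finset.sum_congr rfl fun σ _ => smul_comm _ _ _
    · intro p σ
      have he : finSuccEquiv' j j = none := finSuccEquiv'_at j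
      rw [NCWeilIota.ordered_removed (insertPerm j p σ) g j
        (finSuccEquiv' j) he x ((insertPerm j p σ).injective.comp Subtype.val_injective) (hk' _),
        koszul_remove id (insertPerm j p σ) Function.injective_id (insertPerm j p σ).injective g j
        (finSuccEquiv' j) he, if_pos h]
      have h1 : (fun y => g ((finSuccEquiv' j).symm (some y))) = g ∘ j.succAbove := by
        ext y; simp
      have h2 : koszul (fun y => (id ((finSuccEquiv' j).symm (some y)) : Fin (n + 1)))
          (fun y => insertPerm j p σ ((finSuccEquiv' j).symm (some y))) (g ∘ j.succAbove) =
          koszul (id : Fin n → Fin n) σ (g ∘ j.succAbove) := by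
        refine koszul_congr (fun y z => ?_) (fun y z => ?_) _
        · simp [Fin.succAbove_lt_succAbove_iff]
        · simp [Fin.succAbove_lt_succAbove_iff]
      have h3 : NCWeilIota.ordered (fun y => insertPerm j p σ ((finSuccEquiv' j).symm (some y)))
          (hk' _) (g ∘ j.succAbove) = NCWeilIota.ordered σ σ.injective (g ∘ j.succAbove) := by
        refine NCWeilIota.ordered_congr _ _ (fun y z => ?_) _
        simp [Fin.succAbove_lt_succAbove_iff]
      rw [h1, h2, h3, smul_smul, smul_smul]
      congr 1
      linear_combination passSignBy id g j * koszul (id : Fin n → Fin n) σ (g ∘ j.succAbove) *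
        passSignBy_mul_self (insertPerm j p σ) g j
  · unfold NCWeilIota.symInitial
    simp only [LinearMap.smul_apply, LinearMap.sum_apply, Finset.smul_sum]
    refine Finset.sum_congr rfl fun π _ => ?_
    have := koszul_update id π Function.injective_id π.injective g j .one (Ne.symm h)
    simp only [smul_smul]
    congr 1
    linear_combination ((initialPerms (n + 1) m).card : ℚ)⁻¹ * this

end
/-! ### The homotopy from the identity to the symmetrization -/

section
variable {n : ℕ}

theorem LegGrade.neg_one_pow_mul_of_ne {a b : LegGrade} (h : a ≠ b) :
    (-1 : ℚ) ^ a.deg * (-1) ^ b.deg = -1 := by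
  cases a <;> cases b <;> simp [LegGrade.deg] at h ⊢

theorem LegGrade.neg_one_pow_mul_self (a : LegGrade) : (-1 : ℚ) ^ a.deg * (-1) ^ a.deg = 1 := by
  cases a <;> simp [LegGrade.deg]

/-- Changing the parity of the leg `k` changes the sign of passing it. -/
theorem passSignBy_update {X A : Type} [Fintype X] [DecidableEq X] [LinearOrder A] (key : X → A)
    (g : X → LegGrade) (k : X) (a : LegGrade) (ha : a ≠ g k) (j : X) :
    passSignBy key (Function.update g k a) j =
      (if key k < key j then -1 else 1) * passSignBy key g j := by
  unfold passSignBy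
  rw [← Finset.mul_prod_erase _ _ (Finset.mem_univ k),
    ← Finset.mul_prod_erase (s := Finset.univ) (f := fun x => if key x < key j then _ else _)
      (h := Finset.mem_univ k), ← mul_assoc]
  congr 1
  · split_ifs
    · rw [Function.update_self]
      have h1 := LegGrade.neg_one_pow_mul_of_ne ha
      have h2 := LegGrade.neg_one_pow_mul_self (g k)
      linear_combination (-1 : ℚ) ^ (g k).deg * h1 - (-1 : ℚ) ^ a.deg * h2
    · norm_num
  · refine Finset.prod_congr rfl fun x hx => ?_
    rw [Function.update_of_ne (Finset.ne_of_mem_erase hx)]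

theorem passSignBy_succAbove (g : Fin (n + 1) → LegGrade) (j : Fin (n + 1)) (k : Fin n) :
    passSignBy id g (j.succAbove k) = (if j < j.succAbove k then (-1) ^ (g j).deg else 1) *
      passSignBy id (g ∘ j.succAbove) k := by
  unfold passSignBy
  rw [Fin.prod_univ_succAbove _ j]
  congr 1
  refine Finset.prod_congr rfl fun i _ => ?_
  simp [Fin.succAbove_lt_succAbove_iff]

/-- The signs of two odd operators that change the parities of different legs anticommute. -/
theorem passSignBy_mul_update {X A : Type} [Fintype X] [DecidableEq X] [LinearOrder A]
    (key : X → A) (hkey : Function.Injective key) (g : X → LegGrade) {j k : X} (hjk : j ≠ k)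
    (a b : LegGrade) (ha : a ≠ g k) (hb : b ≠ g j) :
    passSignBy key g k * passSignBy key (Function.update g k a) j =
      -(passSignBy key g j * passSignBy key (Function.update g j b) k) := by
  rw [passSignBy_update key g k a ha, passSignBy_update key g j b hb]
  rcases lt_or_gt_of_ne (hkey.ne hjk) with h | h
  · rw [if_pos h, if_neg h.not_gt]; ring
  · rw [if_pos h, if_neg h.not_gt]; ring

theorem passSignBy_update_self {X A : Type} [Fintype X] [DecidableEq X] [LinearOrder A]
    (key : X → A) (g : X → LegGrade) (k : X) (a : LegGrade) :
    passSignBy key (Function.update g k a) k = passSignBy key g k := by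
  by_cases h : a = g k
  · rw [h, Function.update_eq_self]
  · rw [passSignBy_update key g k a h, if_neg (lt_irrefl _), one_mul]

/-- The difference of the symmetrizations of the first `k` and of the first `k + 1` legs. -/
noncomputable def NCWeil.symStep (k : ℕ) (g : Fin n → LegGrade) : JSpace (Fin n) →ₗ[ℚ] NCWeil :=
  NCWeil.symInitial k g - NCWeil.symInitial (k + 1) g

/-- As `NCWeil.symStep`, for diagrams with a leg `ι`. -/
noncomputable def NCWeilIota.symStep (k : ℕ) (g : Fin n → LegGrade) :
    JSpace (Option (Fin n)) →ₗ[ℚ] NCWeilIota :=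
  NCWeilIota.symInitial k g - NCWeilIota.symInitial (k + 1) g

/-- The homotopy `s`: the sum over legs of grade `2`, with the sign of an odd operator, of turning
the leg, in position `k`, into a leg of grade `1`, and then taking the difference of the
symmetrizations of the legs before `k`, without and with `k`. -/
noncomputable def NCWeil.homotopy : NCWeil →ₗ[ℚ] NCWeil :=
  DirectSum.toModule ℚ Word NCWeil fun w => ∑ k : Fin w.1, if w.2 k = .two then
    passSignBy id w.2 k • NCWeil.symStep k (Function.update w.2 k .one) else 0

/-- As `NCWeil.homotopy`, for diagrams with a leg `ι`. -/
noncomputable def NCWeilIota.homotopy : NCWeilIota →ₗ[ℚ] NCWeilIota :=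
  DirectSum.toModule ℚ Word NCWeilIota fun w => ∑ k : Fin w.1, if w.2 k = .two then
    passSignBy id w.2 k • NCWeilIota.symStep k (Function.update w.2 k .one) else 0

theorem NCWeil.homotopy_ordered (g : Fin n → LegGrade) (x : JSpace (Fin n)) :
    NCWeil.homotopy (NCWeil.ordered id Function.injective_id g x) = ∑ k, if g k = .two then
      passSignBy id g k • NCWeil.symStep k (Function.update g k .one) x else 0 := by
  rw [← NCWeil.lof_eq_ordered]
  unfold NCWeil.homotopy
  rw [DirectSum.toModule_lof, LinearMap.sum_apply]
  refine Finset.sum_congr rfl fun k _ => ?_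
  dsimp only
  split_ifs <;> rfl

theorem NCWeilIota.homotopy_ordered (g : Fin n → LegGrade) (x : JSpace (Option (Fin n))) :
    NCWeilIota.homotopy (NCWeilIota.ordered id Function.injective_id g x) =
      ∑ k, if g k = .two then
        passSignBy id g k • NCWeilIota.symStep k (Function.update g k .one) x else 0 := by
  rw [← NCWeilIota.lof_eq_ordered]
  unfold NCWeilIota.homotopy
  rw [DirectSum.toModule_lof, LinearMap.sum_apply]
  refine Finset.sum_congr rfl fun k _ => ?_
  dsimp only
  split_ifs <;> rfl

theorem NCWeil.d_symStep (m : ℕ) (g : Fin n → LegGrade) (x : JSpace (Fin n)) :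
    NCWeil.d (NCWeil.symStep m g x) = ∑ j, if g j = .one then
      passSignBy id g j • NCWeil.symStep m (Function.update g j .two) x else 0 := by
  unfold NCWeil.symStep
  rw [LinearMap.sub_apply, map_sub, NCWeil.d_symInitial, NCWeil.d_symInitial,
    ← Finset.sum_sub_distrib]
  refine Finset.sum_congr rfl fun j _ => ?_
  split_ifs
  · rw [LinearMap.sub_apply, smul_sub]
  · rw [sub_zero]

/-- The homotopy joins the identity to the symmetrization. In `d s + s d`, the terms in which `d`
and `s` act on different legs cancel, and those in which they act on the same leg `k` give the
difference of the symmetrizations of `k` and of `k + 1` legs, so the sum telescopes. -/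
theorem NCWeil.d_homotopy_add_homotopy_d (z : NCWeil) :
    NCWeil.d (NCWeil.homotopy z) + NCWeil.homotopy (NCWeil.d z) = z - NCWeil.average z := by
  refine LinearMap.congr_fun (f := NCWeil.d ∘ₗ NCWeil.homotopy + NCWeil.homotopy ∘ₗ NCWeil.d)
    (g := LinearMap.id - NCWeil.average) (NCWeil.hom_ext fun n g x => ?_) z
  simp only [LinearMap.add_apply, LinearMap.comp_apply, LinearMap.sub_apply, LinearMap.id_apply]
  have htel : ∑ k : Fin n, NCWeil.symStep k g x =
      NCWeil.ordered id Function.injective_id g x -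
        NCWeil.average (NCWeil.ordered id Function.injective_id g x) := by
    rw [← NCWeil.symInitial_self, ← NCWeil.symInitial_zero,
      Fin.sum_univ_eq_sum_range (fun k => NCWeil.symStep k g x) n]
    exact Finset.sum_range_sub' (fun k => NCWeil.symInitial k g x) n
  have h1 : NCWeil.d (NCWeil.homotopy (NCWeil.ordered id Function.injective_id g x)) =
      ∑ k, ∑ j, if g k = .two ∧ Function.update g k .one j = .one then
        (passSignBy id g k * passSignBy id (Function.update g k .one) j) •
          NCWeil.symStep k (Function.update (Function.update g k .one) j .two) x else 0 := by
    rw [NCWeil.homotopy_ordered, map_sum]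
    refine Finset.sum_congr rfl fun k _ => ?_
    by_cases hk : g k = .two
    · rw [if_pos hk, map_smul, NCWeil.d_symStep, Finset.smul_sum]
      refine Finset.sum_congr rfl fun j _ => ?_
      simp only [hk, true_and]
      split_ifs
      · rw [smul_smul]
      · rw [smul_zero]
    · simp [hk]
  have h2 : NCWeil.homotopy (NCWeil.d (NCWeil.ordered id Function.injective_id g x)) =
      ∑ k, ∑ j, if g j = .one ∧ Function.update g j .two k = .two then
        (passSignBy id g j * passSignBy id (Function.update g j .two) k) •
          NCWeil.symStep k (Function.update (Function.update g j .two) k .one) x else 0 := by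
    rw [NCWeil.d_ordered, map_sum, Finset.sum_comm]
    refine Finset.sum_congr rfl fun j _ => ?_
    by_cases hj : g j = .one
    · rw [if_pos hj, map_smul, NCWeil.homotopy_ordered, Finset.smul_sum]
      refine Finset.sum_congr rfl fun k _ => ?_
      simp only [hj, true_and]
      split_ifs
      · rw [smul_smul]
      · rw [smul_zero]
    · simp [hj]
  rw [h1, h2, ← htel, ← Finset.sum_add_distrib]
  refine Finset.sum_congr rfl fun k _ => ?_
  rw [← Finset.sum_add_distrib, Finset.sum_eq_single k]
  · rw [passSignBy_update_self, passSignBy_update_self, passSignBy_mul_self, Function.update_idem,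
      Function.update_idem]
    rcases (g k).eq_one_or_two with h | h
    · have : Function.update g k .one = g := by rw [← h, Function.update_eq_self]
      simp [h, this]
    · have : Function.update g k .two = g := by rw [← h, Function.update_eq_self]
      simp [h, this]
  · intro j _ hj
    rw [Function.update_of_ne hj, Function.update_of_ne hj.symm, Function.update_comm hj.symm]
    by_cases h : g k = .two ∧ g j = .one
    · rw [if_pos h, if_pos h.symm, passSignBy_mul_update id Function.injective_id g hj .one .two
        (by simp [h.1]) (by simp [h.2]), neg_smul, neg_add_cancel]
    · rw [if_neg h, if_neg fun h' => h h'.symm, add_zero]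
  · simp

theorem NCWeil.iota_symStep (m : ℕ) (g : Fin (n + 1) → LegGrade) (x : JSpace (Fin (n + 1))) :
    NCWeil.iota (NCWeil.symStep m g x) = ∑ j, passSignBy id g j • if g j = .one then
      (NCWeilIota.symInitial (deletedSize j m) (g ∘ j.succAbove) -
        NCWeilIota.symInitial (deletedSize j (m + 1)) (g ∘ j.succAbove))
          (JSpace.relabel (finSuccEquiv' j) x)
      else NCWeilIota.symStep m (Function.update g j .one) (JSpace.attach j x) := by
  unfold NCWeil.symStep NCWeilIota.symStep
  rw [LinearMap.sub_apply, map_sub, NCWeil.iota_symInitial, NCWeil.iota_symInitial,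
    ← Finset.sum_sub_distrib]
  refine Finset.sum_congr rfl fun j _ => ?_
  rw [← smul_sub]
  split_ifs <;> rfl

theorem NCWeil.iota_ordered_id (g : Fin (n + 1) → LegGrade) (x : JSpace (Fin (n + 1))) :
    NCWeil.iota (NCWeil.ordered id Function.injective_id g x) =
      ∑ j, passSignBy id g j • if g j = .one then
        NCWeilIota.ordered id Function.injective_id (g ∘ j.succAbove)
          (JSpace.relabel (finSuccEquiv' j) x)
      else NCWeilIota.ordered id Function.injective_id (Function.update g j .one)
        (JSpace.attach j x) := by
  rw [NCWeil.iota_ordered]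
  refine Finset.sum_congr rfl fun j _ => ?_
  congr 1
  split_ifs with h
  · have hk' : Function.Injective fun y => id ((finSuccEquiv' j).symm (some y)) :=
      (finSuccEquiv' j).symm.injective.comp (Option.some_injective _)
    refine (NCWeilIota.ordered_removed (id : Fin (n + 1) → Fin (n + 1)) g j
      (finSuccEquiv' j) (finSuccEquiv'_at j) x Subtype.val_injective hk').trans ?_
    have h1 : (fun y => g ((finSuccEquiv' j).symm (some y))) = g ∘ j.succAbove := by
      ext y; simp
    rw [h1]
    refine LinearMap.congr_fun (NCWeilIota.ordered_congr _ _ (fun y z => ?_) _) _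
    simp [Fin.succAbove_lt_succAbove_iff]
  · rfl

/-- The homotopy anticommutes with `ι`. When `ι` acts on the leg `k` that the homotopy has just
changed, the two partial symmetrizations become equal, and their difference vanishes. -/
theorem NCWeil.iota_homotopy (z : NCWeil) :
    NCWeil.iota (NCWeil.homotopy z) = -NCWeilIota.homotopy (NCWeil.iota z) := by
  refine LinearMap.congr_fun (f := NCWeil.iota ∘ₗ NCWeil.homotopy)
    (g := -(NCWeilIota.homotopy ∘ₗ NCWeil.iota)) (NCWeil.hom_ext fun n g x => ?_) z
  simp only [LinearMap.neg_apply, LinearMap.comp_apply]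
  rcases n with _ | n
  · rw [NCWeil.homotopy_ordered, NCWeil.iota_ordered]
    simp
  rw [NCWeil.iota_ordered_id, NCWeil.homotopy_ordered, map_sum, map_sum, ← Finset.sum_neg_distrib]
  have h1 : ∀ k, NCWeil.iota (if g k = .two then
      passSignBy id g k • NCWeil.symStep k (Function.update g k .one) x else 0) =
      ∑ j, if g k = .two then (passSignBy id g k * passSignBy id (Function.update g k .one) j) •
        (if Function.update g k .one j = .one then
          (NCWeilIota.symInitial (deletedSize j k) (Function.update g k .one ∘ j.succAbove) -
            NCWeilIota.symInitial (deletedSize j (k + 1)) (Function.update g k .one ∘ j.succAbove))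
            (JSpace.relabel (finSuccEquiv' j) x)
          else NCWeilIota.symStep k (Function.update (Function.update g k .one) j .one)
            (JSpace.attach j x)) else 0 := by
    intro k
    by_cases hk : g k = .two
    · simp only [if_pos hk]
      rw [map_smul, NCWeil.iota_symStep, Finset.smul_sum]
      exact Finset.sum_congr rfl fun j _ => smul_smul _ _ _
    · simp [hk]
  simp only [h1]
  rw [Finset.sum_comm]
  refine Finset.sum_congr rfl fun j _ => ?_
  rw [map_smul]
  rcases (g j).eq_one_or_two with hj | hj
  · -- the leg `j` becomes `ι`
    rw [if_pos hj, NCWeilIota.homotopy_ordered, Fin.sum_univ_succAbove _ j, if_neg (by simp [hj]),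
      zero_add, Finset.smul_sum, ← Finset.sum_neg_distrib]
    refine Finset.sum_congr rfl fun k _ => ?_
    by_cases hk : g (j.succAbove k) = .two
    · have e1 : deletedSize j (j.succAbove k) = k := by
        rw [deletedSize, Fin.succAbove_val_eq]; split_ifs <;> omega
      have e2 : deletedSize j (j.succAbove k + 1) = k + 1 := by
        rw [deletedSize, Fin.succAbove_val_eq]; split_ifs <;> omega
      have e3 : Function.update g (j.succAbove k) .one ∘ j.succAbove =
          Function.update (g ∘ j.succAbove) k .one :=
        Function.update_comp_eq_of_injective _ Fin.succAbove_right_injective _ _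
      rw [if_pos hk, if_pos (show (g ∘ j.succAbove) k = .two from hk),
        Function.update_of_ne (Fin.succAbove_ne j k).symm, if_pos hj, e1, e2, e3, smul_smul,
        ← neg_smul]
      unfold NCWeilIota.symStep
      congr 1
      rw [passSignBy_succAbove, passSignBy_update id g _ .one (by simp [hk]), hj]
      simp only [id]
      rcases lt_or_gt_of_ne (Fin.succAbove_ne j k) with h | h
      · rw [if_pos h, if_neg h.not_gt]; ring
      · rw [if_pos h, if_neg h.not_gt]; simp [LegGrade.deg]; ring
    · rw [if_neg hk, if_neg (show ¬(g ∘ j.succAbove) k = .two from hk), smul_zero, neg_zero]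
  · -- the leg `ι` is attached to the leg `j`
    rw [if_neg (by simp [hj]), NCWeilIota.homotopy_ordered, Finset.smul_sum,
      ← Finset.sum_neg_distrib]
    refine Finset.sum_congr rfl fun k _ => ?_
    by_cases hjk : j = k
    · subst hjk
      -- both symmetrizations become the one of the legs before `j`
      have e1 : deletedSize j j = j := by simp [deletedSize]
      have e2 : deletedSize j (j + 1) = j := by simp [deletedSize]
      simp [e1, e2]
    · by_cases hk : g k = .two
      · rw [if_pos hk, Function.update_of_ne hjk, if_neg (by simp [hj]),
          Function.update_of_ne (Ne.symm hjk), if_pos hk, smul_smul, ← neg_smul,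
          Function.update_comm (Ne.symm hjk), passSignBy_mul_update id Function.injective_id g hjk
          .one .one (by simp [hk]) (by simp [hj])]
      · rw [if_neg hk, Function.update_of_ne (Ne.symm hjk), if_neg hk, smul_zero, neg_zero]

end
/-! ### The symmetrization as a map of complexes -/

section

theorem Weil.chi_mkQ (z : NCWeil) : Weil.chi (permRelations.mkQ z) = NCWeil.average z := by
  unfold Weil.chi
  rw [Submodule.mkQ_apply, Submodule.liftQ_apply]

theorem NCWeil.d_average (z : NCWeil) :
    NCWeil.d (NCWeil.average z) = NCWeil.average (NCWeil.d z) := by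
  refine LinearMap.congr_fun (f := NCWeil.d ∘ₗ NCWeil.average) (g := NCWeil.average ∘ₗ NCWeil.d)
    (NCWeil.hom_ext fun n g x => ?_) z
  simp only [LinearMap.comp_apply]
  rw [← NCWeil.symInitial_self, NCWeil.d_symInitial, NCWeil.d_ordered, map_sum]
  refine Finset.sum_congr rfl fun j _ => ?_
  split_ifs
  · rw [map_smul, NCWeil.symInitial_self]
  · rw [map_zero]

/-- The average, with signs, over all orders of the legs other than `ι`. -/
noncomputable def NCWeilIota.average : NCWeilIota →ₗ[ℚ] NCWeilIota :=
  DirectSum.toModule ℚ Word NCWeilIota fun w => NCWeilIota.symInitial w.1 w.2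

theorem NCWeilIota.average_ordered {n : ℕ} (g : Fin n → LegGrade) (x : JSpace (Option (Fin n))) :
    NCWeilIota.average (NCWeilIota.ordered id Function.injective_id g x) =
      NCWeilIota.symInitial n g x := by
  rw [← NCWeilIota.lof_eq_ordered]
  unfold NCWeilIota.average
  rw [DirectSum.toModule_lof]

theorem NCWeil.iota_average (z : NCWeil) :
    NCWeil.iota (NCWeil.average z) = NCWeilIota.average (NCWeil.iota z) := by
  refine LinearMap.congr_fun (f := NCWeil.iota ∘ₗ NCWeil.average)
    (g := NCWeilIota.average ∘ₗ NCWeil.iota) (NCWeil.hom_ext fun n g x => ?_) z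
  simp only [LinearMap.comp_apply]
  rw [← NCWeil.symInitial_self]
  rcases n with _ | n
  · rw [NCWeil.symInitial_zero, NCWeil.iota_ordered]
    simp
  · rw [NCWeil.iota_symInitial, NCWeil.iota_ordered_id, map_sum]
    refine Finset.sum_congr rfl fun j _ => ?_
    rw [map_smul]
    congr 1
    split_ifs
    · rw [NCWeilIota.average_ordered, deletedSize, if_pos j.2, Nat.add_sub_cancel]
    · rw [NCWeilIota.average_ordered]

end

/-! ### The product -/

section
variable {X Y A A' B B' : Type}

/-- The order that puts the legs in `X` before those in `Y`. -/
def sumKey (k : X → A) (k' : Y → B) (z : X ⊕ Y) : A ⊕ₗ B := toLex (Sum.map k k' z)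

theorem sumKey_injective {k : X → A} {k' : Y → B} (hk : Function.Injective k)
    (hk' : Function.Injective k') : Function.Injective (sumKey k k') := fun _ _ h =>
  Sum.map_injective.2 ⟨hk, hk'⟩ (toLex.injective h)

variable [LinearOrder A] [LinearOrder A'] [LinearOrder B] [LinearOrder B']

@[simp] theorem sumKey_inl_lt_inl (k : X → A) (k' : Y → B) (x y : X) :
    sumKey k k' (.inl x) < sumKey k k' (.inl y) ↔ k x < k y := Sum.Lex.inl_lt_inl_iff

@[simp] theorem sumKey_inr_lt_inr (k : X → A) (k' : Y → B) (x y : Y) :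
    sumKey k k' (.inr x) < sumKey k k' (.inr y) ↔ k' x < k' y := Sum.Lex.inr_lt_inr_iff

@[simp] theorem sumKey_inl_lt_inr (k : X → A) (k' : Y → B) (x : X) (y : Y) :
    sumKey k k' (.inl x) < sumKey k k' (.inr y) := Sum.Lex.inl_lt_inr _ _

@[simp] theorem not_sumKey_inr_lt_inl (k : X → A) (k' : Y → B) (x : X) (y : Y) :
    ¬sumKey k k' (.inr y) < sumKey k k' (.inl x) := Sum.Lex.not_inr_lt_inl

theorem sumKey_lt_congr {X' Y' : Type} {k : X → A} {k' : Y → B} {l : X' → A'} {l' : Y' → B'}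
    (f : X → X') (f' : Y → Y') (h : ∀ x y, k x < k y ↔ l (f x) < l (f y))
    (h' : ∀ x y, k' x < k' y ↔ l' (f' x) < l' (f' y)) (x y : X ⊕ Y) :
    sumKey k k' x < sumKey k k' y ↔
      sumKey l l' (Sum.map f f' x) < sumKey l l' (Sum.map f f' y) := by
  rcases x with x | x <;> rcases y with y | y
  · exact (sumKey_inl_lt_inl k k' x y).trans
      ((h x y).trans (sumKey_inl_lt_inl l l' (f x) (f y)).symm)
  · exact iff_of_true (sumKey_inl_lt_inr k k' x y) (sumKey_inl_lt_inr l l' (f x) (f' y))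
  · exact iff_of_false (not_sumKey_inr_lt_inl k k' y x) (not_sumKey_inr_lt_inl l l' (f y) (f' x))
  · exact (sumKey_inr_lt_inr k k' x y).trans
      ((h' x y).trans (sumKey_inr_lt_inr l l' (f' x) (f' y)).symm)

theorem finSumFinEquiv_lt {m n : ℕ} (x y : Fin m ⊕ Fin n) :
    finSumFinEquiv x < finSumFinEquiv y ↔
      sumKey (id : Fin m → Fin m) (id : Fin n → Fin n) x < sumKey id id y := by
  rcases x with x | x <;> rcases y with y | y
  · rw [sumKey_inl_lt_inl]
    rfl
  · refine iff_of_true ?_ (sumKey_inl_lt_inr _ _ x y)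
    rw [finSumFinEquiv_apply_left, finSumFinEquiv_apply_right, Fin.lt_def, Fin.val_castAdd,
      Fin.val_natAdd]
    omega
  · refine iff_of_false ?_ (not_sumKey_inr_lt_inl _ _ y x)
    rw [finSumFinEquiv_apply_left, finSumFinEquiv_apply_right, Fin.lt_def, Fin.val_castAdd,
      Fin.val_natAdd]
    omega
  · rw [sumKey_inr_lt_inr, finSumFinEquiv_apply_right, finSumFinEquiv_apply_right, Fin.lt_def,
      Fin.val_natAdd, Fin.val_natAdd, Nat.add_lt_add_iff_left]
    rfl

variable [Fintype X] [Fintype Y]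

theorem NCWeil.juxtapose_ordered (k : X → A) (hk : Function.Injective k) (g : X → LegGrade)
    (x : JSpace X) (k' : Y → B) (hk' : Function.Injective k') (g' : Y → LegGrade) (y : JSpace Y) :
    NCWeil.juxtapose (NCWeil.ordered k hk g x) (NCWeil.ordered k' hk' g' y) =
      NCWeil.ordered (sumKey k k') (sumKey_injective hk hk') (Sum.elim g g')
        (JSpace.union x y) := by
  have h1 : NCWeil.ordered k hk g x = DirectSum.lof ℚ Word (fun w => JSpace (Fin w.1))
    ⟨_, g ∘ (rankBy k hk).symm⟩ (JSpace.relabel (rankBy k hk) x) := rfl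
  have h2 : NCWeil.ordered k' hk' g' y = DirectSum.lof ℚ Word (fun w => JSpace (Fin w.1))
    ⟨_, g' ∘ (rankBy k' hk').symm⟩ (JSpace.relabel (rankBy k' hk') y) := rfl
  rw [h1, h2]
  unfold NCWeil.juxtapose
  rw [DirectSum.toModule_lof, LinearMap.flip_apply, DirectSum.toModule_lof, LinearMap.flip_apply,
    LinearMap.compr₂_apply, JSpace.union_relabel, NCWeil.place_relabel, NCWeil.place_eq_ordered]
  have h3 : Sum.elim (g ∘ (rankBy k hk).symm) (g' ∘ (rankBy k' hk').symm) ∘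
      Equiv.sumCongr (rankBy k hk) (rankBy k' hk') = Sum.elim g g' := by
    ext z; rcases z with z | z <;> simp
  rw [h3]
  refine LinearMap.congr_fun (NCWeil.ordered_congr _ _ (fun z w => ?_) _) _
  rw [Equiv.trans_apply, Equiv.trans_apply, finSumFinEquiv_lt]
  exact (sumKey_lt_congr (rankBy k hk) (rankBy k' hk') (fun x y => (rankBy_lt k hk x y).symm)
    (fun x y => (rankBy_lt k' hk' x y).symm) z w).symm

/-- The legs of a disjoint union, when there is a leg `ι` in the left part. -/
def optionSumLeft (X Y : Type) : Option X ⊕ Y ≃ Option (X ⊕ Y) where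
  toFun := Sum.elim (Option.map .inl) fun y => some (.inr y)
  invFun := Option.elim' (.inl none) (Sum.map some id)
  left_inv := by rintro ((_ | x) | y) <;> rfl
  right_inv := by rintro (_ | x | y) <;> rfl

/-- The legs of a disjoint union, when there is a leg `ι` in the right part. -/
def optionSumRight (X Y : Type) : X ⊕ Option Y ≃ Option (X ⊕ Y) where
  toFun := Sum.elim (fun x => some (.inl x)) (Option.map .inr)
  invFun := Option.elim' (.inr none) (Sum.map id some)
  left_inv := by rintro (x | _ | y) <;> rfl
  right_inv := by rintro (_ | x | y) <;> rfl

/-- The product of a diagram with a leg `ι` and a diagram without. -/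
noncomputable def NCWeilIota.juxtaposeLeft : NCWeilIota →ₗ[ℚ] NCWeil →ₗ[ℚ] NCWeilIota :=
  DirectSum.toModule ℚ Word (NCWeil →ₗ[ℚ] NCWeilIota) fun w =>
    (DirectSum.toModule ℚ Word (JSpace (Option (Fin w.1)) →ₗ[ℚ] NCWeilIota) fun w' =>
      (JSpace.union.compr₂ (NCWeilIota.place finSumFinEquiv (Sum.elim w.2 w'.2) ∘ₗ
        JSpace.relabel (optionSumLeft _ _))).flip).flip

/-- The product of a diagram without a leg `ι` and a diagram with such a leg. -/
noncomputable def NCWeilIota.juxtaposeRight : NCWeil →ₗ[ℚ] NCWeilIota →ₗ[ℚ] NCWeilIota :=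
  DirectSum.toModule ℚ Word (NCWeilIota →ₗ[ℚ] NCWeilIota) fun w =>
    (DirectSum.toModule ℚ Word (JSpace (Fin w.1) →ₗ[ℚ] NCWeilIota) fun w' =>
      (JSpace.union.compr₂ (NCWeilIota.place finSumFinEquiv (Sum.elim w.2 w'.2) ∘ₗ
        JSpace.relabel (optionSumRight _ _))).flip).flip

theorem NCWeilIota.juxtaposeLeft_ordered (k : X → A) (hk : Function.Injective k)
    (g : X → LegGrade) (x : JSpace (Option X)) (k' : Y → B) (hk' : Function.Injective k')
    (g' : Y → LegGrade) (y : JSpace Y) :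
    NCWeilIota.juxtaposeLeft (NCWeilIota.ordered k hk g x) (NCWeil.ordered k' hk' g' y) =
      NCWeilIota.ordered (sumKey k k') (sumKey_injective hk hk') (Sum.elim g g')
        (JSpace.relabel (optionSumLeft X Y) (JSpace.union x y)) := by
  have h1 : NCWeilIota.ordered k hk g x = DirectSum.lof ℚ Word
    (fun w => JSpace (Option (Fin w.1))) ⟨_, g ∘ (rankBy k hk).symm⟩
      (JSpace.relabel (Equiv.optionCongr (rankBy k hk)) x) := rfl
  have h2 : NCWeil.ordered k' hk' g' y = DirectSum.lof ℚ Word (fun w => JSpace (Fin w.1))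
    ⟨_, g' ∘ (rankBy k' hk').symm⟩ (JSpace.relabel (rankBy k' hk') y) := rfl
  rw [h1, h2]
  unfold NCWeilIota.juxtaposeLeft
  rw [DirectSum.toModule_lof, LinearMap.flip_apply, DirectSum.toModule_lof, LinearMap.flip_apply,
    LinearMap.compr₂_apply, JSpace.union_relabel, LinearMap.comp_apply]
  have h4 : JSpace.relabel (optionSumLeft _ _) (JSpace.relabel (Equiv.sumCongr
      (Equiv.optionCongr (rankBy k hk)) (rankBy k' hk')) (JSpace.union x y)) =
      JSpace.relabel (Equiv.optionCongr (Equiv.sumCongr (rankBy k hk) (rankBy k' hk')))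
        (JSpace.relabel (optionSumLeft X Y) (JSpace.union x y)) := by
    rw [JSpace.relabel_relabel, JSpace.relabel_relabel]
    congr 2
    ext z : 1
    rcases z with (_ | z) | z <;> rfl
  rw [h4, NCWeilIota.place_relabel, NCWeilIota.place_eq_ordered]
  have h3 : Sum.elim (g ∘ (rankBy k hk).symm) (g' ∘ (rankBy k' hk').symm) ∘
      Equiv.sumCongr (rankBy k hk) (rankBy k' hk') = Sum.elim g g' := by
    ext z; rcases z with z | z <;> simp
  rw [h3]
  refine LinearMap.congr_fun (NCWeilIota.ordered_congr _ _ (fun z w => ?_) _) _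
  rw [Equiv.trans_apply, Equiv.trans_apply, finSumFinEquiv_lt]
  exact (sumKey_lt_congr (rankBy k hk) (rankBy k' hk') (fun x y => (rankBy_lt k hk x y).symm)
    (fun x y => (rankBy_lt k' hk' x y).symm) z w).symm

theorem NCWeilIota.juxtaposeRight_ordered (k : X → A) (hk : Function.Injective k)
    (g : X → LegGrade) (x : JSpace X) (k' : Y → B) (hk' : Function.Injective k')
    (g' : Y → LegGrade) (y : JSpace (Option Y)) :
    NCWeilIota.juxtaposeRight (NCWeil.ordered k hk g x) (NCWeilIota.ordered k' hk' g' y) =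
      NCWeilIota.ordered (sumKey k k') (sumKey_injective hk hk') (Sum.elim g g')
        (JSpace.relabel (optionSumRight X Y) (JSpace.union x y)) := by
  have h1 : NCWeil.ordered k hk g x = DirectSum.lof ℚ Word (fun w => JSpace (Fin w.1))
    ⟨_, g ∘ (rankBy k hk).symm⟩ (JSpace.relabel (rankBy k hk) x) := rfl
  have h2 : NCWeilIota.ordered k' hk' g' y = DirectSum.lof ℚ Word
    (fun w => JSpace (Option (Fin w.1))) ⟨_, g' ∘ (rankBy k' hk').symm⟩
      (JSpace.relabel (Equiv.optionCongr (rankBy k' hk')) y) := rfl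
  rw [h1, h2]
  unfold NCWeilIota.juxtaposeRight
  rw [DirectSum.toModule_lof, LinearMap.flip_apply, DirectSum.toModule_lof, LinearMap.flip_apply,
    LinearMap.compr₂_apply, JSpace.union_relabel, LinearMap.comp_apply]
  have h4 : JSpace.relabel (optionSumRight _ _) (JSpace.relabel (Equiv.sumCongr
      (rankBy k hk) (Equiv.optionCongr (rankBy k' hk'))) (JSpace.union x y)) =
      JSpace.relabel (Equiv.optionCongr (Equiv.sumCongr (rankBy k hk) (rankBy k' hk')))
        (JSpace.relabel (optionSumRight X Y) (JSpace.union x y)) := by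
    rw [JSpace.relabel_relabel, JSpace.relabel_relabel]
    congr 2
    ext z : 1
    rcases z with z | _ | z <;> rfl
  rw [h4, NCWeilIota.place_relabel, NCWeilIota.place_eq_ordered]
  have h3 : Sum.elim (g ∘ (rankBy k hk).symm) (g' ∘ (rankBy k' hk').symm) ∘
      Equiv.sumCongr (rankBy k hk) (rankBy k' hk') = Sum.elim g g' := by
    ext z; rcases z with z | z <;> simp
  rw [h3]
  refine LinearMap.congr_fun (NCWeilIota.ordered_congr _ _ (fun z w => ?_) _) _
  rw [Equiv.trans_apply, Equiv.trans_apply, finSumFinEquiv_lt]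
  exact (sumKey_lt_congr (rankBy k hk) (rankBy k' hk') (fun x y => (rankBy_lt k hk x y).symm)
    (fun x y => (rankBy_lt k' hk' x y).symm) z w).symm

/-- The sign `(-1) ^ (grade)`, as an operator. -/
noncomputable def NCWeil.parity : NCWeil →ₗ[ℚ] NCWeil :=
  DirectSum.toModule ℚ Word NCWeil fun w =>
    ((-1 : ℚ) ^ w.degree) • DirectSum.lof ℚ Word (fun w => JSpace (Fin w.1)) w

theorem NCWeil.parity_ordered {n : ℕ} (g : Fin n → LegGrade) (x : JSpace (Fin n)) :
    NCWeil.parity (NCWeil.ordered id Function.injective_id g x) =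
      (∏ i, (-1 : ℚ) ^ (g i).deg) • NCWeil.ordered id Function.injective_id g x := by
  rw [← NCWeil.lof_eq_ordered]
  unfold NCWeil.parity
  rw [DirectSum.toModule_lof, Finset.prod_pow_eq_pow_sum]
  rfl

theorem passSignBy_sumKey_inl (k : X → A) (k' : Y → B) (g : X → LegGrade) (g' : Y → LegGrade)
    (x : X) : passSignBy (sumKey k k') (Sum.elim g g') (.inl x) = passSignBy k g x := by
  simp [passSignBy]

theorem passSignBy_sumKey_inr (k : X → A) (k' : Y → B) (g : X → LegGrade) (g' : Y → LegGrade)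
    (y : Y) : passSignBy (sumKey k k') (Sum.elim g g') (.inr y) =
      (∏ x, (-1 : ℚ) ^ (g x).deg) * passSignBy k' g' y := by
  simp [passSignBy]

/-- The differential is an odd derivation of the product. -/
theorem NCWeil.d_juxtapose (a b : NCWeil) : NCWeil.d (NCWeil.juxtapose a b) =
    NCWeil.juxtapose (NCWeil.d a) b + NCWeil.juxtapose (NCWeil.parity a) (NCWeil.d b) := by
  have : NCWeil.juxtapose.compr₂ NCWeil.d = NCWeil.juxtapose ∘ₗ NCWeil.d +
      NCWeil.juxtapose.compl₁₂ NCWeil.parity NCWeil.d := by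
    refine NCWeil.hom_ext fun m g x => NCWeil.hom_ext fun n g' y => ?_
    simp only [LinearMap.compr₂_apply, LinearMap.add_apply, LinearMap.comp_apply,
      LinearMap.compl₁₂_apply]
    rw [NCWeil.juxtapose_ordered, NCWeil.d_ordered, NCWeil.d_ordered, NCWeil.d_ordered,
      NCWeil.parity_ordered, Fintype.sum_sum_type, map_sum, LinearMap.sum_apply, map_sum]
    congr 1
    · refine Finset.sum_congr rfl fun k _ => ?_
      rw [Sum.elim_inl, passSignBy_sumKey_inl]
      split_ifs
      · rw [map_smul, LinearMap.smul_apply, NCWeil.juxtapose_ordered, Sum.update_elim_inl]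
      · rw [map_zero, LinearMap.zero_apply]
    · refine Finset.sum_congr rfl fun k _ => ?_
      rw [Sum.elim_inr, passSignBy_sumKey_inr]
      split_ifs
      · rw [map_smul, map_smul, LinearMap.smul_apply, NCWeil.juxtapose_ordered,
          Sum.update_elim_inr, smul_smul, mul_comm]
      · rw [map_zero]
  exact LinearMap.congr_fun₂ this a b

/-- The map `ι` is an odd derivation of the product. -/
theorem NCWeil.iota_juxtapose (a b : NCWeil) : NCWeil.iota (NCWeil.juxtapose a b) =
    NCWeilIota.juxtaposeLeft (NCWeil.iota a) b +
      NCWeilIota.juxtaposeRight (NCWeil.parity a) (NCWeil.iota b) := by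
  have : NCWeil.juxtapose.compr₂ NCWeil.iota = NCWeilIota.juxtaposeLeft ∘ₗ NCWeil.iota +
      NCWeilIota.juxtaposeRight.compl₁₂ NCWeil.parity NCWeil.iota := by
    refine NCWeil.hom_ext fun m g x => NCWeil.hom_ext fun n g' y => ?_
    simp only [LinearMap.compr₂_apply, LinearMap.add_apply, LinearMap.comp_apply,
      LinearMap.compl₁₂_apply]
    rw [NCWeil.juxtapose_ordered, NCWeil.iota_ordered, NCWeil.iota_ordered, NCWeil.iota_ordered,
      NCWeil.parity_ordered, Fintype.sum_sum_type, map_sum, LinearMap.sum_apply, map_sum]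
    congr 1
    · refine Finset.sum_congr rfl fun k _ => ?_
      rw [Sum.elim_inl, passSignBy_sumKey_inl, map_smul, LinearMap.smul_apply]
      congr 1
      split_ifs
      · rw [NCWeilIota.juxtaposeLeft_ordered]
        let e : Fin m ⊕ Fin n ≃ Option ({j // j ≠ k} ⊕ Fin n) :=
          (Equiv.sumCongr (Equiv.optionSubtypeNe k).symm (Equiv.refl _)).trans (optionSumLeft _ _)
        have he : ∀ z, e.symm (some z) = Sum.map Subtype.val id z := by
          rintro (z | z) <;> simp [e, optionSumLeft]
        have hinj := sumKey_injective (Function.injective_id (α := Fin m))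
          (Function.injective_id (α := Fin n))
        rw [NCWeilIota.ordered_removed (sumKey id id) (Sum.elim g g') (.inl k) e
          (by simp [e, optionSumLeft]) _ _
          (hinj.comp (e.symm.injective.comp (Option.some_injective _)))]
        have h1 : JSpace.relabel e (JSpace.union x y) = JSpace.relabel (optionSumLeft _ _)
            (JSpace.union (JSpace.relabel (Equiv.optionSubtypeNe k).symm x) y) := by
          conv_rhs => rw [← JSpace.relabel_refl y]
          rw [JSpace.union_relabel, JSpace.relabel_relabel]
        have h2 : (fun z => Sum.elim g g' (e.symm (some z))) =
            Sum.elim (fun j : {j // j ≠ k} => g j) g' := by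
          ext z; rw [he]; rcases z with z | z <;> rfl
        rw [h1, h2]
        refine LinearMap.congr_fun (NCWeilIota.ordered_congr _ _ (fun z w => ?_) _) _
        rw [he, he]
        exact (sumKey_lt_congr Subtype.val id (fun _ _ => Iff.rfl) (fun _ _ => Iff.rfl) z w).symm
      · rw [NCWeilIota.juxtaposeLeft_ordered, Sum.update_elim_inl,
          JSpace.attach_inl_union k x y (optionSumLeft _ _) rfl (fun _ => rfl) (fun _ => rfl)]
    · refine Finset.sum_congr rfl fun k _ => ?_
      rw [Sum.elim_inr, passSignBy_sumKey_inr, map_smul, map_smul, LinearMap.smul_apply, smul_smul,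
        mul_comm]
      congr 1
      split_ifs
      · rw [NCWeilIota.juxtaposeRight_ordered]
        let e : Fin m ⊕ Fin n ≃ Option (Fin m ⊕ {j // j ≠ k}) :=
          (Equiv.sumCongr (Equiv.refl _) (Equiv.optionSubtypeNe k).symm).trans (optionSumRight _ _)
        have he : ∀ z, e.symm (some z) = Sum.map id Subtype.val z := by
          rintro (z | z) <;> simp [e, optionSumRight]
        have hinj := sumKey_injective (Function.injective_id (α := Fin m))
          (Function.injective_id (α := Fin n))
        rw [NCWeilIota.ordered_removed (sumKey id id) (Sum.elim g g') (.inr k) e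
          (by simp [e, optionSumRight]) _ _
          (hinj.comp (e.symm.injective.comp (Option.some_injective _)))]
        have h1 : JSpace.relabel e (JSpace.union x y) = JSpace.relabel (optionSumRight _ _)
            (JSpace.union x (JSpace.relabel (Equiv.optionSubtypeNe k).symm y)) := by
          conv_rhs => rw [← JSpace.relabel_refl x]
          rw [JSpace.union_relabel, JSpace.relabel_relabel]
        have h2 : (fun z => Sum.elim g g' (e.symm (some z))) =
            Sum.elim g (fun j : {j // j ≠ k} => g' j) := by
          ext z; rw [he]; rcases z with z | z <;> rfl
        rw [h1, h2]
        refine LinearMap.congr_fun (NCWeilIota.ordered_congr _ _ (fun z w => ?_) _) _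
        rw [he, he]
        exact (sumKey_lt_congr id Subtype.val (fun _ _ => Iff.rfl) (fun _ _ => Iff.rfl) z w).symm
      · rw [NCWeilIota.juxtaposeRight_ordered, Sum.update_elim_inr,
          JSpace.attach_inr_union k x y (optionSumRight _ _) rfl (fun _ => rfl) (fun _ => rfl)]
  exact LinearMap.congr_fun₂ this a b

theorem koszul_sumKey (k : X → A) (l : X → A') (k' : Y → B) (l' : Y → B') (g : X → LegGrade)
    (g' : Y → LegGrade) : koszul (sumKey k k') (sumKey l l') (Sum.elim g g') =
      koszul k l g * koszul k' l' g' := by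
  simp [koszul]

/-- The product on the commutative Weil complex does not see a symmetrization of the first factor.
-/
theorem Weil.mk_juxtapose_average_left (a b : NCWeil) :
    permRelations.mkQ (NCWeil.juxtapose (NCWeil.average a) b) =
      permRelations.mkQ (NCWeil.juxtapose a b) := by
  have : (NCWeil.juxtapose ∘ₗ NCWeil.average).compr₂ permRelations.mkQ =
      NCWeil.juxtapose.compr₂ permRelations.mkQ := by
    refine NCWeil.hom_ext fun m g x => NCWeil.hom_ext fun n g' y => ?_
    simp only [LinearMap.compr₂_apply, LinearMap.comp_apply]
    conv_lhs => rw [← NCWeil.lof_eq_ordered, NCWeil.average_lof]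
    simp only [NCWeil.place_eq_ordered, map_smul, map_sum, LinearMap.smul_apply,
      LinearMap.sum_apply, NCWeil.juxtapose_ordered]
    have h : ∀ π : Equiv.Perm (Fin m), koszul (id : Fin m → Fin m) π g • permRelations.mkQ
        (NCWeil.ordered (sumKey π id) (sumKey_injective π.injective Function.injective_id)
          (Sum.elim g g') (JSpace.union x y)) = permRelations.mkQ (NCWeil.ordered (sumKey id id)
          (sumKey_injective Function.injective_id Function.injective_id)
          (Sum.elim g g') (JSpace.union x y)) := by
      intro π
      rw [Weil.mk_ordered (sumKey π id) (sumKey id id) _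
        (sumKey_injective Function.injective_id Function.injective_id), koszul_sumKey, koszul_self,
        mul_one, smul_smul, koszul_mul_self _ _ Function.injective_id π.injective, one_smul]
    simp only [h]
    rw [Finset.sum_const, Finset.card_univ, Fintype.card_perm, Fintype.card_fin,
      ← Nat.cast_smul_eq_nsmul ℚ, smul_smul, inv_mul_cancel₀, one_smul]
    exact_mod_cast m.factorial_ne_zero
  exact LinearMap.congr_fun₂ this a b

/-- The product on the commutative Weil complex does not see a symmetrization of the second factor.
-/
theorem Weil.mk_juxtapose_average_right (a b : NCWeil) :
    permRelations.mkQ (NCWeil.juxtapose a (NCWeil.average b)) =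
      permRelations.mkQ (NCWeil.juxtapose a b) := by
  have : (NCWeil.juxtapose.compl₂ NCWeil.average).compr₂ permRelations.mkQ =
      NCWeil.juxtapose.compr₂ permRelations.mkQ := by
    refine NCWeil.hom_ext fun m g x => NCWeil.hom_ext fun n g' y => ?_
    simp only [LinearMap.compr₂_apply, LinearMap.compl₂_apply]
    conv_lhs => rw [← NCWeil.lof_eq_ordered g' y, NCWeil.average_lof]
    simp only [NCWeil.place_eq_ordered, map_smul, map_sum, NCWeil.juxtapose_ordered]
    have h : ∀ π : Equiv.Perm (Fin n), koszul (id : Fin n → Fin n) π g' • permRelations.mkQ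
        (NCWeil.ordered (sumKey id π) (sumKey_injective Function.injective_id π.injective)
          (Sum.elim g g') (JSpace.union x y)) = permRelations.mkQ (NCWeil.ordered (sumKey id id)
          (sumKey_injective Function.injective_id Function.injective_id)
          (Sum.elim g g') (JSpace.union x y)) := by
      intro π
      rw [Weil.mk_ordered (sumKey id π) (sumKey id id) _
        (sumKey_injective Function.injective_id Function.injective_id), koszul_sumKey, koszul_self,
        one_mul, smul_smul, koszul_mul_self _ _ Function.injective_id π.injective, one_smul]
    simp only [h]
    rw [Finset.sum_const, Finset.card_univ, Fintype.card_perm, Fintype.card_fin,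
      ← Nat.cast_smul_eq_nsmul ℚ, smul_smul, inv_mul_cancel₀, one_smul]
    exact_mod_cast n.factorial_ne_zero
  exact LinearMap.congr_fun₂ this a b

end
/-! ### Products of curvatures are basic -/

section
variable {n : ℕ}

theorem splitHairs_apply (x : JSpace (Fin n)) : splitHairs n x =
    ∑ S : Finset (Fin n), (-1 / 2 : ℚ) ^ S.card •
      NCWeil.ordered (forkKey S) (forkKey_injective S) (forkGrade S)
        (JSpace.insert (forkContext S) x) := by
  unfold splitHairs
  rw [LinearMap.sum_apply]
  rfl

/-- The product over the legs after forking, collected by the original legs: the factor of `l` is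
the contribution of the leg or right tine at `l` times that of the left tine. -/
theorem passSignBy_fork (S : Finset (Fin n)) (k : Fin n ⊕ S) :
    passSignBy (forkKey S) (forkGrade S) k = ∏ l,
      (if toLex (l, (1 : Fin 2)) < forkKey S k then (-1 : ℚ) ^ (if l ∈ S then 1 else 2) else 1) *
        if l ∈ S then (if toLex (l, (0 : Fin 2)) < forkKey S k then (-1 : ℚ) else 1) else 1 := by
  unfold passSignBy
  rw [Fintype.prod_sum_type, Finset.prod_mul_distrib]
  congr 1
  · refine Finset.prod_congr rfl fun l _ => ?_
    by_cases hl : l ∈ S <;> simp [forkKey, forkGrade, hl, LegGrade.deg]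
  · rw [Finset.prod_ite_mem, Finset.univ_inter, ← Finset.prod_coe_sort S]
    refine Finset.prod_congr rfl fun s _ => ?_
    simp only [forkGrade, LegGrade.deg, pow_one]
    rfl

/-- The grades before a leg add up to an even number, as each curvature is even. -/
theorem passSignBy_fork_inl_of_notMem (S : Finset (Fin n)) {l : Fin n} (hl : l ∉ S) :
    passSignBy (forkKey S) (forkGrade S) (.inl l) = 1 := by
  rw [passSignBy_fork]
  refine Finset.prod_eq_one fun a _ => ?_
  rcases lt_trichotomy a l with h | rfl | h
  · by_cases ha : a ∈ S <;> simp [forkKey, Prod.Lex.toLex_lt_toLex, h, ha]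
  · simp [forkKey, hl]
  · by_cases ha : a ∈ S <;> simp [forkKey, Prod.Lex.toLex_lt_toLex, h.not_gt, h.ne', ha]

theorem passSignBy_fork_inr (S : Finset (Fin n)) (s : S) :
    passSignBy (forkKey S) (forkGrade S) (.inr s) = 1 := by
  rw [passSignBy_fork]
  refine Finset.prod_eq_one fun a _ => ?_
  rcases lt_trichotomy a s with h | rfl | h
  · by_cases ha : a ∈ S <;> simp [forkKey, Prod.Lex.toLex_lt_toLex, h, ha]
  · simp [forkKey, Prod.Lex.toLex_lt_toLex]
  · by_cases ha : a ∈ S <;> simp [forkKey, Prod.Lex.toLex_lt_toLex, h.not_gt, h.ne', ha]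

/-- The only odd contribution before a right tine is the left tine of the same fork. -/
theorem passSignBy_fork_inl_of_mem (S : Finset (Fin n)) {l : Fin n} (hl : l ∈ S) :
    passSignBy (forkKey S) (forkGrade S) (.inl l) = -1 := by
  rw [passSignBy_fork, Finset.prod_eq_single l]
  · simp [forkKey, Prod.Lex.toLex_lt_toLex, hl]
  · intro a _ hal
    rcases lt_or_gt_of_ne hal with h | h
    · by_cases ha : a ∈ S <;> simp [forkKey, Prod.Lex.toLex_lt_toLex, h, ha]
    · by_cases ha : a ∈ S <;> simp [forkKey, Prod.Lex.toLex_lt_toLex, h.not_gt, h.ne', ha]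
  · simp

/-- Reindexing a sum over pairs of a set and one of its elements by removing the element. -/
theorem sum_sum_erase {L M : Type*} [Fintype L] [DecidableEq L] [AddCommMonoid M]
    (f : Finset L → L → M) :
    ∑ S : Finset L, ∑ l, (if l ∈ S then f (S.erase l) l else 0) =
      ∑ S : Finset L, ∑ l, if l ∈ S then 0 else f S l := by
  rw [Finset.sum_comm, Finset.sum_comm (s := (Finset.univ : Finset (Finset L)))]
  refine Finset.sum_congr rfl fun l _ => ?_
  have hnot : ∀ S : Finset L, (if l ∈ S then 0 else f S l) = if l ∉ S then f S l else 0 :=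
    fun S => (ite_not _ _ _).symm
  simp only [hnot]
  rw [← Finset.sum_filter, ← Finset.sum_filter]
  refine Finset.sum_nbij' (fun S => S.erase l) (fun S => insert l S) ?_ ?_ ?_ ?_ ?_
  · simp
  · simp
  · intro S hS; exact Finset.insert_erase (Finset.mem_filter.1 hS).2
  · intro S hS; exact Finset.erase_insert (Finset.mem_filter.1 hS).2
  · simp

/-- The legs after forks are grafted on the legs in `S`, with the right tine at `l ∈ S` singled out;
the left tine gets the name of `l`. -/
def rightTineEquiv {S : Finset (Fin n)} {l : Fin n} (h : l ∈ S) :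
    Fin n ⊕ S ≃ Option (Fin n ⊕ S.erase l) :=
  (tineEquiv h).trans (Equiv.swap none (some (.inl l)))

theorem rightTineEquiv_inl_self {S : Finset (Fin n)} {l : Fin n} (h : l ∈ S) :
    rightTineEquiv h (.inl l) = none := by simp [rightTineEquiv]

theorem rightTineEquiv_symm_inl_self {S : Finset (Fin n)} {l : Fin n} (h : l ∈ S) :
    (rightTineEquiv h).symm (some (.inl l)) = .inr ⟨l, h⟩ := by simp [rightTineEquiv]

theorem rightTineEquiv_symm_inl {S : Finset (Fin n)} {l : Fin n} (h : l ∈ S) {a : Fin n}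
    (ha : a ≠ l) : (rightTineEquiv h).symm (some (.inl a)) = .inl a := by
  simp [rightTineEquiv, Equiv.swap_apply_of_ne_of_ne, ha]

theorem rightTineEquiv_symm_inr {S : Finset (Fin n)} {l : Fin n} (h : l ∈ S) (s : S.erase l) :
    (rightTineEquiv h).symm (some (.inr s)) = .inr ⟨s, Finset.mem_of_mem_erase s.2⟩ := by
  simp [rightTineEquiv, Equiv.swap_apply_of_ne_of_ne]

theorem relabel_rightTineEquiv {S : Finset (Fin n)} {l : Fin n} (h : l ∈ S) (x : JSpace (Fin n)) :
    JSpace.relabel (rightTineEquiv h) (JSpace.insert (forkContext S) x) =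
      -JSpace.attach (.inl l) (JSpace.insert (forkContext (S.erase l)) x) := by
  rw [rightTineEquiv, ← JSpace.relabel_relabel, JSpace.relabel_insert_fork,
    JSpace.relabel_swap_attach]

/-- Removing the left tine of a fork leaves the order of the legs unchanged. -/
theorem forkKey_tineEquiv_lt {S : Finset (Fin n)} {l : Fin n} (h : l ∈ S)
    (y z : Fin n ⊕ S.erase l) :
    forkKey S ((tineEquiv h).symm (some y)) < forkKey S ((tineEquiv h).symm (some z)) ↔
      forkKey (S.erase l) y < forkKey (S.erase l) z := by
  rcases y with y | y <;> rcases z with z | z <;> simp [forkKey]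

/-- Removing the right tine of a fork leaves the order of the legs unchanged. -/
theorem forkKey_rightTineEquiv_lt {S : Finset (Fin n)} {l : Fin n} (h : l ∈ S)
    (y z : Fin n ⊕ S.erase l) :
    forkKey S ((rightTineEquiv h).symm (some y)) < forkKey S ((rightTineEquiv h).symm (some z)) ↔
      forkKey (S.erase l) y < forkKey (S.erase l) z := by
  have key : ∀ y : Fin n ⊕ S.erase l, forkKey S ((rightTineEquiv h).symm (some y)) =
      if y = .inl l then toLex (l, 0) else forkKey (S.erase l) y := by
    rintro (a | s)
    · by_cases ha : a = l
      · subst ha; rw [rightTineEquiv_symm_inl_self, if_pos rfl]; rfl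
      · rw [rightTineEquiv_symm_inl h ha, if_neg (by simpa using ha)]; rfl
    · rw [rightTineEquiv_symm_inr, if_neg (by simp)]; rfl
  have hne : ∀ s : S.erase l, s.1 ≠ l := fun s => Finset.ne_of_mem_erase s.2
  have hlt : ∀ (a : Fin n) (p q p' q' : Fin 2), a ≠ l →
      (toLex (a, p) < toLex (l, q) ↔ toLex (a, p') < toLex (l, q')) := by
    intro a p q p' q' ha
    simp [Prod.Lex.toLex_lt_toLex, ha]
  have hgt : ∀ (a : Fin n) (p q p' q' : Fin 2), a ≠ l →
      (toLex (l, q) < toLex (a, p) ↔ toLex (l, q') < toLex (a, p')) := by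
    intro a p q p' q' ha
    simp [Prod.Lex.toLex_lt_toLex, ha.symm]
  rw [key, key]
  by_cases hy : y = .inl l <;> by_cases hz : z = .inl l
  · rw [if_pos hy, if_pos hz, hy, hz]; simp
  · rw [if_pos hy, if_neg hz, hy]
    rcases z with a | s
    · exact hgt a _ _ _ _ (by simpa using hz)
    · exact hgt s _ _ _ _ (hne s)
  · rw [if_neg hy, if_pos hz, hz]
    rcases y with a | s
    · exact hlt a _ _ _ _ (by simpa using hy)
    · exact hlt s _ _ _ _ (hne s)
  · rw [if_neg hy, if_neg hz]

theorem forkGrade_tineEquiv {S : Finset (Fin n)} {l : Fin n} (h : l ∈ S) (y : Fin n ⊕ S.erase l) :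
    forkGrade S ((tineEquiv h).symm (some y)) =
      Function.update (forkGrade (S.erase l)) (.inl l) .one y := by
  rcases y with a | s
  · by_cases ha : a = l
    · subst ha; simp [forkGrade, h]
    · simp [forkGrade, ha]
  · simp [forkGrade]

theorem forkGrade_rightTineEquiv {S : Finset (Fin n)} {l : Fin n} (h : l ∈ S)
    (y : Fin n ⊕ S.erase l) : forkGrade S ((rightTineEquiv h).symm (some y)) =
      Function.update (forkGrade (S.erase l)) (.inl l) .one y := by
  rcases y with a | s
  · by_cases ha : a = l
    · subst ha; rw [rightTineEquiv_symm_inl_self]; simp [forkGrade]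
    · rw [rightTineEquiv_symm_inl h ha]; simp [forkGrade, ha]
  · rw [rightTineEquiv_symm_inr]; simp [forkGrade]

/-- The leg `ι` is attached to the leg `l` of a diagram with forks on the legs in `S`, and `l` gets
grade `1`. -/
noncomputable def attachedTerm (S : Finset (Fin n)) (l : Fin n) (x : JSpace (Fin n)) : NCWeilIota :=
  NCWeilIota.ordered (forkKey S) (forkKey_injective S) (Function.update (forkGrade S) (.inl l) .one)
    (JSpace.attach (.inl l) (JSpace.insert (forkContext S) x))

/-- For `l ∈ S`, each of the two tines becomes `ι` once; the signs of the right tine, from the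
position and from AS, cancel. -/
theorem iota_fork (S : Finset (Fin n)) (x : JSpace (Fin n)) :
    NCWeil.iota (NCWeil.ordered (forkKey S) (forkKey_injective S) (forkGrade S)
      (JSpace.insert (forkContext S) x)) =
      ∑ l, (if l ∈ S then (2 : ℚ) • attachedTerm (S.erase l) l x else 0) +
        ∑ l, if l ∈ S then 0 else attachedTerm S l x := by
  have hleft : ∀ s : S, passSignBy (forkKey S) (forkGrade S) (.inr s) •
      (if forkGrade S (.inr s) = .one then
        NCWeilIota.ordered (fun j : {j : Fin n ⊕ S // j ≠ .inr s} => forkKey S j)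
          ((forkKey_injective S).comp Subtype.val_injective) (fun j => forkGrade S j)
          (JSpace.relabel (Equiv.optionSubtypeNe (.inr s)).symm (JSpace.insert (forkContext S) x))
        else NCWeilIota.ordered (forkKey S) (forkKey_injective S)
          (Function.update (forkGrade S) (.inr s) .one)
          (JSpace.attach (.inr s) (JSpace.insert (forkContext S) x))) =
        attachedTerm (S.erase s) s x := by
    rintro ⟨l, h⟩
    rw [passSignBy_fork_inr, one_smul, if_pos (show forkGrade S (.inr ⟨l, h⟩) = .one from rfl),
      NCWeilIota.ordered_removed (forkKey S) (forkGrade S) (.inr ⟨l, h⟩)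
        (tineEquiv h) (by simp) _ _ ((forkKey_injective S).comp
          ((tineEquiv h).symm.injective.comp (Option.some_injective _))),
      JSpace.relabel_insert_fork, funext (forkGrade_tineEquiv h)]
    exact LinearMap.congr_fun (NCWeilIota.ordered_congr _ _ (forkKey_tineEquiv_lt h) _) _
  have hright : ∀ l : Fin n, passSignBy (forkKey S) (forkGrade S) (.inl l) •
      (if forkGrade S (.inl l) = .one then
        NCWeilIota.ordered (fun j : {j : Fin n ⊕ S // j ≠ .inl l} => forkKey S j)
          ((forkKey_injective S).comp Subtype.val_injective) (fun j => forkGrade S j)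
          (JSpace.relabel (Equiv.optionSubtypeNe (Sum.inl l : Fin n ⊕ S)).symm
            (JSpace.insert (forkContext S) x))
        else NCWeilIota.ordered (forkKey S) (forkKey_injective S)
          (Function.update (forkGrade S) (.inl l) .one)
          (JSpace.attach (.inl l) (JSpace.insert (forkContext S) x))) =
        (if l ∈ S then attachedTerm (S.erase l) l x else 0) +
          if l ∈ S then 0 else attachedTerm S l x := by
    intro l
    by_cases h : l ∈ S
    · have hg : forkGrade S (.inl l) = .one := by simp [forkGrade, h]
      rw [passSignBy_fork_inl_of_mem S h, if_pos hg,
        NCWeilIota.ordered_removed (forkKey S) (forkGrade S) (.inl l)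
          (rightTineEquiv h) (rightTineEquiv_inl_self h) _
          ((forkKey_injective S).comp Subtype.val_injective) ((forkKey_injective S).comp
            ((rightTineEquiv h).symm.injective.comp (Option.some_injective _))),
        relabel_rightTineEquiv, funext (forkGrade_rightTineEquiv h), map_neg, neg_smul, one_smul,
        neg_neg, if_pos h, if_pos h, add_zero]
      exact LinearMap.congr_fun (NCWeilIota.ordered_congr _ _ (forkKey_rightTineEquiv_lt h) _) _
    · have hg : forkGrade S (.inl l) ≠ .one := by simp [forkGrade, h]
      rw [passSignBy_fork_inl_of_notMem S h, one_smul, if_neg hg, if_neg h, if_neg h, zero_add]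
      rfl
  rw [NCWeil.iota_ordered, Fintype.sum_sum_type]
  simp only [hleft, hright]
  rw [Finset.sum_add_distrib, add_right_comm]
  congr 1
  rw [Finset.sum_coe_sort S fun l => attachedTerm (S.erase l) l x, ← Finset.univ_inter S,
    ← Finset.sum_ite_mem, ← Finset.sum_add_distrib]
  refine Finset.sum_congr rfl fun l _ => ?_
  rw [Finset.univ_inter]
  split_ifs
  · rw [two_smul]
  · rw [add_zero]

/-- A product of curvatures is killed by `ι`: at each leg, the two tines of the fork contribute
equally, and cancel the contribution of the leg of grade `2`. -/
theorem iota_splitHairs (x : JSpace (Fin n)) : NCWeil.iota (splitHairs n x) = 0 := by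
  rw [splitHairs_apply, map_sum]
  simp only [map_smul, iota_fork, smul_add, Finset.sum_add_distrib]
  have h := sum_sum_erase fun (S : Finset (Fin n)) l =>
    (-1 / 2 : ℚ) ^ (S.card + 1) • (2 : ℚ) • attachedTerm S l x
  have h1 : ∀ S : Finset (Fin n), (-1 / 2 : ℚ) ^ S.card •
      ∑ l, (if l ∈ S then (2 : ℚ) • attachedTerm (S.erase l) l x else 0) =
      ∑ l, if l ∈ S then (-1 / 2 : ℚ) ^ ((S.erase l).card + 1) •
        (2 : ℚ) • attachedTerm (S.erase l) l x else 0 := by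
    intro S
    rw [Finset.smul_sum]
    refine Finset.sum_congr rfl fun l _ => ?_
    split_ifs with hl
    · rw [Finset.card_erase_add_one hl]
    · rw [smul_zero]
  rw [Finset.sum_congr rfl fun S _ => h1 S, h, ← Finset.sum_add_distrib]
  refine Finset.sum_eq_zero fun S _ => ?_
  rw [Finset.smul_sum, ← Finset.sum_add_distrib]
  refine Finset.sum_eq_zero fun l _ => ?_
  split_ifs
  · rw [smul_zero, add_zero]
  · rw [smul_smul, ← add_smul, pow_succ]
    have : (-1 / 2 : ℚ) ^ S.card * (-1 / 2) * 2 + (-1 / 2) ^ S.card = 0 := by ring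
    rw [this, zero_smul]

end
/-! ### Products of curvatures are closed in the commutative Weil complex -/

section
variable {X Y A B : Type}

/-- The order in which `none` comes first. -/
def headKey (key : X → A) (o : Option X) : WithBot A := o.map key

theorem headKey_injective {key : X → A} (hkey : Function.Injective key) :
    Function.Injective (headKey key) := Option.map_injective hkey

variable [Fintype X] [Fintype Y] [LinearOrder A] [LinearOrder B]

/-- The grades of the legs, when `none` has grade `1`. -/
def headGrade (g : X → LegGrade) (o : Option X) : LegGrade := o.elim .one g

/-- A leg of grade `1` that passes even legs only may be moved to the front. -/
theorem Weil.mk_ordered_eq_head (key : X → A) (hkey : Function.Injective key) (g : X → LegGrade)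
    (k : X) (hk : passSignBy key g k = 1) (e : X ≃ Option Y) (he : e k = none) (key' : Y → B)
    (hkey' : Function.Injective key')
    (h : ∀ y z, key (e.symm (some y)) < key (e.symm (some z)) ↔ key' y < key' z)
    (g' : Y → LegGrade) (hg : g k = .one) (hg' : ∀ y, g (e.symm (some y)) = g' y)
    (x : JSpace X) :
    permRelations.mkQ (NCWeil.ordered key hkey g x) =
      permRelations.mkQ (NCWeil.ordered (headKey key') (headKey_injective hkey') (headGrade g')
        (JSpace.relabel e x)) := by
  have hinj := (headKey_injective hkey').comp e.injective
  have hgrade : headGrade g' ∘ e = g := by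
    ext z
    obtain ⟨_ | y, rfl⟩ := e.symm.surjective z
    · rw [← he, Equiv.symm_apply_apply, hg, Function.comp_apply, he]
      rfl
    · rw [Function.comp_apply, Equiv.apply_symm_apply, hg']
      rfl
  have hfirst : passSignBy (headKey key' ∘ e) g k = 1 := by
    refine Finset.prod_eq_one fun z _ => if_neg ?_
    rw [Function.comp_apply, Function.comp_apply, he]
    exact not_lt_bot
  have hrest : koszul (fun y => key (e.symm (some y)))
      (fun y => (headKey key' ∘ e) (e.symm (some y))) (fun y => g (e.symm (some y))) = 1 := by
    rw [koszul_congr (σ' := key') (τ' := key') h (fun y z => ?_), koszul_self]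
    simp only [Function.comp_apply, Equiv.apply_symm_apply]
    exact WithBot.coe_lt_coe
  rw [NCWeil.ordered_relabel, Weil.mk_ordered key (headKey key' ∘ e) hkey hinj,
    koszul_remove key (headKey key' ∘ e) hkey hinj g k e he, if_pos hg, hk, hfirst, hrest, hgrade,
    one_mul, one_mul, one_smul]

/-- Three legs of grade `1` joined in a tree vanish in the commutative Weil complex: by IHX, the sum
of the cyclic rotations of the tree is zero, and these are equal. -/
theorem Weil.mk_ordered_attach_attach [DecidableEq X] (k : X) (x : JSpace X)
    (key : Option (Option X) → A) (hkey : Function.Injective key) (g : Option (Option X) → LegGrade)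
    (h0 : g none = .one) (h1 : g (some none) = .one) (h2 : g (some (some k)) = .one) :
    permRelations.mkQ
        (NCWeil.ordered key hkey g (JSpace.attach (some k) (JSpace.attach k x))) = 0 ∧
      permRelations.mkQ
        (NCWeil.ordered key hkey g (JSpace.attach none (JSpace.attach k x))) = 0 := by
  have hrot : JSpace.attach none (JSpace.attach k x) = -JSpace.relabel
      (Equiv.swap (some none) (some (some k))) (JSpace.attach (some k) (JSpace.attach k x)) := by
    have := JSpace.attach_relabel (Equiv.swap none (some k)) (some k) (JSpace.attach k x)
    rw [Equiv.swap_apply_right, JSpace.relabel_swap_attach, map_neg, neg_eq_iff_eq_neg] at this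
    rw [this]
    congr 3
    ext o : 1
    rcases o with _ | _ | o
    · simp [Equiv.swap_apply_of_ne_of_ne]
    · simp
    · by_cases h : o = k
      · subst h; simp
      · simp [Equiv.swap_apply_of_ne_of_ne, h]
  have hj := congrArg (fun z => permRelations.mkQ (NCWeil.ordered key hkey g z))
    (JSpace.attach_attach_jacobi k x)
  simp only [map_sub] at hj
  rw [Weil.mk_ordered_swap (by simp) key hkey g h0 h1] at hj
  have hn : permRelations.mkQ (NCWeil.ordered key hkey g (JSpace.attach none (JSpace.attach k x))) =
      permRelations.mkQ
        (NCWeil.ordered key hkey g (JSpace.attach (some k) (JSpace.attach k x))) := by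
    rw [hrot, map_neg, map_neg, Weil.mk_ordered_swap (by simp) key hkey g h1 h2, neg_neg]
  rw [hn] at hj ⊢
  refine ⟨?_, ?_⟩ <;>
  · set w := permRelations.mkQ
      (NCWeil.ordered key hkey g (JSpace.attach (some k) (JSpace.attach k x)))
    have h3 : (3 : ℚ) • w = 0 := by
      have : w + w + w = 0 := by nth_rewrite 1 [hj]; abel
      rw [← this]; module
    exact (smul_eq_zero.1 h3).resolve_left (by norm_num)

end

section
variable {n : ℕ}

/-- A leg of grade `1`, placed in front of all the others, is attached to the leg `k` of a diagram
with forks on the legs in `S`. -/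
noncomputable def headTerm (S : Finset (Fin n)) (k : Fin n ⊕ S) (x : JSpace (Fin n)) : Weil :=
  permRelations.mkQ (NCWeil.ordered (headKey (forkKey S)) (headKey_injective (forkKey_injective S))
    (headGrade (forkGrade S)) (JSpace.attach k (JSpace.insert (forkContext S) x)))

/-- Attaching the odd leg to a tine gives a tree with three legs of grade `1`, which vanishes. -/
theorem headTerm_tine {S : Finset (Fin n)} {l : Fin n} (h : l ∈ S) (x : JSpace (Fin n)) :
    headTerm S (.inl l) x = 0 ∧ headTerm S (.inr ⟨l, h⟩) x = 0 := by
  have h1 : JSpace.insert (forkContext S) x = JSpace.relabel (tineEquiv h).symm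
      (JSpace.attach (.inl l) (JSpace.insert (forkContext (S.erase l)) x)) := by
    rw [← JSpace.relabel_insert_fork h, JSpace.relabel_relabel, Equiv.self_trans_symm,
      JSpace.relabel_refl]
  have h2 := JSpace.attach_relabel (tineEquiv h).symm (some (.inl l))
    (JSpace.attach (.inl l) (JSpace.insert (forkContext (S.erase l)) x))
  have h3 := JSpace.attach_relabel (tineEquiv h).symm none
    (JSpace.attach (.inl l) (JSpace.insert (forkContext (S.erase l)) x))
  rw [← h1] at h2 h3
  rw [tineEquiv_symm_inl] at h2
  rw [tineEquiv_symm_none] at h3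
  unfold headTerm
  rw [h2, h3, NCWeil.ordered_relabel, NCWeil.ordered_relabel]
  refine Weil.mk_ordered_attach_attach _ _ _ _ _ ?_ ?_ ?_
  · rfl
  · change forkGrade S ((tineEquiv h).symm none) = .one
    rw [tineEquiv_symm_none]
    rfl
  · change forkGrade S ((tineEquiv h).symm (some (.inl l))) = .one
    rw [tineEquiv_symm_inl]
    exact if_pos h

/-- By `JSpace.sum_attach`, the attachments of the odd leg to the legs of grade `2` add up to zero.
-/
theorem sum_headTerm (S : Finset (Fin n)) (x : JSpace (Fin n)) :
    ∑ l, (if l ∈ S then 0 else headTerm S (.inl l) x) = 0 := by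
  have h := congrArg (fun z => permRelations.mkQ (NCWeil.ordered (headKey (forkKey S))
    (headKey_injective (forkKey_injective S)) (headGrade (forkGrade S)) z))
    (JSpace.sum_attach (JSpace.insert (forkContext S) x))
  simp only [map_sum, map_zero] at h
  rw [Fintype.sum_sum_type] at h
  have h2 : ∀ s : S, headTerm S (.inr s) x = 0 := fun s => (headTerm_tine s.2 x).2
  change ∑ l, headTerm S (.inl l) x + ∑ s : S, headTerm S (.inr s) x = 0 at h
  simp only [h2, Finset.sum_const_zero, add_zero] at h
  refine Eq.trans (Finset.sum_congr rfl fun l _ => ?_) h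
  split_ifs with hl
  · exact (headTerm_tine hl x).1.symm
  · rfl

theorem update_forkGrade_tineEquiv {S : Finset (Fin n)} {l : Fin n} (h : l ∈ S)
    (y : Fin n ⊕ S.erase l) : Function.update (forkGrade S) (.inl l) .two
      ((tineEquiv h).symm (some y)) = forkGrade (S.erase l) y := by
  rcases y with a | s
  · by_cases ha : a = l
    · subst ha; simp [forkGrade]
    · simp [forkGrade, ha]
  · simp [forkGrade]

theorem update_forkGrade_rightTineEquiv {S : Finset (Fin n)} {l : Fin n} (h : l ∈ S)
    (y : Fin n ⊕ S.erase l) : Function.update (forkGrade S) (.inr ⟨l, h⟩) .two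
      ((rightTineEquiv h).symm (some y)) = forkGrade (S.erase l) y := by
  rcases y with a | s
  · by_cases ha : a = l
    · subst ha; rw [rightTineEquiv_symm_inl_self]; simp [forkGrade]
    · rw [rightTineEquiv_symm_inl h ha]; simp [forkGrade, ha]
  · rw [rightTineEquiv_symm_inr, Function.update_of_ne]
    · rfl
    · have := Finset.ne_of_mem_erase s.2
      simpa [Subtype.ext_iff] using this

/-- The differential turns one of the tines of a fork into a leg of grade `2`. The other tine is
moved to the front, and what remains is an odd leg attached to a leg of grade `2`; both tines
contribute the same. -/
theorem mk_d_fork (S : Finset (Fin n)) (x : JSpace (Fin n)) :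
    permRelations.mkQ (NCWeil.d (NCWeil.ordered (forkKey S) (forkKey_injective S) (forkGrade S)
      (JSpace.insert (forkContext S) x))) =
      ∑ l, if l ∈ S then (-2 : ℚ) • headTerm (S.erase l) (.inl l) x else 0 := by
  have hlt : ∀ s : S, forkKey S (.inr s) < forkKey S (.inl s) := fun s => by
    simp [forkKey, Prod.Lex.toLex_lt_toLex]
  have hleft : ∀ s : S, permRelations.mkQ (if forkGrade S (.inr s) = .one then
      passSignBy (forkKey S) (forkGrade S) (.inr s) • NCWeil.ordered (forkKey S)
        (forkKey_injective S) (Function.update (forkGrade S) (.inr s) .two)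
          (JSpace.insert (forkContext S) x) else 0) = -headTerm (S.erase s) (.inl s) x := by
    rintro ⟨l, h⟩
    have hg : forkGrade S (.inl l) = .one := by simp [forkGrade, h]
    have hgs : forkGrade S (.inr ⟨l, h⟩) = .one := rfl
    rw [if_pos hgs, passSignBy_fork_inr, one_smul, Weil.mk_ordered_eq_head (forkKey S) _ _ (.inl l)
      ?_ (rightTineEquiv h) (rightTineEquiv_inl_self h) (forkKey (S.erase l))
      (forkKey_injective _) (forkKey_rightTineEquiv_lt h) (forkGrade (S.erase l)) ?_
      (update_forkGrade_rightTineEquiv h), relabel_rightTineEquiv, map_neg, map_neg]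
    · rfl
    · rw [passSignBy_update _ _ _ _ (by rw [hgs]; simp), if_pos (hlt ⟨l, h⟩),
        passSignBy_fork_inl_of_mem S h]
      norm_num
    · rw [Function.update_of_ne (by simp), hg]
  have hright : ∀ l : Fin n, permRelations.mkQ (if forkGrade S (.inl l) = .one then
      passSignBy (forkKey S) (forkGrade S) (.inl l) • NCWeil.ordered (forkKey S)
        (forkKey_injective S) (Function.update (forkGrade S) (.inl l) .two)
          (JSpace.insert (forkContext S) x) else 0) =
      if l ∈ S then -headTerm (S.erase l) (.inl l) x else 0 := by
    intro l
    by_cases h : l ∈ S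
    · have hg : forkGrade S (.inl l) = .one := by simp [forkGrade, h]
      rw [if_pos hg, if_pos h, passSignBy_fork_inl_of_mem S h, map_smul,
        Weil.mk_ordered_eq_head (forkKey S) _ _ (.inr ⟨l, h⟩)
        ?_ (tineEquiv h) (by simp) (forkKey (S.erase l))
        (forkKey_injective _) (forkKey_tineEquiv_lt h) (forkGrade (S.erase l)) ?_
        (update_forkGrade_tineEquiv h), JSpace.relabel_insert_fork, neg_smul, one_smul]
      · rfl
      · rw [passSignBy_update _ _ _ _ (by rw [hg]; simp), if_neg (hlt ⟨l, h⟩).not_gt,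
          passSignBy_fork_inr, one_mul]
      · rw [Function.update_of_ne (by simp)]
        rfl
    · have hg : forkGrade S (.inl l) ≠ .one := by simp [forkGrade, h]
      rw [if_neg hg, if_neg h, map_zero]
  rw [NCWeil.d_ordered, Fintype.sum_sum_type, map_add, map_sum, map_sum]
  simp only [hleft, hright]
  rw [Finset.sum_coe_sort S fun l => -headTerm (S.erase l) (.inl l) x, ← Finset.univ_inter S,
    ← Finset.sum_ite_mem, ← Finset.sum_add_distrib]
  refine Finset.sum_congr rfl fun l _ => ?_
  rw [Finset.univ_inter]
  split_ifs
  · module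
  · rw [add_zero]

/-- A product of curvatures is closed in the commutative Weil complex: its differential is the sum
of all ways to attach an odd leg to the legs of grade `2` of the expanded product. -/
theorem mk_d_splitHairs (x : JSpace (Fin n)) :
    permRelations.mkQ (NCWeil.d (splitHairs n x)) = 0 := by
  rw [splitHairs_apply, map_sum, map_sum]
  simp only [map_smul, mk_d_fork]
  have h := sum_sum_erase fun (S : Finset (Fin n)) l =>
    (-1 / 2 : ℚ) ^ (S.card + 1) • (-2 : ℚ) • headTerm S (.inl l) x
  have h1 : ∀ S : Finset (Fin n), (-1 / 2 : ℚ) ^ S.card •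
      ∑ l, (if l ∈ S then (-2 : ℚ) • headTerm (S.erase l) (.inl l) x else 0) =
      ∑ l, if l ∈ S then (-1 / 2 : ℚ) ^ ((S.erase l).card + 1) •
        (-2 : ℚ) • headTerm (S.erase l) (.inl l) x else 0 := by
    intro S
    rw [Finset.smul_sum]
    refine Finset.sum_congr rfl fun l _ => ?_
    split_ifs with hl
    · rw [Finset.card_erase_add_one hl]
    · rw [smul_zero]
  rw [Finset.sum_congr rfl fun S _ => h1 S, h]
  refine Finset.sum_eq_zero fun S _ => ?_
  refine Eq.trans ?_ ((congrArg (fun z => ((-1 / 2 : ℚ) ^ (S.card + 1) * -2) • z)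
    (sum_headTerm S x)).trans (smul_zero _))
  rw [Finset.smul_sum]
  refine Finset.sum_congr rfl fun l _ => ?_
  split_ifs
  · rw [smul_zero]
  · rw [smul_smul]

end
/-! ### Products of curvatures -/

section

theorem forkGrade_disjSum {m n : ℕ} (S : Finset (Fin m)) (S' : Finset (Fin n))
    (z : (Fin m ⊕ S) ⊕ (Fin n ⊕ S')) :
    forkGrade (S.disjSum S') (forkUnionEquiv S S' z) =
      Sum.elim (forkGrade S) (forkGrade S') z := by
  rcases z with (l | s) | (l | s)
  · simp [forkUnionEquiv, forkGrade]
  · rfl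
  · simp [forkUnionEquiv, forkGrade]
  · rfl

/-- The order of the legs after forking a disjoint union. -/
theorem forkKey_union_lt {m n : ℕ} (S : Finset (Fin m)) (S' : Finset (Fin n))
    (R : Finset (Fin (m + n))) (h : ∀ l, l ∈ S.disjSum S' ↔ finSumFinEquiv l ∈ R)
    (y z : (Fin m ⊕ S) ⊕ (Fin n ⊕ S')) :
    sumKey (forkKey S) (forkKey S') y < sumKey (forkKey S) (forkKey S') z ↔
      forkKey R (Equiv.sumCongr finSumFinEquiv (finSumFinEquiv.subtypeEquiv h)
        (forkUnionEquiv S S' y)) <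
      forkKey R (Equiv.sumCongr finSumFinEquiv (finSumFinEquiv.subtypeEquiv h)
        (forkUnionEquiv S S' z)) := by
  -- the strictly monotone map that shifts the numbers of the second factor by `m`
  let f : (Fin m ×ₗ Fin 2) ⊕ (Fin n ×ₗ Fin 2) → Fin (m + n) ×ₗ Fin 2 :=
    Sum.elim (fun p => toLex (Fin.castAdd n (ofLex p).1, (ofLex p).2))
      fun p => toLex (Fin.natAdd m (ofLex p).1, (ofLex p).2)
  have hf : ∀ y, forkKey R (Equiv.sumCongr finSumFinEquiv (finSumFinEquiv.subtypeEquiv h)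
      (forkUnionEquiv S S' y)) = f (Sum.map (forkKey S) (forkKey S') y) := by
    rintro ((l | s) | (l | s)) <;> rfl
  have hlt : ∀ y z : (Fin m ×ₗ Fin 2) ⊕ (Fin n ×ₗ Fin 2),
      toLex y < toLex z ↔ f y < f z := by
    rintro (p | p) (q | q)
    · rw [Sum.Lex.inl_lt_inl_iff, Prod.Lex.lt_iff]
      simp [f, Prod.Lex.toLex_lt_toLex]
      rfl
    · refine iff_of_true (Sum.Lex.inl_lt_inr _ _) ?_
      refine Prod.Lex.toLex_lt_toLex.2 (.inl ?_)
      rw [Fin.lt_def, Fin.val_castAdd, Fin.val_natAdd]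
      omega
    · refine iff_of_false Sum.Lex.not_inr_lt_inl fun hlt => ?_
      rcases Prod.Lex.toLex_lt_toLex.1 hlt with hlt | ⟨heq, _⟩
      · rw [Fin.lt_def, Fin.val_castAdd, Fin.val_natAdd] at hlt
        omega
      · have := congrArg Fin.val heq
        rw [Fin.val_castAdd, Fin.val_natAdd] at this
        omega
    · rw [Sum.Lex.inr_lt_inr_iff, Prod.Lex.lt_iff]
      simp [f, Prod.Lex.toLex_lt_toLex]
  rw [hf, hf, ← hlt]
  rfl

/-- A product of products of curvatures is the product of all of them. -/
theorem juxtapose_splitHairs {m n : ℕ} (x : JSpace (Fin m)) (y : JSpace (Fin n)) :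
    NCWeil.juxtapose (splitHairs m x) (splitHairs n y) =
      splitHairs (m + n) (JSpace.relabel finSumFinEquiv (JSpace.union x y)) := by
  rw [splitHairs_apply, splitHairs_apply, splitHairs_apply, map_sum NCWeil.juxtapose,
    LinearMap.sum_apply]
  simp only [map_smul, map_sum, LinearMap.smul_apply, NCWeil.juxtapose_ordered]
  simp only [smul_smul]
  rw [← Fintype.sum_prod_type']
  refine Fintype.sum_equiv (Finset.sumEquiv.symm.toEquiv.trans (Equiv.finsetCongr finSumFinEquiv))
    _ _ ?_
  rintro ⟨S, S'⟩
  change _ = (-1 / 2 : ℚ) ^ (Equiv.finsetCongr finSumFinEquiv (S.disjSum S')).card •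
    NCWeil.ordered (forkKey (Equiv.finsetCongr finSumFinEquiv (S.disjSum S')))
      (forkKey_injective _) (forkGrade _) (JSpace.insert (forkContext _) _)
  have h : ∀ l, l ∈ S.disjSum S' ↔
      finSumFinEquiv l ∈ Equiv.finsetCongr finSumFinEquiv (S.disjSum S') := by simp
  have hcard : (Equiv.finsetCongr finSumFinEquiv (S.disjSum S')).card = S.card + S'.card := by
    simp
  rw [hcard, pow_add, mul_comm]
  congr 1
  set R := Equiv.finsetCongr finSumFinEquiv (S.disjSum S')
  rw [JSpace.insert_fork_relabel finSumFinEquiv (S.disjSum S') R h, JSpace.insert_fork_union,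
    NCWeil.ordered_relabel, NCWeil.ordered_relabel]
  have hg : (forkGrade R ∘ Equiv.sumCongr finSumFinEquiv (finSumFinEquiv.subtypeEquiv h)) ∘
      forkUnionEquiv S S' = Sum.elim (forkGrade S) (forkGrade S') := by
    ext z
    rw [← forkGrade_disjSum, Function.comp_apply]
    rcases forkUnionEquiv S S' z with l | s
    · simp only [Function.comp_apply, Equiv.sumCongr_apply, Sum.map_inl, forkGrade, ← h]
    · rfl
  rw [hg]
  exact LinearMap.congr_fun (NCWeil.ordered_congr _ _ (forkKey_union_lt S S' R h) _) _

end

/-! ### Grades -/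

section
variable {X A : Type} [Fintype X] [LinearOrder A]

theorem NCWeil.ordered_mem_grade (key : X → A) (hkey : Function.Injective key) (g : X → LegGrade)
    (x : JSpace X) {i : ℤ} (h : ((∑ y, (g y).deg : ℕ) : ℤ) = i) :
    NCWeil.ordered key hkey g x ∈ NCWeil.grade i := by
  refine Submodule.subset_span ⟨⟨_, g ∘ (rankBy key hkey).symm⟩,
    JSpace.relabel (rankBy key hkey) x, ?_, rfl⟩
  rw [← h]
  exact congrArg Nat.cast ((rankBy key hkey).symm.sum_comp fun y => (g y).deg)

theorem NCWeil.grade_induction {i : ℤ} {p : NCWeil → Prop} (hzero : p 0)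
    (hadd : ∀ a b, p a → p b → p (a + b)) (hsmul : ∀ (r : ℚ) a, p a → p (r • a))
    (h : ∀ n (g : Fin n → LegGrade) (x : JSpace (Fin n)), ((∑ k, (g k).deg : ℕ) : ℤ) = i →
      p (NCWeil.ordered id Function.injective_id g x)) {z : NCWeil} (hz : z ∈ NCWeil.grade i) :
    p z := by
  unfold NCWeil.grade at hz
  induction hz using Submodule.span_induction with
  | mem z hz =>
    obtain ⟨⟨n, g⟩, x, hi, rfl⟩ := hz
    rw [NCWeil.lof_eq_ordered]
    exact h n g x hi
  | zero => exact hzero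
  | add a b _ _ ha hb => exact hadd a b ha hb
  | smul r a _ ha => exact hsmul r a ha

theorem NCWeil.map_mem_grade {i j : ℤ} (f : NCWeil →ₗ[ℚ] NCWeil)
    (h : ∀ n (g : Fin n → LegGrade) (x : JSpace (Fin n)), ((∑ k, (g k).deg : ℕ) : ℤ) = i →
      f (NCWeil.ordered id Function.injective_id g x) ∈ NCWeil.grade j) {z : NCWeil}
    (hz : z ∈ NCWeil.grade i) : f z ∈ NCWeil.grade j := by
  refine NCWeil.grade_induction (p := fun z => f z ∈ NCWeil.grade j) ?_ ?_ ?_ h hz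
  · rw [map_zero]; exact zero_mem _
  · intro a b ha hb; rw [map_add]; exact add_mem ha hb
  · intro r a ha; rw [map_smul]; exact Submodule.smul_mem _ r ha

theorem NCWeil.average_mem_grade {i : ℤ} {z : NCWeil} (hz : z ∈ NCWeil.grade i) :
    NCWeil.average z ∈ NCWeil.grade i := by
  refine NCWeil.map_mem_grade _ (fun n g x hi => ?_) hz
  rw [← NCWeil.lof_eq_ordered, NCWeil.average_lof]
  refine Submodule.smul_mem _ _ (sum_mem fun π _ => Submodule.smul_mem _ _ ?_)
  rw [NCWeil.place_eq_ordered]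
  exact NCWeil.ordered_mem_grade _ _ _ _ hi

theorem NCWeil.symInitial_mem_grade {n : ℕ} (k : ℕ) (g : Fin n → LegGrade) (x : JSpace (Fin n))
    {i : ℤ} (hi : ((∑ k, (g k).deg : ℕ) : ℤ) = i) : NCWeil.symInitial k g x ∈ NCWeil.grade i := by
  unfold NCWeil.symInitial
  simp only [LinearMap.smul_apply, LinearMap.sum_apply]
  refine Submodule.smul_mem _ _ (sum_mem fun π _ => Submodule.smul_mem _ _ ?_)
  exact NCWeil.ordered_mem_grade _ _ _ _ hi

theorem NCWeil.homotopy_mem_grade {i : ℤ} {z : NCWeil} (hz : z ∈ NCWeil.grade i) :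
    NCWeil.homotopy z ∈ NCWeil.grade (i - 1) := by
  refine NCWeil.map_mem_grade _ (fun n g x hi => ?_) hz
  rw [NCWeil.homotopy_ordered]
  refine sum_mem fun k _ => ?_
  split_ifs with hk
  · have hdeg : ((∑ l, (Function.update g k .one l).deg : ℕ) : ℤ) = i - 1 := by
      rw [← hi, ← Finset.add_sum_erase _ _ (Finset.mem_univ k),
        ← Finset.add_sum_erase Finset.univ (fun l => (g l).deg) (Finset.mem_univ k)]
      rw [Function.update_self, hk, Finset.sum_congr rfl fun l hl => by
        rw [Function.update_of_ne (Finset.ne_of_mem_erase hl)]]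
      simp only [LegGrade.deg]
      push_cast
      ring
    refine Submodule.smul_mem _ _ (sub_mem ?_ ?_) <;>
      exact NCWeil.symInitial_mem_grade _ _ _ hdeg
  · exact zero_mem _

theorem NCWeil.juxtapose_mem_grade {i j : ℤ} {a b : NCWeil} (ha : a ∈ NCWeil.grade i)
    (hb : b ∈ NCWeil.grade j) : NCWeil.juxtapose a b ∈ NCWeil.grade (i + j) := by
  refine NCWeil.map_mem_grade (NCWeil.juxtapose a) (fun n g' y hj => ?_) hb
  refine NCWeil.map_mem_grade (NCWeil.juxtapose.flip _) (fun m g x hi => ?_) ha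
  rw [LinearMap.flip_apply, NCWeil.juxtapose_ordered]
  refine NCWeil.ordered_mem_grade _ _ _ _ ?_
  rw [Fintype.sum_sum_type, ← hi, ← hj, Nat.cast_add]
  rfl

theorem NCWeil.parity_of_mem_grade {i : ℤ} {z : NCWeil} (hz : z ∈ NCWeil.grade i) :
    NCWeil.parity z = (-1 : ℚ) ^ i • z := by
  refine NCWeil.grade_induction (p := fun z => NCWeil.parity z = (-1 : ℚ) ^ i • z) ?_ ?_ ?_ ?_ hz
  · rw [map_zero, smul_zero]
  · intro a b ha hb; rw [map_add, ha, hb, smul_add]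
  · intro r a ha; rw [map_smul, ha, smul_comm]
  · intro n g x hi
    rw [NCWeil.parity_ordered, Finset.prod_pow_eq_pow_sum, ← hi, zpow_natCast]

theorem splitHairs_mem_grade (n : ℕ) (x : JSpace (Fin n)) :
    splitHairs n x ∈ NCWeil.grade (2 * n) := by
  rw [splitHairs_apply]
  refine sum_mem fun S _ => Submodule.smul_mem _ _ (NCWeil.ordered_mem_grade _ _ _ _ ?_)
  have := forkGrade_sum S fun _ => 1
  simp only [mul_one, Finset.sum_const, Finset.card_univ, Fintype.card_fin, smul_eq_mul] at this
  rw [this]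
  push_cast
  rfl

end

/-! ### Homological wheeling -/

section

theorem chi_upsilon_ofLegs (n : ℕ) (x : JSpace (Fin n)) :
    Weil.chi (SymJacobi.upsilon (SymJacobi.ofLegs n x)) = NCWeil.average (splitHairs n x) := by
  unfold SymJacobi.upsilon
  rw [SymJacobi.lift_ofLegs, LinearMap.comp_apply, Weil.chi_mkQ]

theorem iota_chi_upsilon (v : SymJacobi) : NCWeil.iota (Weil.chi (SymJacobi.upsilon v)) = 0 := by
  refine LinearMap.congr_fun (f := NCWeil.iota ∘ₗ Weil.chi ∘ₗ SymJacobi.upsilon) (g := 0)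
    (SymJacobi.hom_ext fun n x => ?_) v
  rw [LinearMap.comp_apply, LinearMap.comp_apply, chi_upsilon_ofLegs, NCWeil.iota_average,
    iota_splitHairs, map_zero, LinearMap.zero_apply]

/-- Symmetrization factors through the commutative Weil complex, where curvatures are closed. -/
theorem d_chi_upsilon (v : SymJacobi) : NCWeil.d (Weil.chi (SymJacobi.upsilon v)) = 0 := by
  refine LinearMap.congr_fun (f := NCWeil.d ∘ₗ Weil.chi ∘ₗ SymJacobi.upsilon) (g := 0)
    (SymJacobi.hom_ext fun n x => ?_) v
  rw [LinearMap.comp_apply, LinearMap.comp_apply, chi_upsilon_ofLegs, NCWeil.d_average,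
    ← Weil.chi_mkQ, mk_d_splitHairs, map_zero, LinearMap.zero_apply]

theorem chi_upsilon_mem_grade {i : ℤ} {v : SymJacobi} (hv : v ∈ SymJacobi.grade i) :
    Weil.chi (SymJacobi.upsilon v) ∈ NCWeil.grade i := by
  unfold SymJacobi.grade at hv
  induction hv using Submodule.span_induction with
  | mem v hv =>
    obtain ⟨n, x, rfl, rfl⟩ := hv
    rw [chi_upsilon_ofLegs]
    exact NCWeil.average_mem_grade (splitHairs_mem_grade n x)
  | zero => rw [map_zero, map_zero]; exact zero_mem _
  | add a b _ _ ha hb => rw [map_add, map_add]; exact add_mem ha hb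
  | smul r a _ ha => rw [map_smul, map_smul]; exact Submodule.smul_mem _ r ha

theorem chi_upsilon_mem_basicCocycles {i : ℤ} {v : SymJacobi} (hv : v ∈ SymJacobi.grade i) :
    Weil.chi (SymJacobi.upsilon v) ∈ NCWeil.basicCocycles i :=
  ⟨⟨chi_upsilon_mem_grade hv, iota_chi_upsilon v⟩, d_chi_upsilon v⟩

/-- In the commutative Weil complex, `Υ` is multiplicative. -/
theorem mk_juxtapose_chi_upsilon (v w : SymJacobi) :
    permRelations.mkQ (NCWeil.juxtapose (Weil.chi (SymJacobi.upsilon v))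
      (Weil.chi (SymJacobi.upsilon w))) = SymJacobi.upsilon (SymJacobi.disjointUnion v w) := by
  have : (NCWeil.juxtapose.compl₁₂ (Weil.chi ∘ₗ SymJacobi.upsilon)
      (Weil.chi ∘ₗ SymJacobi.upsilon)).compr₂ permRelations.mkQ =
      SymJacobi.disjointUnion.compr₂ SymJacobi.upsilon := by
    refine SymJacobi.hom_ext fun m x => SymJacobi.hom_ext fun n y => ?_
    simp only [LinearMap.compr₂_apply, LinearMap.compl₁₂_apply, LinearMap.comp_apply]
    rw [chi_upsilon_ofLegs, chi_upsilon_ofLegs, Weil.mk_juxtapose_average_left,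
      Weil.mk_juxtapose_average_right, juxtapose_splitHairs, SymJacobi.disjointUnion_ofLegs]
    unfold SymJacobi.upsilon
    rw [SymJacobi.lift_ofLegs, LinearMap.comp_apply]
  exact LinearMap.congr_fun₂ this v w

theorem NCWeil.d_juxtapose_eq_zero {a b : NCWeil} (ha : NCWeil.d a = 0) (hb : NCWeil.d b = 0) :
    NCWeil.d (NCWeil.juxtapose a b) = 0 := by
  rw [NCWeil.d_juxtapose, ha, hb, map_zero, map_zero, LinearMap.zero_apply, add_zero]

theorem NCWeil.iota_juxtapose_eq_zero {a b : NCWeil} (ha : NCWeil.iota a = 0)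
    (hb : NCWeil.iota b = 0) : NCWeil.iota (NCWeil.juxtapose a b) = 0 := by
  rw [NCWeil.iota_juxtapose, ha, hb, map_zero, map_zero, LinearMap.zero_apply, add_zero]

theorem NCWeil.juxtapose_mem_basic {i j : ℤ} {a b : NCWeil} (ha : a ∈ NCWeil.basic i)
    (hb : b ∈ NCWeil.basic j) : NCWeil.juxtapose a b ∈ NCWeil.basic (i + j) :=
  ⟨NCWeil.juxtapose_mem_grade ha.1 hb.1, NCWeil.iota_juxtapose_eq_zero ha.2 hb.2⟩

/-- The homotopy exhibits the difference between a product and its symmetrization as a boundary. -/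
theorem exists_juxtapose_chi_upsilon {i j : ℤ} {v w : SymJacobi} (hv : v ∈ SymJacobi.grade i)
    (hw : w ∈ SymJacobi.grade j) : ∃ x ∈ NCWeil.basic (i + j - 1),
      NCWeil.juxtapose (Weil.chi (SymJacobi.upsilon v)) (Weil.chi (SymJacobi.upsilon w)) =
        Weil.chi (SymJacobi.upsilon (SymJacobi.disjointUnion v w)) + NCWeil.d x := by
  have h1 := NCWeil.d_juxtapose_eq_zero (d_chi_upsilon v) (d_chi_upsilon w)
  have h2 := NCWeil.iota_juxtapose_eq_zero (iota_chi_upsilon v) (iota_chi_upsilon w)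
  have h3 := NCWeil.juxtapose_mem_grade (chi_upsilon_mem_grade hv) (chi_upsilon_mem_grade hw)
  rw [← mk_juxtapose_chi_upsilon, Weil.chi_mkQ]
  set z := NCWeil.juxtapose (Weil.chi (SymJacobi.upsilon v)) (Weil.chi (SymJacobi.upsilon w))
  refine ⟨NCWeil.homotopy z, ⟨NCWeil.homotopy_mem_grade h3, ?_⟩, ?_⟩
  · change NCWeil.iota (NCWeil.homotopy z) = 0
    rw [NCWeil.iota_homotopy, h2, map_zero, neg_zero]
  · have h4 := NCWeil.d_homotopy_add_homotopy_d z
    rw [h1, map_zero, add_zero] at h4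
    rw [h4, add_sub_cancel]

/-- Two basic cocycles are cohomologous if they differ by the differential of a basic element. -/
theorem NCWeil.basicClass_eq_iff {i : ℤ} (a b : NCWeil.basicCocycles i) :
    NCWeil.basicClass i a = NCWeil.basicClass i b ↔
      ∃ x ∈ NCWeil.basic (i - 1), (a : NCWeil) = b + NCWeil.d x := by
  unfold NCWeil.basicClass
  rw [Submodule.mkQ_apply, Submodule.mkQ_apply, Submodule.Quotient.eq]
  change (a : NCWeil) - b ∈ (NCWeil.basic (i - 1)).map NCWeil.d ↔ _
  rw [Submodule.mem_map]
  refine exists_congr fun x => and_congr_right fun _ => ?_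
  rw [eq_sub_iff_add_eq, add_comm, eq_comm]

end
end Wheeling

theorem mainTheorem1 :
    (∀ (i j : ℤ) (v w : Wheeling.SymJacobi), v ∈ Wheeling.SymJacobi.grade i →
      w ∈ Wheeling.SymJacobi.grade j →
      ∃ x ∈ Wheeling.NCWeil.grade (i + j - 1), Wheeling.NCWeil.iota x = 0 ∧
        Wheeling.NCWeil.juxtapose (Wheeling.Weil.chi (Wheeling.SymJacobi.upsilon v))
            (Wheeling.Weil.chi (Wheeling.SymJacobi.upsilon w)) =
          Wheeling.Weil.chi
              (Wheeling.SymJacobi.upsilon (Wheeling.SymJacobi.disjointUnion v w)) +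
            Wheeling.NCWeil.d x) ∧
    ∃ H : ∀ i : ℤ, Wheeling.SymJacobi.grade i →ₗ[ℚ] Wheeling.NCWeil.BasicCohomology i,
      (∀ (i : ℤ) (v : Wheeling.SymJacobi.grade i),
        ∃ h : Wheeling.Weil.chi (Wheeling.SymJacobi.upsilon v) ∈ Wheeling.NCWeil.basicCocycles i,
          H i v = Wheeling.NCWeil.basicClass i ⟨_, h⟩) ∧
      ∀ (i j : ℤ) (v : Wheeling.SymJacobi.grade i) (w : Wheeling.SymJacobi.grade j),
        Wheeling.NCWeil.IsBasicProduct (H i v) (H j w)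
          (H (i + j) ⟨Wheeling.SymJacobi.disjointUnion v w,
            Wheeling.SymJacobi.disjointUnion_mem v.2 w.2⟩) := by
  open Wheeling in
  refine ⟨fun i j v w hv hw => ?_, fun i => NCWeil.basicClass i ∘ₗ
    ((Weil.chi ∘ₗ SymJacobi.upsilon) ∘ₗ (SymJacobi.grade i).subtype).codRestrict _
      fun v => chi_upsilon_mem_basicCocycles v.2,
    fun i v => ⟨chi_upsilon_mem_basicCocycles v.2, rfl⟩, fun i j v w a b ha hb => ?_⟩
  · obtain ⟨x, hx, h⟩ := exists_juxtapose_chi_upsilon hv hw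
    exact ⟨x, hx.1, hx.2, h⟩
  · obtain ⟨a', ha', ha⟩ := (NCWeil.basicClass_eq_iff a
      ⟨_, chi_upsilon_mem_basicCocycles v.2⟩).1 ha
    obtain ⟨b', hb', hb⟩ := (NCWeil.basicClass_eq_iff b
      ⟨_, chi_upsilon_mem_basicCocycles w.2⟩).1 hb
    have hab : NCWeil.juxtapose (a : NCWeil) (b : NCWeil) ∈ NCWeil.basicCocycles (i + j) :=
      ⟨NCWeil.juxtapose_mem_basic a.2.1 b.2.1, NCWeil.d_juxtapose_eq_zero a.2.2 b.2.2⟩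
    refine ⟨hab, (NCWeil.basicClass_eq_iff ⟨_, hab⟩
      ⟨_, chi_upsilon_mem_basicCocycles (SymJacobi.disjointUnion_mem v.2 w.2)⟩).2 ?_⟩
    obtain ⟨x, hx, h⟩ := exists_juxtapose_chi_upsilon v.2 w.2
    have hv := chi_upsilon_mem_basicCocycles v.2
    dsimp only at ha hb ⊢
    set v' := Weil.chi (SymJacobi.upsilon v)
    have h1 : NCWeil.juxtapose a' (b : NCWeil) ∈ NCWeil.basic (i + j - 1) := by
      rw [add_sub_right_comm]
      exact NCWeil.juxtapose_mem_basic ha' b.2.1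
    have h2 : NCWeil.juxtapose v' b' ∈ NCWeil.basic (i + j - 1) := by
      rw [add_sub_assoc]
      exact NCWeil.juxtapose_mem_basic hv.1 hb'
    -- with `a = v' + d a'` and `b = w' + d b'`, the product `a # b` is
    -- `v' # w' + d a' # b + v' # d b'`; the sign comes from moving `d` past `v'`
    refine ⟨x + NCWeil.juxtapose a' b + (-1 : ℚ) ^ i • NCWeil.juxtapose v' b',
      add_mem (add_mem hx h1) (Submodule.smul_mem _ _ h2), ?_⟩
    have hsq : (-1 : ℚ) ^ i * (-1) ^ i = 1 := by rw [← mul_zpow]; norm_num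
    have hd1 : NCWeil.d (NCWeil.juxtapose a' b) = NCWeil.juxtapose (NCWeil.d a') b := by
      rw [NCWeil.d_juxtapose, LinearMap.mem_ker.1 b.2.2, map_zero, add_zero]
    have hd2 : NCWeil.d ((-1 : ℚ) ^ i • NCWeil.juxtapose v' b') =
        NCWeil.juxtapose v' (NCWeil.d b') := by
      rw [map_smul, NCWeil.d_juxtapose, LinearMap.mem_ker.1 hv.2, map_zero, LinearMap.zero_apply,
        zero_add, NCWeil.parity_of_mem_grade hv.1.1, map_smul, LinearMap.smul_apply, smul_smul, hsq,
        one_smul]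
    rw [map_add, map_add, hd1, hd2, ← add_assoc, ← add_assoc, ← h, add_right_comm]
    nth_rewrite 1 [ha]
    rw [map_add, LinearMap.add_apply, ← map_add, ← hb]
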